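/- **Setting.** Let $(X,\Phi,Y,\Phi^\vee)$ be a reduced root datum with a base $\Pi\subseteq\Phi$ and positive roots $\Phi^+$; for instance the root datum of a connected reductive complex algebraic group $G$ relative to a maximal torus $T$ and a Borel subgroup $B\supseteq T$, with $X=X(T)$. Let $W$ be its Weyl group, with simple reflections $S=\{s_\alpha\mid\alpha\in\Pi\}$, let $W_{\mathrm{ex}}=X\rtimes W$ be the extended affine Weyl group, with translations $t_\lambda$ ($\lambda\in X$), and let $W_{\mathrm{af}}$ be the affine Weyl group, generated by $W$ and the $t_\alpha$, $\alpha\in\Phi$. Let $S_{\mathrm{af}}\supseteq S$ be the set of reflections in the walls of the fundamental alcove $\{x\mid 0<\langle x,\alpha^\vee\rangle<1\ \forall\alpha\in\Phi^+\}$, so that $(W_{\mathrm{af}},S_{\mathrm{af}})$ is a Coxeter system, and let $\Gamma\subseteq W_{\mathrm{ex}}$ be the stabilizer of this alcove, so that $W_{\mathrm{ex}}=W_{\mathrm{af}}\Gamma$ and $W_{\mathrm{af}}\cap\Gamma=1$. The length function and the Bruhat order of $W_{\mathrm{af}}$ are extended to $W_{\mathrm{ex}}$ by $\ell(y\gamma)=\ell(y)$,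 and $y\gamma\le y'\gamma'$ if and only if $\gamma=\gamma'$ and $y\le y'$, for $y,y'\in W_{\mathrm{af}}$ and $\gamma,\gamma'\in\Gamma$. Let $A=\mathbb Z[v,v^{-1}]$ and let $\mathcal H$ be the extended affine Hecke algebra: the $A$-algebra generated by elements $T_x$, $x\in W_{\mathrm{ex}}$ (they form its standard basis), with the relations $T_xT_y=T_{xy}$ if $\ell(xy)=\ell(x)+\ell(y)$, $T_s^2=v^2T_1+(v^2-1)T_s$ for $s\in S_{\mathrm{af}}$, and $T_1=1$. There is a unique ring automorphism $h\mapsto\overline h$ of $\mathcal H$ with $\overline v=v^{-1}$ and $\overline{T_x}=T_{x^{-1}}^{-1}$ for all $x\in W_{\mathrm{ex}}$; and for each $x\in W_{\mathrm{ex}}$ there is a unique $C'_x\in\mathcal H$ such that $\overline{C'_x}=C'_x$ and $$C'_x=v^{-\ell(x)}T_x+\sum_{y<x}v^{-\ell(x)}P_{y,x}T_y,$$ where each $P_{y,x}\in\mathbb Z[v]$ has degree at most $\ell(x)-\ell(y)-1$ and only finitely many of them are non-zero. For $I\subseteq S$ let $W_I=\langle I\rangle$, let $w_I$ be its longest element,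 and put $C_{w_I}=(-v)^{\ell(w_I)}\sum_{y\in W_I}(-1)^{\ell(y)}v^{-2\ell(y)}T_y$. For $I,J\subseteq S$ define $$\chi^{IJ}\colon\mathcal H\to\mathcal H,\quad\chi^{IJ}(h)=C_{w_I}hC_{w_J},\qquad\text{and}\qquad\mathcal H^{IJ}=\chi^{IJ}(\mathcal H)=C_{w_I}\mathcal HC_{w_J}.$$ Let $W^{IJ}$ be the set of minimal length $(W_I,W_J)$-double coset representatives in $W$. For $z\in W^{IJ}$ let $X_z^+$ be the set of those $\lambda\in X$ such that $\langle\lambda,\alpha^\vee\rangle\ge0$ for all $\alpha\in\Pi$ with $s_\alpha\in I\cap zJz^{-1}$. For $z\in W^{IJ}$ and $\lambda\in X_z^+$ let $m_{\lambda,z}$ be the element of minimal length in $W_It_\lambda zW_J$, and put $$T_{\lambda,z}=\chi^{IJ}(T_{m_{\lambda,z}}),\qquad C'_{\lambda,z}=\chi^{IJ}(C'_{m_{\lambda,z}}).$$ **Proposition.** Let $I,J\subseteq S$. The involution $h\mapsto\overline h$ maps $\mathcal H^{IJ}$ to itself. For every $z\in W^{IJ}$ and $\lambda\in X_z^+$,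 the element $C'_{\lambda,z}$ is the unique element $h$ of $\mathcal H^{IJ}$ that satisfies both 1. $\overline h=h$, and 2. $\displaystyle h=v^{-\ell(m_{\lambda,z})}\,T_{\lambda,z}+\sum_{m_{\lambda',z'}<m_{\lambda,z}}v^{-\ell(m_{\lambda,z})}\,P_{(\lambda',z'),(\lambda,z)}\,T_{\lambda',z'}$ for some polynomials $P_{(\lambda',z'),(\lambda,z)}\in\mathbb Z[v]$, only finitely many of them non-zero, where $P_{(\lambda',z'),(\lambda,z)}$ has degree at most $\ell(m_{\lambda,z})-\ell(m_{\lambda',z'})-1$ and the sum runs over the pairs $(\lambda',z')$ with $z'\in W^{IJ}$, $\lambda'\in X_{z'}^+$ and $m_{\lambda',z'}<m_{\lambda,z}$. -/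

import Mathlib

open scoped Polynomial

noncomputable section

namespace AffHecke

variable {ι X Y : Type*} [AddCommGroup X] [AddCommGroup Y]

/-! ### The extended affine Weyl group of a based root datum -/

/-- The action of the (finite) Weyl group `W` on the lattice `X`, written multiplicatively. -/
def weylAction (P : RootDatum ι X Y) : P.weylGroup →* MulAut (Multiplicative X) :=
  ((MulAutMultiplicative X).symm : Multiplicative (AddAut X) →* MulAut (Multiplicative X)).comp
    (DistribMulAction.toAddAut P.weylGroup X)

/-- The extended affine Weyl group `X ⋊ W`. -/
abbrev ExtWeyl (P : RootDatum ι X Y) : Type _ :=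
  Multiplicative X ⋊[weylAction P] P.weylGroup

/-- The translation `t_λ`. -/
def transl (P : RootDatum ι X Y) (lam : X) : ExtWeyl P :=
  SemidirectProduct.inl (Multiplicative.ofAdd lam)

/-- The inclusion of `W` in the extended affine Weyl group. -/
def ofW (P : RootDatum ι X Y) : P.weylGroup →* ExtWeyl P := SemidirectProduct.inr

/-- The reflection `s_i` of `W` in the root with index `i`. -/
def refl (P : RootDatum ι X Y) (i : ι) : P.weylGroup := RootPairing.weylGroup.ofIdx P i

/-- The affine Weyl group: the subgroup generated by `W` and the translations by roots. -/
def affWeyl (P : RootDatum ι X Y) : Subgroup (ExtWeyl P) :=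
  Subgroup.closure (Set.range (ofW P) ∪ Set.range fun i => transl P (P.root i))

section Based

variable {P : RootDatum ι X Y} (b : P.Base)

/-- `i` is the index of a highest coroot (of one of the irreducible components): a positive
coroot to which no simple coroot can be added. -/
def IsHighestCoroot (i : ι) : Prop :=
  b.IsPos i ∧ ∀ j ∈ b.support, P.coroot i + P.coroot j ∉ Set.range P.coroot

/-- The Coxeter generators of the affine Weyl group: the reflections in the walls of the
fundamental alcove `{x | 0 < ⟨x, α^∨⟩ < 1 for all positive α}`. They are the simple reflections
together with, for each highest coroot `θ^∨`, the reflection `t_θ s_θ` in the hyperplane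
`⟨x, θ^∨⟩ = 1`. -/
def affSimple : Set (ExtWeyl P) :=
  {s | (∃ i ∈ b.support, s = ofW P (refl P i)) ∨
    ∃ i, IsHighestCoroot b i ∧ s = transl P (P.root i) * ofW P (refl P i)}

/-- The pair `(i, k)` stands for the affine function `x ↦ ⟨x, α_i^∨⟩ + k`; this says that it is
positive on the fundamental alcove. -/
def AffPos (i : ι) (k : ℤ) : Prop := 0 < k ∨ (k = 0 ∧ b.IsPos i)

/-- The stabilizer `Γ` of the fundamental alcove: the elements `x = t_λ w` that map every affine
function `(i, k)` that is positive on the alcove to one that is again positive, where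
`(x · f)(y) = f(x⁻¹ y)`, that is, `x · (i, k) = (w i, k - ⟨λ, α_{w i}^∨⟩)`. It is a complement
of the affine Weyl group, and it normalizes `affSimple`. -/
def alcoveStab : Set (ExtWeyl P) :=
  {x | ∀ i k, AffPos b i k →
    AffPos b (P.weylGroupToPerm x.right i)
      (k - P.toLinearMap (Multiplicative.toAdd x.left)
        (P.coroot (P.weylGroupToPerm x.right i)))}

/-- The length function of the extended affine Weyl group: the length of `y γ`, with `y` in the
affine Weyl group and `γ ∈ Γ`, is the least number of factors in an expression of `y` as a product
of Coxeter generators. -/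
def length (x : ExtWeyl P) : ℕ :=
  sInf {n | ∃ l : List (ExtWeyl P), (∀ s ∈ l, s ∈ affSimple b) ∧ l.length = n ∧
    ∃ γ ∈ alcoveStab b, x = l.prod * γ}

/-- The reflections of the affine Weyl group. -/
def IsAffReflection (t : ExtWeyl P) : Prop :=
  ∃ y ∈ affWeyl P, ∃ s ∈ affSimple b, t = y * s * y⁻¹

/-- The Bruhat order on the extended affine Weyl group: it is generated by the relations `x < t x`
with `t` a reflection of the affine Weyl group and `ℓ(x) < ℓ(t x)`. Multiplication by `t` on the
left does not change the component in `Γ`, so that `y γ ≤ y' γ'` if and only if `γ = γ'` and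
`y ≤ y'` in the Bruhat order of the affine Weyl group. -/
def BruhatLE : ExtWeyl P → ExtWeyl P → Prop :=
  Relation.ReflTransGen fun x x' =>
    ∃ t, IsAffReflection b t ∧ x' = t * x ∧ length b x < length b x'

/-- The strict Bruhat order. -/
def BruhatLT (x x' : ExtWeyl P) : Prop := BruhatLE b x x' ∧ x ≠ x'

/-! ### The extended affine Hecke algebra -/

/-- The ring `A = ℤ[v, v⁻¹]`. -/
abbrev A : Type := LaurentPolynomial ℤ

/-- The power `v ^ n`. -/
abbrev v (n : ℤ) : A := LaurentPolynomial.T n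

/-- The defining relations of the extended affine Hecke algebra between the generators `T_x`. -/
inductive HeckeRel : FreeAlgebra A (ExtWeyl P) → FreeAlgebra A (ExtWeyl P) → Prop
  | one : HeckeRel (FreeAlgebra.ι A 1) 1
  | mul (x y : ExtWeyl P) (h : length b (x * y) = length b x + length b y) :
      HeckeRel (FreeAlgebra.ι A x * FreeAlgebra.ι A y) (FreeAlgebra.ι A (x * y))
  | sq (s : ExtWeyl P) (h : s ∈ affSimple b) :
      HeckeRel (FreeAlgebra.ι A s * FreeAlgebra.ι A s)
        (v 2 • FreeAlgebra.ι A 1 + (v 2 - 1) • FreeAlgebra.ι A s)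

/-- The extended affine Hecke algebra. -/
abbrev Hecke : Type _ := RingQuot (HeckeRel b)

/-- The standard basis element `T_x`. -/
def stdT (x : ExtWeyl P) : Hecke b := RingQuot.mkAlgHom A (HeckeRel b) (FreeAlgebra.ι A x)

/-- The defining property of the bar involution: it is the ring automorphism with `v ↦ v⁻¹` and
`T_x ↦ (T_{x⁻¹})⁻¹`. -/
structure IsBar (f : Hecke b ≃+* Hecke b) : Prop where
  map_scalar (a : A) : f (algebraMap A (Hecke b) a) =
    algebraMap A (Hecke b) (LaurentPolynomial.invert a)
  map_mul_eq_one (x : ExtWeyl P) : f (stdT b x) * stdT b x⁻¹ = 1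
  mul_map_eq_one (x : ExtWeyl P) : stdT b x⁻¹ * f (stdT b x) = 1

/-- The bar involution of the Hecke algebra: the ring automorphism with the property `IsBar`. -/
def bar : Hecke b ≃+* Hecke b := Classical.epsilon (IsBar b)

/-- The defining property of the Kazhdan-Lusztig element `C'_x`. The family of polynomials `p` is
finitely supported; its members are `P_{y,x}`, polynomials in `v`. -/
def IsKL (x : ExtWeyl P) (c : Hecke b) : Prop :=
  bar b c = c ∧
    ∃ p : ExtWeyl P →₀ ℤ[X],
      (∀ y ∈ p.support, BruhatLT b y x ∧ (p y).natDegree + length b y + 1 ≤ length b x) ∧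
      c = v (-(length b x : ℤ)) • stdT b x +
        p.sum fun y q => (v (-(length b x : ℤ)) * Polynomial.toLaurent q) • stdT b y

/-- The Kazhdan-Lusztig basis element `C'_x`. -/
def klC' (x : ExtWeyl P) : Hecke b := Classical.epsilon (IsKL b x)

/-! ### Parabolic subgroups and the space `H^{IJ}` -/

/-- The parabolic subgroup `W_I` generated by the reflections in the roots indexed by `I`. -/
def parab (P : RootDatum ι X Y) (I : Set ι) : Subgroup P.weylGroup :=
  Subgroup.closure (refl P '' I)

/-- The length of the longest element `w_I` of the finite group `W_I`. -/
def longestLength (I : Set ι) : ℕ := ⨆ y : parab P I, length b (ofW P y)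

/-- The element `C_{w_I} = (-v)^{ℓ(w_I)} ∑_{y ∈ W_I} (-1)^{ℓ(y)} v^{-2ℓ(y)} T_y`. -/
def parabC (I : Set ι) : Hecke b :=
  ((-v 1) ^ longestLength b I) •
    ∑ᶠ y : parab P I, ((-1) ^ length b (ofW P y) * v (-2 * (length b (ofW P y) : ℤ))) •
      stdT b (ofW P y)

/-- The map `χ^{IJ} : h ↦ C_{w_I} h C_{w_J}`. -/
def chi (I J : Set ι) : Hecke b →ₗ[A] Hecke b :=
  LinearMap.mulLeftRight A (parabC b I, parabC b J)

/-- The `A`-module `H^{IJ} = C_{w_I} H C_{w_J}`. -/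
def HIJ (I J : Set ι) : Submodule A (Hecke b) := LinearMap.range (chi b I J)

/-- The set `W^{IJ}` of the minimal length `(W_I, W_J)`-double coset representatives in `W`. -/
def minReps (I J : Set ι) : Set P.weylGroup :=
  {z | ∀ u ∈ parab P I, ∀ u' ∈ parab P J, length b (ofW P z) ≤ length b (ofW P (u * z * u'))}

/-- The set `X_z^+`: the elements of `X` that are dominant for the simple roots `α ∈ I` with
`s_α ∈ z J z⁻¹`. -/
def domWeights (P : RootDatum ι X Y) (I J : Set ι) (z : P.weylGroup) : Set X :=
  {lam | ∀ i ∈ I, (∃ j ∈ J, refl P i = z * refl P j * z⁻¹) →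
    0 ≤ P.toLinearMap lam (P.coroot i)}

/-- The index set of the bases of `H^{IJ}`: the pairs `(λ, z)` with `z ∈ W^{IJ}`, `λ ∈ X_z^+`. -/
abbrev Index (I J : Set ι) : Type _ :=
  {a : X × P.weylGroup // a.2 ∈ minReps b I J ∧ a.1 ∈ domWeights P I J a.2}

/-- The double coset `W_I t_λ z W_J`. -/
def dblCoset (P : RootDatum ι X Y) (I J : Set ι) (lam : X) (z : P.weylGroup) :
    Set (ExtWeyl P) :=
  {x | ∃ u ∈ parab P I, ∃ u' ∈ parab P J, x = ofW P u * (transl P lam * ofW P z) * ofW P u'}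

theorem dblCoset_nonempty (P : RootDatum ι X Y) (I J : Set ι) (lam : X) (z : P.weylGroup) :
    (dblCoset P I J lam z).Nonempty :=
  ⟨_, 1, one_mem _, 1, one_mem _, rfl⟩

variable {b} in
/-- The element `m_{λ,z}` of minimal length in the double coset `W_I t_λ z W_J`. -/
def minElt {I J : Set ι} (a : Index b I J) : ExtWeyl P :=
  Function.argminOn (length b) (dblCoset P I J a.1.1 a.1.2)
    (dblCoset_nonempty P I J a.1.1 a.1.2)

variable {b} in
/-- The standard basis element `T_{λ,z} = χ^{IJ}(T_{m_{λ,z}})` of `H^{IJ}`. -/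
def stdTIJ {I J : Set ι} (a : Index b I J) : Hecke b := chi b I J (stdT b (minElt a))

variable {b} in
/-- The Kazhdan-Lusztig basis element `C'_{λ,z} = χ^{IJ}(C'_{m_{λ,z}})` of `H^{IJ}`. -/
def klC'IJ {I J : Set ι} (a : Index b I J) : Hecke b := chi b I J (klC' b (minElt a))

variable {b} in
/-- The two properties that characterize `C'_{λ,z}` in `H^{IJ}`: `h` is self-dual, and
`h = v^{-ℓ(m)} T_{λ,z} + ∑ v^{-ℓ(m)} P T_{λ',z'}`, where `m = m_{λ,z}`, the (finite) sum is over
pairs with `m' = m_{λ',z'} < m`, and each `P` is a polynomial in `v` of degree at most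
`ℓ(m) - ℓ(m') - 1`. -/
def IsKLIJ {I J : Set ι} (a : Index b I J) (h : Hecke b) : Prop :=
  bar b h = h ∧
    ∃ p : Index b I J →₀ ℤ[X],
      (∀ a' ∈ p.support, BruhatLT b (minElt a') (minElt a) ∧
        (p a').natDegree + length b (minElt a') + 1 ≤ length b (minElt a)) ∧
      h = v (-(length b (minElt a) : ℤ)) • stdTIJ a +
        p.sum fun a' q =>
          (v (-(length b (minElt a) : ℤ)) * Polynomial.toLaurent q) • stdTIJ a'

end Based

end AffHecke

end

/-! The heart of the matter is the Kazhdan-Lusztig lemma `eq_zero_of_selfDual`. Suppose that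
elements `e n` are independent and that duality sends `e n` to `v^(-2 l n) e n` plus terms of
smaller `l`. Then a self-dual combination whose coefficients, multiplied by `v^(l n)`, involve only
negative powers of `v` is zero: at a term of maximal `l` the normalized coefficient is fixed by `v ↦
v⁻¹`. The lemma gives uniqueness twice, for the basis `T_x` and for the elements `C_{w_I} T_m
C_{w_J}` with `m` minimal in its double coset.

Since `T_s C_{w_I} = -C_{w_I}` for `s` in `I`, and likewise on the right for `J`, the element
`C_{w_I} T_y C_{w_J}` depends on `y` only up to sign inside a double coset (`IsParC.mul_T_mul`). It
is supported on that coset and non-zero, whence independence (`IsParC.linearIndependent`). The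
element `C_{w_I}` is self-dual (`IsParC.map_eq`), so `χ` commutes with duality and carries the
triangularity of the `T_x` over to these elements.

Applying `χ` to `C'_m` turns a term `T_y`, `y < m`, into plus or minus the standard element of some
`m'`, where `m' ≤ y` because a minimal element lies below its whole double coset
(`le_of_mem_doubleCoset`, from the lifting property). Hence both the Bruhat condition and the degree
bound survive, which gives existence (`IsParC.isKLIJ`). The pairs `(λ, z)` only have to reach every
double coset (`exists_index`). Whether two pairs could share a coset is immaterial, since `h` is
claimed to be unique and the polynomials are not.

The combinatorics is done in a `RefSys`, where length is the number of inversions. Its axioms hold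
for the extended affine Weyl group by properties of highest coroots, and the word length and Bruhat
order of the statement agree with the abstract ones (`length_eq_len`, `bruhatLE_eq_le`). The `T_x`
are independent because the algebra given by generators and relations acts on the free module on the
group (`exists_regular_rep`). -/

noncomputable section

/-! ### Reflection systems -/

/-- A group `G` acting on a set `R` of (affine) roots with a notion of positivity, where each root
`a` has a reflection `r a`, and the reflection in a simple root `a` permutes the positive roots
other than `a`. This is an abstraction of an extended affine Weyl group. -/
structure RefSys (G R : Type*) [Group G] [MulAction G R] where
  neg : R → R
  pos : R → Prop
  simple : Set R
  r : R → G
  smul_negRoot : ∀ (x : G) a, x • neg a = neg (x • a)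
  pos_neg : ∀ a, pos (neg a) ↔ ¬ pos a
  r_smul : ∀ (x : G) a, r (x • a) = x * r a * x⁻¹
  r_self : ∀ a, r a • a = neg a
  r_mul_self : ∀ a, r a * r a = 1
  simple_pos : ∀ a ∈ simple, pos a
  simple_perm : ∀ a ∈ simple, ∀ c, pos c → c ≠ a → pos (r a • c)
  pos_of_simple : ∀ x : G, (∀ a ∈ simple, pos (x • a)) → ∀ c, pos c → pos (x • c)
  finite_inv : ∀ x : G, {c | pos c ∧ ¬ pos (x • c)}.Finite

namespace RefSys

variable {G R : Type*} [Group G] [MulAction G R] (D : RefSys G R)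

/-- The set of positive roots that are made negative by `x`. -/
def inversions (x : G) : Set R := {c | D.pos c ∧ ¬ D.pos (x • c)}

/-- The length of `x`: the number of its inversions. -/
def len (x : G) : ℕ := (D.inversions x).ncard

/-- The Bruhat order. -/
def Le : G → G → Prop :=
  Relation.ReflTransGen fun x x' => ∃ a, x' = D.r a * x ∧ D.len x < D.len x'

/-- The strict Bruhat order. -/
def Lt (x y : G) : Prop := D.Le x y ∧ x ≠ y

/-- The parabolic subgroup generated by the reflections in `I`. -/
def par (I : Set R) : Subgroup G := Subgroup.closure (D.r '' I)

/-- The product of the reflections in the roots of a list. -/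
def wprod (l : List R) : G := (l.map D.r).prod

@[simp] theorem wprod_nil : D.wprod [] = 1 := rfl

@[simp] theorem wprod_cons (a : R) (l : List R) : D.wprod (a :: l) = D.r a * D.wprod l := by
  simp [wprod]

theorem r_inv (a : R) : (D.r a)⁻¹ = D.r a := inv_eq_of_mul_eq_one_left (D.r_mul_self a)

@[simp] theorem r_mul_r_mul (a : R) (x : G) : D.r a * (D.r a * x) = x := by
  rw [← mul_assoc, D.r_mul_self, one_mul]

@[simp] theorem mul_r_mul_r (a : R) (x : G) : x * D.r a * D.r a = x := by
  rw [mul_assoc, D.r_mul_self, mul_one]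

@[simp] theorem r_smul_r_smul (a c : R) : D.r a • D.r a • c = c := by
  rw [smul_smul, D.r_mul_self, one_smul]

theorem neg_negRoot (a : R) : D.neg (D.neg a) = a := by
  rw [← D.r_self a, ← D.smul_negRoot, ← D.r_self a, r_smul_r_smul]

theorem r_neg (a : R) : D.r (D.neg a) = D.r a := by
  rw [← D.r_self a, D.r_smul, D.r_inv, mul_r_mul_r]

theorem inversions_finite (x : G) : (D.inversions x).Finite := D.finite_inv x

theorem smul_inv_r_mul (a : R) (x : G) : (D.r a * x)⁻¹ • a = D.neg (x⁻¹ • a) := by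
  rw [mul_inv_rev, D.r_inv, mul_smul, D.r_self, D.smul_negRoot]

theorem smul_mul_r (a : R) (x : G) : (x * D.r a) • a = D.neg (x • a) := by
  rw [mul_smul, D.r_self, D.smul_negRoot]

/-- The map `c ↦ -(x c)` is a bijection from the inversions of `x` to those of `x⁻¹`. -/
theorem len_inv (x : G) : D.len x⁻¹ = D.len x := by
  symm
  refine Set.ncard_congr (fun c _ => D.neg (x • c)) ?_ ?_ ?_
  · intro c hc
    refine ⟨(D.pos_neg _).2 hc.2, ?_⟩
    rw [D.smul_negRoot, inv_smul_smul, D.pos_neg, not_not]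
    exact hc.1
  · intro c d _ _ h
    have := congrArg D.neg h
    rw [D.neg_negRoot, D.neg_negRoot] at this
    exact smul_left_cancel x this
  · intro c hc
    refine ⟨D.neg (x⁻¹ • c), ⟨(D.pos_neg _).2 hc.2, ?_⟩, ?_⟩
    · rw [D.smul_negRoot, smul_inv_smul, D.pos_neg, not_not]
      exact hc.1
    · rw [D.smul_negRoot, smul_inv_smul, D.neg_negRoot]

/-! ### Length and multiplication by reflections -/

variable {D}

/-- As `r a` permutes the positive roots other than `a`, the inversions of `x * r a` are `a` and the
`r a`-images of the inversions of `x`. -/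
theorem len_mul_r {a : R} (ha : a ∈ D.simple) {x : G} (h : D.pos (x • a)) :
    D.len (x * D.r a) = D.len x + 1 := by
  have hna : ¬ D.pos (D.r a • a) := by
    rw [D.r_self, D.pos_neg, not_not]; exact D.simple_pos a ha
  have key : D.inversions (x * D.r a) = insert a ((fun c => D.r a • c) '' D.inversions x) := by
    ext c
    simp only [Set.mem_insert_iff, Set.mem_image]
    constructor
    · rintro ⟨h1, h2⟩
      by_cases hc : c = a
      · exact Or.inl hc
      · exact Or.inr ⟨D.r a • c, ⟨D.simple_perm a ha c h1 hc, by rwa [← mul_smul]⟩, by simp⟩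
    · rintro (rfl | ⟨d, ⟨h1, h2⟩, rfl⟩)
      · refine ⟨D.simple_pos c ha, ?_⟩
        rw [D.smul_mul_r, D.pos_neg, not_not]; exact h
      · refine ⟨D.simple_perm a ha d h1 ?_, ?_⟩
        · rintro rfl; exact h2 h
        · rwa [mul_smul, r_smul_r_smul]
  rw [len, key, Set.ncard_insert_of_notMem _ ((D.inversions_finite x).image _),
    Set.ncard_image_of_injective _ (MulAction.injective _)]
  · rfl
  · rintro ⟨d, ⟨h1, h2⟩, h3⟩
    have : d = D.r a • a := (D.r_smul_r_smul a d).symm.trans (congrArg (D.r a • ·) h3)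
    exact hna (this ▸ h1)

theorem len_mul_r_of_not {a : R} (ha : a ∈ D.simple) {x : G} (h : ¬ D.pos (x • a)) :
    D.len (x * D.r a) + 1 = D.len x := by
  have := len_mul_r (x := x * D.r a) ha (by rw [D.smul_mul_r, D.pos_neg]; exact h)
  rw [mul_r_mul_r] at this
  exact this.symm

theorem len_r_mul {a : R} (ha : a ∈ D.simple) {x : G} (h : D.pos (x⁻¹ • a)) :
    D.len (D.r a * x) = D.len x + 1 := by
  rw [← D.len_inv, ← D.len_inv x, mul_inv_rev, D.r_inv, len_mul_r ha h]

theorem len_r_mul_of_not {a : R} (ha : a ∈ D.simple) {x : G} (h : ¬ D.pos (x⁻¹ • a)) :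
    D.len (D.r a * x) + 1 = D.len x := by
  rw [← D.len_inv, ← D.len_inv x, mul_inv_rev, D.r_inv, len_mul_r_of_not ha h]

theorem len_r_mul_le {a : R} (ha : a ∈ D.simple) (x : G) : D.len (D.r a * x) ≤ D.len x + 1 := by
  by_cases h : D.pos (x⁻¹ • a)
  · exact (len_r_mul ha h).le
  · have := len_r_mul_of_not ha h; omega

theorem len_eq_zero_iff {x : G} : D.len x = 0 ↔ ∀ c, D.pos c → D.pos (x • c) := by
  rw [len, Set.ncard_eq_zero (D.inversions_finite x), Set.eq_empty_iff_forall_notMem]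
  simp [inversions]

@[simp] theorem len_one : D.len 1 = 0 := len_eq_zero_iff.2 fun c hc => by simpa using hc

theorem len_r {a : R} (ha : a ∈ D.simple) : D.len (D.r a) = 1 := by
  have := len_r_mul (x := 1) ha (by simpa using D.simple_pos a ha)
  simpa using this

theorem pos_smul_iff_of_len_eq_zero {x : G} (hx : D.len x = 0) (c : R) :
    D.pos (x • c) ↔ D.pos c := by
  refine ⟨fun h => ?_, len_eq_zero_iff.1 hx c⟩
  by_contra hc
  have := len_eq_zero_iff.1 hx (D.neg c) ((D.pos_neg c).2 hc)
  rw [D.smul_negRoot, D.pos_neg] at this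
  exact this h

theorem len_mul_of_len_eq_zero {x γ : G} (hγ : D.len γ = 0) : D.len (γ * x) = D.len x := by
  unfold len
  congr 1
  ext c
  simp only [inversions, Set.mem_ofPred_eq, mul_smul, pos_smul_iff_of_len_eq_zero hγ]

theorem len_mul_of_len_eq_zero' {x γ : G} (hγ : D.len γ = 0) : D.len (x * γ) = D.len x := by
  rw [← D.len_inv, mul_inv_rev, len_mul_of_len_eq_zero (by rwa [D.len_inv]), D.len_inv]

theorem exists_descent {x : G} (hx : D.len x ≠ 0) : ∃ a ∈ D.simple, ¬ D.pos (x⁻¹ • a) := by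
  by_contra! h
  exact hx (by rw [← D.len_inv]; exact len_eq_zero_iff.2 (D.pos_of_simple _ h))

variable (D) in
-- Removing left descents lowers the length one at a time. The base case covers all elements of
-- length zero, not only `1`: they play the role of the alcove stabilizer.
theorem induction_left {p : G → Prop} (h0 : ∀ x, D.len x = 0 → p x)
    (h1 : ∀ a ∈ D.simple, ∀ x, D.pos (x⁻¹ • a) → p x → p (D.r a * x)) (x : G) : p x := by
  induction hn : D.len x generalizing x with
  | zero => exact h0 x hn
  | succ n ih =>
    obtain ⟨a, ha, hx⟩ := exists_descent (D := D) (x := x) (by omega)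
    have h2 := len_r_mul_of_not ha hx
    have := h1 a ha (D.r a * x) (by rw [D.smul_inv_r_mul, D.pos_neg]; exact hx) (ih _ (by omega))
    simpa using this

/-- If `x` and `sxt` agree in length while `sx` and `xt` are longer, then `sx = xt`. -/
theorem r_mul_eq_mul_r {a c : R} (ha : a ∈ D.simple) {x : G}
    (h1 : D.pos (x • c)) (h2 : ¬ D.pos ((D.r a * x) • c)) : D.r a * x = x * D.r c := by
  have : x • c = a := by
    by_contra h
    exact h2 (by rw [mul_smul]; exact D.simple_perm a ha _ h1 h)
  rw [← this, D.r_smul, inv_mul_cancel_right]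

/-- The geometric criterion for an arbitrary reflection, not just a simple one. A simple left factor
`r c` of `x` is moved past `r a` at the price of replacing `a` by `r c • a`, which stays positive
unless `a = c`. -/
theorem len_reflection_lt {a : R} (ha : D.pos a) {x : G} (h : ¬ D.pos (x⁻¹ • a)) :
    D.len (D.r a * x) < D.len x := by
  induction x using D.induction_left generalizing a with
  | h0 x hx =>
    rw [pos_smul_iff_of_len_eq_zero (by rwa [D.len_inv])] at h
    exact absurd ha h
  | h1 c hc x hx ih =>
    have hl := len_r_mul hc hx
    by_cases hac : a = c
    · subst hac; rw [r_mul_r_mul]; omega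
    · have h3 := ih (D.simple_perm c hc a ha hac) (by
        rwa [← mul_smul, ← D.r_inv c, ← mul_inv_rev])
      have h4 : D.r a * (D.r c * x) = D.r c * (D.r (D.r c • a) * x) := by
        rw [D.r_smul, D.r_inv]; simp only [mul_assoc, r_mul_r_mul]
      rw [h4, hl]
      have := len_r_mul_le hc (D.r (D.r c • a) * x)
      omega

theorem lt_len_reflection {a : R} (ha : D.pos a) {x : G} (h : D.pos (x⁻¹ • a)) :
    D.len x < D.len (D.r a * x) := by
  have := len_reflection_lt (x := D.r a * x) ha (by
    rw [D.smul_inv_r_mul, D.pos_neg, not_not]; exact h)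
  rwa [r_mul_r_mul] at this

/-! ### The Bruhat order and the lifting property -/

theorem Le.refl (x : G) : D.Le x x := Relation.ReflTransGen.refl

theorem Le.trans {x y z : G} (h : D.Le x y) (h' : D.Le y z) : D.Le x z :=
  Relation.ReflTransGen.trans h h'

theorem Le.reflection {a : R} {x : G} (h : D.len x < D.len (D.r a * x)) : D.Le x (D.r a * x) :=
  Relation.ReflTransGen.single ⟨a, rfl, h⟩

theorem Le.r_mul {a : R} (ha : a ∈ D.simple) {x : G} (h : D.pos (x⁻¹ • a)) :
    D.Le x (D.r a * x) := .reflection (lt_len_reflection (D.simple_pos a ha) h)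

theorem Le.len_le {x y : G} (h : D.Le x y) : D.len x ≤ D.len y := by
  induction h with
  | refl => rfl
  | tail _ h ih => obtain ⟨a, _, h⟩ := h; omega

theorem Le.eq_or_len_lt {x y : G} (h : D.Le x y) : x = y ∨ D.len x < D.len y := by
  induction h with
  | refl => exact .inl rfl
  | tail h' h ih =>
    obtain ⟨a, _, h⟩ := h
    have := Le.len_le h'
    right; omega

theorem Lt.len_lt {x y : G} (h : D.Lt x y) : D.len x < D.len y :=
  h.1.eq_or_len_lt.resolve_left h.2

theorem Lt.of_len_lt {x y : G} (h : D.Le x y) (h' : D.len x < D.len y) : D.Lt x y :=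
  ⟨h, by rintro rfl; exact absurd h' (lt_irrefl _)⟩

theorem Lt.trans_le {x y z : G} (h : D.Lt x y) (h' : D.Le y z) : D.Lt x z :=
  .of_len_lt (h.1.trans h') (h.len_lt.trans_le h'.len_le)

theorem Le.trans_lt {x y z : G} (h : D.Le x y) (h' : D.Lt y z) : D.Lt x z :=
  .of_len_lt (h.trans h'.1) (h.len_le.trans_lt h'.len_lt)

/-- Left and right reflections generate the same order, because `(r a * y)⁻¹ = r (y⁻¹ • a) * y⁻¹`.
This converts left-handed statements into right-handed ones. -/
theorem Le.inv {x y : G} (h : D.Le x y) : D.Le x⁻¹ y⁻¹ := by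
  induction h with
  | refl => exact .refl _
  | @tail y z _ h ih =>
    obtain ⟨a, rfl, h⟩ := h
    refine ih.trans ?_
    have : (D.r a * y)⁻¹ = D.r (y⁻¹ • a) * y⁻¹ := by
      rw [D.r_smul, mul_inv_rev, D.r_inv]; group
    rw [this]
    refine .reflection ?_
    rw [← this, D.len_inv, D.len_inv]; exact h

/-- The positive one of `a` and `-a` has the same reflection. -/
theorem exists_pos (a : R) : ∃ c, D.pos c ∧ D.r c = D.r a := by
  by_cases h : D.pos a
  · exact ⟨a, h, rfl⟩
  · exact ⟨D.neg a, (D.pos_neg a).2 h, D.r_neg a⟩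

/-- Left multiplication by a simple reflection preserves the relation `y < r c * y`, unless `r c`
is that simple reflection. -/
theorem reflection_step {a : R} (ha : a ∈ D.simple) {c : R} {y : G}
    (h : D.len y < D.len (D.r c * y)) :
    D.r c = D.r a ∨ D.Le (D.r a * y) (D.r a * (D.r c * y)) := by
  obtain ⟨d, hd, hdc⟩ := exists_pos (D := D) c
  rw [← hdc] at h ⊢
  by_cases hda : d = a
  · exact .inl (by rw [hda])
  right
  have hp : D.pos (y⁻¹ • d) := by
    by_contra h'
    have := len_reflection_lt hd h'
    omega
  have h4 : D.r a * (D.r d * y) = D.r (D.r a • d) * (D.r a * y) := by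
    rw [D.r_smul, D.r_inv]; simp only [mul_assoc, r_mul_r_mul]
  rw [h4]
  refine .reflection (lt_len_reflection (D.simple_perm a ha d hd hda) ?_)
  rwa [mul_inv_rev, D.r_inv, mul_smul, r_smul_r_smul]

/-- Multiplying a chain from `y` up to `x` by a simple reflection `s` keeps every step upward,
except a step by `s` itself. At such a step `s y` is already a member of the chain. -/
theorem Le.r_mul_or {a : R} (ha : a ∈ D.simple) {x y : G} (h : D.Le y x) :
    D.Le (D.r a * y) x ∨ D.Le (D.r a * y) (D.r a * x) := by
  induction h using Relation.ReflTransGen.head_induction_on with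
  | refl => exact .inr (.refl _)
  | @head y z h h' ih =>
    obtain ⟨c, rfl, h⟩ := h
    rcases reflection_step ha h with hc | hc
    · rw [← hc]; exact .inl h'
    · exact ih.imp hc.trans hc.trans

/-- If `y ≤ x < s x`, then `y, s y ≤ s x`. -/
theorem Le.r_mul_r_mul {a : R} (ha : a ∈ D.simple) {x y : G} (h : D.Le y x)
    (hx : D.pos (x⁻¹ • a)) : D.Le (D.r a * y) (D.r a * x) :=
  (h.r_mul_or ha).elim (fun h => h.trans (Le.r_mul ha hx)) id

/-- The lifting property for a descent `s` of `x`, by descending along the chain. If `s` is not a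
descent of `y`, then `y ≤ s y`, so `y` passes below `s x` together with `s y`. -/
theorem Le.lift {a : R} (ha : a ∈ D.simple) {x y : G} (h : D.Le y x) (hx : ¬ D.pos (x⁻¹ • a)) :
    D.Le y (D.r a * x) ∨ (¬ D.pos (y⁻¹ • a) ∧ D.Le (D.r a * y) (D.r a * x)) := by
  induction h using Relation.ReflTransGen.head_induction_on with
  | refl => exact .inr ⟨hx, .refl _⟩
  | @head y z h h' ih =>
    obtain ⟨c, rfl, h⟩ := h
    rcases ih with ih | ⟨ih1, ih2⟩
    · exact .inl ((Le.reflection h).trans ih)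
    · by_cases hy : D.pos (y⁻¹ • a)
      · left
        rcases reflection_step ha h with hc | hc
        · rw [hc, RefSys.r_mul_r_mul] at ih2; exact ih2
        · exact ((Le.r_mul ha hy).trans hc).trans ih2
      · right
        refine ⟨hy, ?_⟩
        rcases reflection_step ha h with hc | hc
        · rw [hc, RefSys.r_mul_r_mul] at ih2
          have := Le.r_mul (x := D.r a * y) ha (by rw [D.smul_inv_r_mul, D.pos_neg]; exact hy)
          rw [RefSys.r_mul_r_mul] at this
          exact this.trans ih2
        · exact hc.trans ih2

/-! ### Exchange, parabolic subgroups and double cosets -/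

theorem wprod_len_le {l : List R} (hl : ∀ a ∈ l, a ∈ D.simple) : D.len (D.wprod l) ≤ l.length := by
  induction l with
  | nil => simp
  | cons a l ih =>
    rw [wprod_cons, List.length_cons]
    have := len_r_mul_le (hl a (by simp)) (D.wprod l)
    have := ih fun c hc => hl c (by simp [hc])
    omega

/-- Applying the letters in turn to `a`, the sign first changes at a letter whose simple root has
been reached; multiplying by `r a` deletes that letter. Neither is `a` assumed simple nor `l`
reduced. -/
theorem exchange {l : List R} (hl : ∀ c ∈ l, c ∈ D.simple) {a : R} (ha : D.pos a)
    (h : ¬ D.pos ((D.wprod l)⁻¹ • a)) :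
    ∃ l', (∀ c ∈ l', c ∈ l) ∧ l'.length + 1 = l.length ∧ D.r a * D.wprod l = D.wprod l' := by
  induction l generalizing a with
  | nil => simp [ha] at h
  | cons s t ih =>
    by_cases has : a = s
    · subst has
      exact ⟨t, fun c hc => by simp [hc], rfl, by simp⟩
    · have hs : s ∈ D.simple := hl s (by simp)
      obtain ⟨t', h1, h2, h3⟩ := ih (fun c hc => hl c (by simp [hc]))
        (D.simple_perm s hs a ha has) (by
          rwa [wprod_cons, mul_inv_rev, D.r_inv, mul_smul] at h)
      refine ⟨s :: t', ?_, by simp [h2], ?_⟩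
      · intro c hc
        rcases List.mem_cons.1 hc with rfl | hc
        · simp
        · simp [h1 c hc]
      · rw [wprod_cons, wprod_cons, ← h3, D.r_smul, D.r_inv]
        simp only [mul_assoc, r_mul_r_mul]

theorem par_induction {I : Set R} {p : G → Prop} (h1 : p 1)
    (h : ∀ a ∈ I, ∀ x ∈ D.par I, p x → p (D.r a * x)) {x : G} (hx : x ∈ D.par I) : p x := by
  induction hx using Subgroup.closure_induction_left with
  | one => exact h1
  | mul_left x hx y hy ih => obtain ⟨a, ha, rfl⟩ := hx; exact h a ha y hy ih
  | inv_mul_cancel x hx y hy ih =>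
    obtain ⟨a, ha, rfl⟩ := hx; rw [D.r_inv]; exact h a ha y hy ih

theorem r_mem_par {I : Set R} {a : R} (ha : a ∈ I) : D.r a ∈ D.par I :=
  Subgroup.subset_closure ⟨a, ha, rfl⟩

/-- Exchange only deletes letters, so a word in `I` can be shortened without leaving `I`, down to
the length taken in the whole group. -/
theorem exists_reduced {I : Set R} (hI : I ⊆ D.simple) {x : G} (hx : x ∈ D.par I) :
    ∃ l : List R, (∀ a ∈ l, a ∈ I) ∧ D.wprod l = x ∧ l.length = D.len x := by
  refine par_induction (p := fun x => ∃ l : List R, (∀ a ∈ l, a ∈ I) ∧ D.wprod l = x ∧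
    l.length = D.len x) ⟨[], by simp⟩ ?_ hx
  · intro a ha x hx ih
    obtain ⟨l, h1, rfl, h3⟩ := ih
    by_cases h : D.pos ((D.wprod l)⁻¹ • a)
    · refine ⟨a :: l, ?_, by simp, ?_⟩
      · intro c hc
        rcases List.mem_cons.1 hc with rfl | hc
        · exact ha
        · exact h1 c hc
      · rw [len_r_mul (hI ha) h, List.length_cons, h3]
    · obtain ⟨l', h4, h5, h6⟩ := exchange (fun c hc => hI (h1 c hc)) (D.simple_pos a (hI ha)) h
      refine ⟨l', fun c hc => h1 c (h4 c hc), h6.symm, ?_⟩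
      have := len_r_mul_of_not (hI ha) h
      omega

theorem exists_descent_par {I : Set R} (hI : I ⊆ D.simple) {x : G} (hx : x ∈ D.par I)
    (h : x ≠ 1) : ∃ a ∈ I, ¬ D.pos (x⁻¹ • a) := by
  obtain ⟨l, h1, rfl, h3⟩ := exists_reduced hI hx
  cases l with
  | nil => simp at h
  | cons a l =>
    refine ⟨a, h1 a (by simp), fun hp => ?_⟩
    have ha := hI (h1 a (by simp))
    have h4 := len_r_mul ha hp
    rw [wprod_cons, r_mul_r_mul] at h4
    have h5 := wprod_len_le (D := D) (l := l) fun c hc => hI (h1 c (by simp [hc]))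
    rw [List.length_cons] at h3
    rw [wprod_cons] at h3
    omega

theorem par_finite {I : Set R} (hI : I ⊆ D.simple) (hfin : I.Finite) {n : ℕ}
    (hn : ∀ x ∈ D.par I, D.len x ≤ n) : (D.par I : Set G).Finite := by
  have := hfin.to_subtype
  refine ((List.finite_length_le I n).image fun l => D.wprod (l.map (↑))).subset ?_
  intro x hx
  obtain ⟨l, h1, rfl, h3⟩ := exists_reduced hI hx
  lift l to List I using h1
  refine ⟨l, ?_, rfl⟩
  have := hn _ hx
  rw [← h3] at this
  simpa using this

/-- By the lifting property, `m ≤ x` persists when `x` is multiplied on the left by `r a` with `a ∈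
I`: if this goes down, the second alternative of `Le.lift` would make `a` a descent of `m`. -/
theorem le_of_mem_doubleCoset {I J : Set R} (hI : I ⊆ D.simple) (hJ : J ⊆ D.simple) {m : G}
    (hmI : ∀ a ∈ I, D.pos (m⁻¹ • a)) (hmJ : ∀ a ∈ J, D.pos (m • a)) {u u' : G}
    (hu : u ∈ D.par I) (hu' : u' ∈ D.par J) : D.Le m (u * m * u') := by
  have left : ∀ {K : Set R} (_ : K ⊆ D.simple) {m x : G} (_ : ∀ a ∈ K, D.pos (m⁻¹ • a))
      (_ : D.Le m x) {u : G} (_ : u ∈ D.par K), D.Le m (u * x) := by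
    intro K hK m x hm h u hu
    refine par_induction (p := fun u => D.Le m (u * x)) (by simpa using h) ?_ hu
    · intro a ha u hu ih
      rw [mul_assoc]
      by_cases hp : D.pos ((u * x)⁻¹ • a)
      · exact ih.trans (Le.r_mul (hK ha) hp)
      · rcases ih.lift (hK ha) hp with h | h
        · exact h
        · exact absurd (hm a ha) h.1
  rw [mul_assoc]
  refine left hI hmI ?_ hu
  -- The right-hand factor is handled by the left-hand argument for `m⁻¹`.
  have := (left hJ (m := m⁻¹) (by simpa using hmJ) (.refl _) (inv_mem hu')).inv
  simpa using this

end RefSys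

/-! ### The regular representation of the Hecke algebra of a reflection system -/

namespace RefSys

variable {G R : Type*} [Group G] [MulAction G R] {D : RefSys G R}

theorem induction_right {p : G → Prop} (h0 : ∀ x, D.len x = 0 → p x)
    (h1 : ∀ a ∈ D.simple, ∀ x, D.pos (x • a) → p x → p (x * D.r a)) (x : G) : p x := by
  have := D.induction_left (p := fun x => p x⁻¹) (fun x hx => h0 _ (by rwa [D.len_inv]))
    (fun a ha x hx ih => by
      rw [mul_inv_rev, D.r_inv]; exact h1 a ha _ hx ih) x⁻¹
  simpa using this

theorem len_mul_le (x y : G) : D.len (x * y) ≤ D.len x + D.len y := by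
  induction x using D.induction_left with
  | h0 x hx => rw [len_mul_of_len_eq_zero hx]; omega
  | h1 a ha x hx ih =>
    rw [len_r_mul ha hx, mul_assoc]
    have := len_r_mul_le ha (x * y)
    omega

theorem pos_iff_len_r_mul {a : R} (ha : a ∈ D.simple) {x : G} :
    D.pos (x⁻¹ • a) ↔ D.len (D.r a * x) = D.len x + 1 := by
  refine ⟨len_r_mul ha, fun h => ?_⟩
  by_contra h'
  have := len_r_mul_of_not ha h'
  omega

theorem pos_iff_len_mul_r {a : R} (ha : a ∈ D.simple) {x : G} :
    D.pos (x • a) ↔ D.len (x * D.r a) = D.len x + 1 := by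
  refine ⟨len_mul_r ha, fun h => ?_⟩
  by_contra h'
  have := len_mul_r_of_not ha h'
  omega

/-- A simple reflection changes the sign only of `a` and `-a`, and `x • c` being one of these forces
`r a * x = x * r c`. -/
theorem pos_r_mul_smul {a c : R} (ha : a ∈ D.simple) {x : G} (h : D.r a * x ≠ x * D.r c) :
    D.pos ((D.r a * x) • c) ↔ D.pos (x • c) := by
  refine ⟨fun h1 => ?_, fun h1 => ?_⟩ <;> by_contra h2
  · have := r_mul_eq_mul_r ha h1 (by rwa [r_mul_r_mul])
    rw [r_mul_r_mul] at this
    exact h (by conv_rhs => rw [this, mul_r_mul_r])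
  · exact h (r_mul_eq_mul_r ha h1 h2)

theorem pos_mul_r_inv_smul {a c : R} (hc : c ∈ D.simple) {x : G} (h : D.r a * x ≠ x * D.r c) :
    D.pos ((x * D.r c)⁻¹ • a) ↔ D.pos (x⁻¹ • a) := by
  rw [mul_inv_rev, D.r_inv]
  refine pos_r_mul_smul hc fun h' => h ?_
  have := congrArg (·⁻¹) h'
  simp only [mul_inv_rev, D.r_inv, inv_inv] at this
  exact this.symm

variable {A : Type*} [CommRing A] (q : A)

open Classical in
variable (D) in
/-- Left multiplication by `T_s`, with `s` the reflection in `a`. -/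
def opL (a : R) : Module.End A (G →₀ A) :=
  Finsupp.lift _ A G fun x =>
    if D.pos (x⁻¹ • a) then Finsupp.single (D.r a * x) 1
    else Finsupp.single (D.r a * x) q + Finsupp.single x (q - 1)

open Classical in
variable (D) in
/-- Right multiplication by `T_s`, with `s` the reflection in `a`. -/
def opR (a : R) : Module.End A (G →₀ A) :=
  Finsupp.lift _ A G fun x =>
    if D.pos (x • a) then Finsupp.single (x * D.r a) 1
    else Finsupp.single (x * D.r a) q + Finsupp.single x (q - 1)

variable (A) in
/-- Left translation by `g`. -/
def translL (g : G) : Module.End A (G →₀ A) := Finsupp.lmapDomain A A (g * ·)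

variable (A) in
/-- Right translation by `g`. -/
def translR (g : G) : Module.End A (G →₀ A) := Finsupp.lmapDomain A A (· * g)

open Classical in
theorem opL_single (a : R) (x : G) (t : A) : D.opL q a (Finsupp.single x t) =
    if D.pos (x⁻¹ • a) then Finsupp.single (D.r a * x) t
    else Finsupp.single (D.r a * x) (t * q) + Finsupp.single x (t * (q - 1)) := by
  rw [opL, Finsupp.lift_apply, Finsupp.sum_single_index (by simp)]
  split_ifs
  · simp
  · simp only [smul_add, Finsupp.smul_single, smul_eq_mul]

open Classical in
theorem opR_single (a : R) (x : G) (t : A) : D.opR q a (Finsupp.single x t) =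
    if D.pos (x • a) then Finsupp.single (x * D.r a) t
    else Finsupp.single (x * D.r a) (t * q) + Finsupp.single x (t * (q - 1)) := by
  rw [opR, Finsupp.lift_apply, Finsupp.sum_single_index (by simp)]
  split_ifs
  · simp
  · simp only [smul_add, Finsupp.smul_single, smul_eq_mul]

theorem opL_pos {a : R} {x : G} (h : D.pos (x⁻¹ • a)) (t : A) :
    D.opL q a (Finsupp.single x t) = Finsupp.single (D.r a * x) t := by
  rw [opL_single, if_pos h]

theorem opL_neg {a : R} {x : G} (h : ¬ D.pos (x⁻¹ • a)) (t : A) :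
    D.opL q a (Finsupp.single x t) =
      Finsupp.single (D.r a * x) (t * q) + Finsupp.single x (t * (q - 1)) := by
  rw [opL_single, if_neg h]

theorem opR_pos {a : R} {x : G} (h : D.pos (x • a)) (t : A) :
    D.opR q a (Finsupp.single x t) = Finsupp.single (x * D.r a) t := by
  rw [opR_single, if_pos h]

theorem opR_neg {a : R} {x : G} (h : ¬ D.pos (x • a)) (t : A) :
    D.opR q a (Finsupp.single x t) =
      Finsupp.single (x * D.r a) (t * q) + Finsupp.single x (t * (q - 1)) := by
  rw [opR_single, if_neg h]

@[simp] theorem translL_single (g x : G) (t : A) :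
    translL A g (Finsupp.single x t) = Finsupp.single (g * x) t := by simp [translL]

@[simp] theorem translR_single (g x : G) (t : A) :
    translR A g (Finsupp.single x t) = Finsupp.single (x * g) t := by simp [translR]

omit [Group G] in
theorem end_ext {f g : Module.End A (G →₀ A)}
    (h : ∀ x, f (Finsupp.single x 1) = g (Finsupp.single x 1)) : f = g :=
  Finsupp.lhom_ext' fun x => LinearMap.ext_ring (h x)

variable (D) in
/-- The endomorphisms that commute with all right multiplications. -/
def CommR (f : Module.End A (G →₀ A)) : Prop :=
  (∀ a ∈ D.simple, Commute f (D.opR q a)) ∧ ∀ g, D.len g = 0 → Commute f (translR A g)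

variable {q}

theorem CommR.mul {f g : Module.End A (G →₀ A)} (hf : D.CommR q f) (hg : D.CommR q g) :
    D.CommR q (f * g) :=
  ⟨fun a ha => (hf.1 a ha).mul_left (hg.1 a ha), fun a ha => (hf.2 a ha).mul_left (hg.2 a ha)⟩

theorem CommR.one : D.CommR q (1 : Module.End A (G →₀ A)) :=
  ⟨fun _ _ => Commute.one_left _, fun _ _ => Commute.one_left _⟩

/-- Right multiplications carry the basis vector at `1` to every other one, so its image determines
an endomorphism commuting with them. Identities between left multiplications can thus be checked on
one vector. -/
theorem CommR.ext {f g : Module.End A (G →₀ A)} (hf : D.CommR q f) (hg : D.CommR q g)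
    (h : f (Finsupp.single 1 1) = g (Finsupp.single 1 1)) : f = g := by
  refine end_ext fun x => ?_
  induction x using D.induction_right with
  | h0 x hx =>
    have e : (Finsupp.single x 1 : G →₀ A) = translR A x (Finsupp.single 1 1) := by simp
    have h1 := LinearMap.congr_fun (hf.2 x hx) (Finsupp.single 1 1)
    have h2 := LinearMap.congr_fun (hg.2 x hx) (Finsupp.single 1 1)
    simp only [Module.End.mul_apply] at h1 h2
    rw [e, h1, h2, h]
  | h1 a ha x hx ih =>
    have e : (Finsupp.single (x * D.r a) 1 : G →₀ A) = D.opR q a (Finsupp.single x 1) := by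
      rw [opR_single, if_pos hx]
    have h1 := LinearMap.congr_fun (hf.1 a ha) (Finsupp.single x 1)
    have h2 := LinearMap.congr_fun (hg.1 a ha) (Finsupp.single x 1)
    simp only [Module.End.mul_apply] at h1 h2
    rw [e, h1, h2, ih]

theorem commR_translL {g : G} (hg : D.len g = 0) : D.CommR q (translL A g) := by
  refine ⟨fun a _ => end_ext fun x => ?_, fun g' _ => end_ext fun x => ?_⟩
  · have h : D.pos ((g * x) • a) ↔ D.pos (x • a) := by
      rw [mul_smul, pos_smul_iff_of_len_eq_zero hg]
    by_cases hp : D.pos (x • a)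
    · simp only [Module.End.mul_apply, opR_pos q hp, opR_pos q (h.2 hp), translL_single, mul_assoc]
    · simp only [Module.End.mul_apply, opR_neg q hp, opR_neg q (mt h.1 hp), translL_single,
        mul_assoc, map_add]
  · simp [Module.End.mul_apply, mul_assoc]

/-- Associativity of the future product. If `r a * x ≠ x * r c`, left multiplication does not affect
whether `c` is a right descent, nor right multiplication whether `a` is a left descent, and the four
sign cases commute. If they are equal, the two signs at `x` agree and both operators act alike. -/
theorem commR_opL {a : R} (ha : a ∈ D.simple) : D.CommR q (D.opL q a : Module.End A (G →₀ A)) := by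
  refine ⟨fun c hc => end_ext fun x => ?_, fun g hg => end_ext fun x => ?_⟩
  · simp only [Module.End.mul_apply]
    by_cases h : D.r a * x = x * D.r c
    · have h1 : D.pos (x⁻¹ • a) ↔ D.pos (x • c) := by
        rw [pos_iff_len_r_mul ha, pos_iff_len_mul_r hc, h]
      have h2 : D.r a * (x * D.r c) = x := by rw [← h, r_mul_r_mul]
      have h4 : D.pos ((x * D.r c)⁻¹ • a) ↔ ¬ D.pos (x • c) := by
        rw [← h, D.smul_inv_r_mul, D.pos_neg, h1]
      have h5 : D.pos ((x * D.r c) • c) ↔ ¬ D.pos (x • c) := by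
        rw [D.smul_mul_r, D.pos_neg]
      by_cases hp : D.pos (x • c)
      · rw [opR_pos q hp, opL_pos q (h1.2 hp), h, opR_neg q (fun h => h5.1 h hp),
          opL_neg q (fun h => h4.1 h hp), h2, mul_r_mul_r]
      · simp only [opR_neg q hp, opL_neg q (mt h1.1 hp), h, opR_pos q (h5.2 hp),
          opL_pos q (h4.2 hp), h2, mul_r_mul_r, map_add]
    · have h1 := pos_r_mul_smul ha h
      have h2 := pos_mul_r_inv_smul hc h
      by_cases hp : D.pos (x • c) <;> by_cases hp' : D.pos (x⁻¹ • a)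
      · rw [opR_pos q hp, opL_pos q hp', opR_pos q (h1.2 hp), opL_pos q (h2.2 hp'), mul_assoc]
      · simp only [opR_pos q hp, opL_neg q hp', opR_pos q (h1.2 hp), opL_neg q (mt h2.1 hp'),
          mul_assoc, map_add]
      · simp only [opR_neg q hp, opL_pos q hp', opR_neg q (mt h1.1 hp), opL_pos q (h2.2 hp'),
          mul_assoc, map_add]
      · simp only [opR_neg q hp, opL_neg q hp', opR_neg q (mt h1.1 hp), opL_neg q (mt h2.1 hp'),
          mul_assoc, map_add, mul_comm (q - 1) q]
        abel
  · have h : D.pos ((x * g)⁻¹ • a) ↔ D.pos (x⁻¹ • a) := by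
      rw [mul_inv_rev, mul_smul, pos_smul_iff_of_len_eq_zero (by rwa [D.len_inv])]
    by_cases hp : D.pos (x⁻¹ • a)
    · simp only [Module.End.mul_apply, opL_pos q hp, opL_pos q (h.2 hp), translR_single, mul_assoc]
    · simp only [Module.End.mul_apply, opL_neg q hp, opL_neg q (mt h.1 hp), translR_single,
        mul_assoc, map_add]

theorem opL_mul_self (a : R) :
    (D.opL q a * D.opL q a : Module.End A (G →₀ A)) = q • 1 + (q - 1) • D.opL q a := by
  refine end_ext fun x => ?_
  have h := D.smul_inv_r_mul a x
  simp only [Module.End.mul_apply, LinearMap.add_apply, LinearMap.smul_apply, Module.End.one_apply]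
  by_cases hp : D.pos (x⁻¹ • a)
  · rw [opL_pos q hp, opL_neg q (by rwa [h, D.pos_neg, not_not]), r_mul_r_mul]
    simp only [Finsupp.smul_single, smul_eq_mul, one_mul, mul_one]
  · simp only [opL_neg q hp, map_add, opL_pos q (x := D.r a * x) (by rwa [h, D.pos_neg]),
      r_mul_r_mul, Finsupp.smul_single, smul_eq_mul, one_mul, smul_add, mul_comm q]

variable (D q) in
theorem exists_regular_rep : ∃ L : G → Module.End A (G →₀ A), L 1 = 1 ∧
    (∀ x y, D.len (x * y) = D.len x + D.len y → L x * L y = L (x * y)) ∧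
    (∀ a ∈ D.simple, L (D.r a) * L (D.r a) = q • L 1 + (q - 1) • L (D.r a)) ∧
    ∀ x, L x (Finsupp.single 1 1) = Finsupp.single x 1 := by
  -- Such an operator is built along a reduced expression of `x`. By `CommR.ext` it does not depend
  -- on the expression, so no braid relations have to be checked.
  have key : ∀ x : G, ∃ f : Module.End A (G →₀ A), D.CommR q f ∧
      ∀ y, D.len (x * y) = D.len x + D.len y →
        f (Finsupp.single y 1) = Finsupp.single (x * y) 1 := by
    intro x
    induction x using D.induction_left with
    | h0 x hx => exact ⟨translL A x, commR_translL hx, fun y _ => by simp⟩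
    | h1 a ha x hx ih =>
      obtain ⟨f, hf, h⟩ := ih
      refine ⟨D.opL q a * f, (commR_opL ha).mul hf, fun y hy => ?_⟩
      rw [len_r_mul ha hx, mul_assoc] at hy
      have h1 := len_r_mul_le ha (x * y)
      have h2 := D.len_mul_le x y
      rw [Module.End.mul_apply, h y (by omega), opL_single, if_pos, mul_assoc]
      rw [pos_iff_len_r_mul ha]
      omega
  choose L hL hL' using key
  have hL1 : ∀ x, L x (Finsupp.single 1 1) = Finsupp.single x 1 := fun x => by
    rw [hL' x 1 (by simp), mul_one]
  have hone : L 1 = 1 := (hL 1).ext .one (by rw [hL1]; rfl)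
  refine ⟨L, hone, fun x y h => ?_, fun a ha => ?_, hL1⟩
  · refine ((hL x).mul (hL y)).ext (hL _) ?_
    rw [Module.End.mul_apply, hL1, hL1, hL' x y h]
  · have : L (D.r a) = D.opL q a := (hL _).ext (commR_opL ha) (by
      rw [hL1, opL_single, if_pos (by simpa using D.simple_pos a ha), mul_one])
    rw [this, hone, opL_mul_self]

end RefSys

section

open AffHecke

/-! ### Laurent polynomials -/

namespace AffHecke

theorem coeff_v_mul (m n : ℤ) (f : A) : (v m * f).coeff n = f.coeff (n - m) := by
  have := AddMonoidAlgebra.coeff_single_mul_eq_mul_coeff (R := ℤ) (r := 1) (x := f)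
    (m := m) (m₁ := n) (n - m) (fun a _ => by omega)
  rw [one_mul] at this
  exact this

theorem v_mul_v (m n : ℤ) : (v m * v n : A) = v (m + n) := (LaurentPolynomial.T_add m n).symm

theorem v_zero : (v 0 : A) = 1 := LaurentPolynomial.T_zero

theorem v_mul_v_mul (m n : ℤ) (f : A) : v m * (v n * f) = v (m + n) * f := by
  rw [← mul_assoc, v_mul_v]

theorem v_ne_zero (n : ℤ) : (v n : A) ≠ 0 := (LaurentPolynomial.isUnit_T n).ne_zero

theorem coeff_toLaurent_natCast (p : ℤ[X]) (n : ℕ) :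
    (Polynomial.toLaurent p).coeff (n : ℤ) = p.coeff n := by
  rw [LaurentPolynomial.coeff_toLaurent]
  exact Finsupp.mapDomain_apply Nat.castEmbedding.injective _ _

theorem coeff_toLaurent_of_neg (p : ℤ[X]) {n : ℤ} (hn : n < 0) :
    (Polynomial.toLaurent p).coeff n = 0 := by
  rw [LaurentPolynomial.coeff_toLaurent]
  refine Finsupp.mapDomain_of_notMem_range _ _ ?_
  rintro ⟨m, rfl⟩
  exact absurd hn (by simp)

/-- `t` only involves powers `v ^ n` with `lo ≤ n ≤ hi`. -/
def Between (lo hi : ℤ) (t : A) : Prop := ∀ n, t.coeff n ≠ 0 → lo ≤ n ∧ n ≤ hi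

theorem Between.add {lo hi : ℤ} {s t : A} (hs : Between lo hi s) (ht : Between lo hi t) :
    Between lo hi (s + t) := by
  intro n hn
  by_cases h : s.coeff n = 0
  · refine ht n fun h' => hn ?_
    simp [h, h']
  · exact hs n h

theorem Between.zero (lo hi : ℤ) : Between lo hi 0 := fun n hn => absurd (by simp) hn

theorem Between.zsmul {lo hi : ℤ} {t : A} (ht : Between lo hi t) (m : ℤ) :
    Between lo hi (m • t) := fun n hn => ht n fun h => hn (by
    rw [AddMonoidAlgebra.coeff_smul, Finsupp.smul_apply, h, smul_zero])

theorem Between.sub {lo hi : ℤ} {s t : A} (hs : Between lo hi s) (ht : Between lo hi t) :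
    Between lo hi (s - t) := by
  rw [sub_eq_add_neg, ← neg_one_zsmul t]
  exact hs.add (ht.zsmul (-1))

theorem Between.v_mul {lo hi : ℤ} {t : A} (ht : Between lo hi t) (m : ℤ) :
    Between (lo + m) (hi + m) (v m * t) := by
  intro n hn
  rw [coeff_v_mul] at hn
  have := ht _ hn
  omega

theorem Between.mono {lo hi lo' hi' : ℤ} {t : A} (ht : Between lo hi t) (h : lo' ≤ lo)
    (h' : hi ≤ hi') : Between lo' hi' t := fun n hn => by have := ht n hn; omega

theorem between_v (n : ℤ) : Between n n (v n) := by
  intro m hm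
  rw [LaurentPolynomial.T_apply] at hm
  split_ifs at hm with h
  · omega
  · exact absurd rfl hm

theorem Between.exists_toLaurent {hi : ℕ} {t : A} (ht : Between 0 hi t) :
    ∃ p : ℤ[X], p.natDegree ≤ hi ∧ Polynomial.toLaurent p = t := by
  refine ⟨∑ i ∈ Finset.range (hi + 1), Polynomial.monomial i (t.coeff i), ?_, ?_⟩
  · refine Polynomial.natDegree_sum_le_of_forall_le _ _ fun i hi' => ?_
    exact (Polynomial.natDegree_monomial_le _).trans (by simpa [Nat.lt_succ_iff] using hi')
  · ext n
    rcases lt_or_ge n 0 with hn | hn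
    · rw [coeff_toLaurent_of_neg _ hn]
      by_contra h
      have := ht n (Ne.symm h)
      omega
    · lift n to ℕ using hn
      rw [coeff_toLaurent_natCast, Polynomial.finsetSum_coeff]
      simp only [Polynomial.coeff_monomial]
      rw [Finset.sum_ite_eq']
      split_ifs with h
      · rfl
      · by_contra h'
        have := ht n (Ne.symm h')
        simp at h
        omega

theorem between_toLaurent {hi : ℕ} {p : ℤ[X]} (hp : p.natDegree ≤ hi) :
    Between 0 hi (Polynomial.toLaurent p) := by
  intro n hn
  rcases lt_or_ge n 0 with h | h
  · exact absurd (coeff_toLaurent_of_neg p h) hn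
  · lift n to ℕ using h
    rw [coeff_toLaurent_natCast] at hn
    have := Polynomial.le_natDegree_of_ne_zero hn
    omega

theorem eq_zero_of_invert_eq {lo : ℤ} {t : A} (ht : Between lo (-1) t)
    (h : LaurentPolynomial.invert t = t) : t = 0 := by
  ext n
  change t.coeff n = 0
  by_contra hn
  have h1 := ht n hn
  have h2 := ht (-n) (by
    rw [← h, LaurentPolynomial.invert_apply, neg_neg]; exact hn)
  omega

/-- All coefficients are non-negative, so nothing cancels. -/
theorem sum_v_ne_zero {α : Type*} {s : Finset α} {f : α → ℤ} {x : α} (hx : x ∈ s) :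
    (∑ y ∈ s, v (f y) : A) ≠ 0 := by
  intro h
  have h1 := congrArg (fun t : A => t.coeff (f x)) h
  simp only [AddMonoidAlgebra.coeff_sum, Finsupp.finsetSum_apply, LaurentPolynomial.T_apply,
    AddMonoidAlgebra.coeff_zero, Finsupp.coe_zero, Pi.zero_apply] at h1
  have h2 : (1 : ℤ) ≤ ∑ y ∈ s, if f y = f x then (1 : ℤ) else 0 := by
    have := Finset.single_le_sum (f := fun y => if f y = f x then (1 : ℤ) else 0)
      (fun y _ => by split_ifs <;> simp) hx
    simpa using this
  omega

end AffHecke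

/-! ### Algebras with a standard basis satisfying the Hecke relations -/

/-- A standard basis of a Hecke algebra of a reflection system. -/
structure HeckeBasis {G R : Type*} [Group G] [MulAction G R] (D : RefSys G R) (H : Type*) [Ring H]
    [Algebra A H] where
  T : Module.Basis G A H
  T_one : T 1 = 1
  T_mul : ∀ x y, D.len (x * y) = D.len x + D.len y → T x * T y = T (x * y)
  T_sq : ∀ a ∈ D.simple, T (D.r a) * T (D.r a) = v 2 • T 1 + (v 2 - 1) • T (D.r a)

namespace HeckeBasis

variable {G R : Type*} [Group G] [MulAction G R] {D : RefSys G R} {H : Type*} [Ring H]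
  [Algebra A H] (K : HeckeBasis D H)

open RefSys

theorem induct {p : H → Prop} (hT : ∀ x, p (K.T x)) (ha : ∀ g h, p g → p h → p (g + h))
    (hs : ∀ (t : A) h, p h → p (t • h)) (h : H) : p h := by
  have := K.T.mem_span h
  induction this using Submodule.span_induction with
  | mem _ hx => obtain ⟨x, rfl⟩ := hx; exact hT x
  | zero => have := hs 0 _ (hT 1); rwa [zero_smul] at this
  | add _ _ _ _ h1 h2 => exact ha _ _ h1 h2
  | smul t _ _ h1 => exact hs t _ h1

variable {K}

theorem r_mul_T {a : R} (ha : a ∈ D.simple) {x : G} (h : D.pos (x⁻¹ • a)) :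
    K.T (D.r a) * K.T x = K.T (D.r a * x) :=
  K.T_mul _ _ (by rw [len_r_mul ha h, len_r ha, add_comm])

theorem r_mul_T_of_not {a : R} (ha : a ∈ D.simple) {x : G} (h : ¬ D.pos (x⁻¹ • a)) :
    K.T (D.r a) * K.T x = v 2 • K.T (D.r a * x) + (v 2 - 1) • K.T x := by
  have h1 : K.T x = K.T (D.r a) * K.T (D.r a * x) := by
    rw [r_mul_T ha (by rwa [D.smul_inv_r_mul, D.pos_neg]), r_mul_r_mul]
  conv_lhs => rw [h1, ← mul_assoc, K.T_sq a ha, add_mul, smul_mul_assoc, smul_mul_assoc, ← h1]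
  rw [K.T_one, one_mul]

theorem T_mul_r {a : R} (ha : a ∈ D.simple) {x : G} (h : D.pos (x • a)) :
    K.T x * K.T (D.r a) = K.T (x * D.r a) :=
  K.T_mul _ _ (by rw [len_mul_r ha h, len_r ha])

theorem T_mul_r_of_not {a : R} (ha : a ∈ D.simple) {x : G} (h : ¬ D.pos (x • a)) :
    K.T x * K.T (D.r a) = v 2 • K.T (x * D.r a) + (v 2 - 1) • K.T x := by
  have h1 : K.T x = K.T (x * D.r a) * K.T (D.r a) := by
    rw [T_mul_r ha (by rwa [D.smul_mul_r, D.pos_neg]), mul_r_mul_r]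
  conv_lhs => rw [h1, mul_assoc, K.T_sq a ha, mul_add, mul_smul_comm, mul_smul_comm, ← h1]
  rw [K.T_one, mul_one]

open Classical in
-- The case distinction is on the position `y` where the coordinate is read. Hence supports and
-- degrees of `T_s h` can be controlled without looking at the individual terms of `h`.
theorem repr_r_mul {a : R} (ha : a ∈ D.simple) (h : H) (y : G) :
    K.T.repr (K.T (D.r a) * h) y = if D.pos (y⁻¹ • a) then v 2 * K.T.repr h (D.r a * y)
      else K.T.repr h (D.r a * y) + (v 2 - 1) * K.T.repr h y := by
  induction h using K.induct with
  | ha g h hg hh =>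
    rw [mul_add, map_add, Finsupp.add_apply, hg, hh, map_add]
    split_ifs <;> simp only [Finsupp.add_apply] <;> ring
  | hs t h hh =>
    rw [mul_smul_comm, map_smul, Finsupp.smul_apply, hh, map_smul]
    split_ifs <;> simp only [Finsupp.smul_apply, smul_eq_mul] <;> ring
  | hT x =>
    have e : x = D.r a * y ↔ D.r a * x = y :=
      ⟨fun h => by rw [h, r_mul_r_mul], fun h => by rw [← h, r_mul_r_mul]⟩
    have h' := D.smul_inv_r_mul a y
    by_cases hx : D.pos (x⁻¹ • a)
    · rw [r_mul_T ha hx]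
      simp only [Module.Basis.repr_self, Finsupp.single_apply, e]
      by_cases h1 : D.r a * x = y
      · subst h1
        have : D.r a * x ≠ x := fun h => by
          have := len_r_mul ha hx; rw [h] at this; omega
        rw [if_pos rfl, D.smul_inv_r_mul, D.pos_neg, if_neg (not_not.2 hx), if_neg this.symm]
        simp
      · by_cases h2 : x = y
        · subst h2; simp [hx, h1]
        · simp [h1, h2]
    · rw [r_mul_T_of_not ha hx]
      simp only [map_add, map_smul, Finsupp.add_apply, Finsupp.smul_apply, Module.Basis.repr_self,
        Finsupp.single_apply, e, smul_eq_mul]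
      by_cases h1 : D.r a * x = y
      · subst h1
        have : D.r a * x ≠ x := fun h => by
          have := len_r_mul_of_not ha hx; rw [h] at this; omega
        rw [if_pos rfl, if_neg this.symm, D.smul_inv_r_mul, D.pos_neg, if_pos hx]
        simp
      · by_cases h2 : x = y
        · subst h2; simp [hx, h1]
        · simp [h1, h2]

open Classical in
theorem repr_mul_r {a : R} (ha : a ∈ D.simple) (h : H) (y : G) :
    K.T.repr (h * K.T (D.r a)) y = if D.pos (y • a) then v 2 * K.T.repr h (y * D.r a)
      else K.T.repr h (y * D.r a) + (v 2 - 1) * K.T.repr h y := by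
  induction h using K.induct with
  | ha g h hg hh =>
    rw [add_mul, map_add, Finsupp.add_apply, hg, hh, map_add]
    split_ifs <;> simp only [Finsupp.add_apply] <;> ring
  | hs t h hh =>
    rw [smul_mul_assoc, map_smul, Finsupp.smul_apply, hh, map_smul]
    split_ifs <;> simp only [Finsupp.smul_apply, smul_eq_mul] <;> ring
  | hT x =>
    have e : x = y * D.r a ↔ x * D.r a = y :=
      ⟨fun h => by rw [h, mul_r_mul_r], fun h => by rw [← h, mul_r_mul_r]⟩
    by_cases hx : D.pos (x • a)
    · rw [T_mul_r ha hx]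
      simp only [Module.Basis.repr_self, Finsupp.single_apply, e]
      by_cases h1 : x * D.r a = y
      · subst h1
        have : x * D.r a ≠ x := fun h => by
          have := len_mul_r ha hx; rw [h] at this; omega
        simp [D.smul_mul_r, D.pos_neg, hx, this.symm]
      · by_cases h2 : x = y
        · subst h2; simp [hx, h1]
        · simp [h1, h2]
    · rw [T_mul_r_of_not ha hx]
      simp only [map_add, map_smul, Finsupp.add_apply, Finsupp.smul_apply, Module.Basis.repr_self,
        Finsupp.single_apply, e, smul_eq_mul]
      by_cases h1 : x * D.r a = y
      · subst h1
        have : x * D.r a ≠ x := fun h => by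
          have := len_mul_r_of_not ha hx; rw [h] at this; omega
        rw [if_pos rfl, if_neg this.symm, D.smul_mul_r, D.pos_neg, if_pos hx]
        simp
      · by_cases h2 : x = y
        · subst h2; simp [hx, h1]
        · simp [h1, h2]

/-! #### The bar involution -/

variable (K)

/-- The quadratic relation solved for the inverse of `T_s`. -/
theorem r_mul_inverse {a : R} (ha : a ∈ D.simple) :
    K.T (D.r a) * (v (-2) • K.T (D.r a) + (v (-2) - 1) • 1) = 1 := by
  rw [mul_add, mul_smul_comm, mul_smul_comm, K.T_sq a ha, mul_one, smul_add, smul_smul, smul_smul,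
    v_mul_v, mul_sub, v_mul_v, K.T_one]
  norm_num [v_zero, sub_smul]
  abel

theorem inverse_mul_r {a : R} (ha : a ∈ D.simple) :
    (v (-2) • K.T (D.r a) + (v (-2) - 1) • 1) * K.T (D.r a) = 1 := by
  refine Eq.trans ?_ (K.r_mul_inverse ha)
  rw [add_mul, mul_add]
  simp only [smul_mul_assoc, mul_smul_comm, one_mul, mul_one]

theorem isUnit_T (x : G) : IsUnit (K.T x) := by
  induction x using D.induction_left with
  | h0 x hx =>
    have h1 : K.T x * K.T x⁻¹ = 1 := by
      rw [K.T_mul _ _ (by simp [hx, D.len_inv]), mul_inv_cancel, K.T_one]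
    have h2 : K.T x⁻¹ * K.T x = 1 := by
      rw [K.T_mul _ _ (by simp [hx, D.len_inv]), inv_mul_cancel, K.T_one]
    exact ⟨⟨_, _, h1, h2⟩, rfl⟩
  | h1 a ha x hx ih =>
    rw [← r_mul_T ha hx]
    exact IsUnit.mul ⟨⟨_, _, K.r_mul_inverse ha, K.inverse_mul_r ha⟩, rfl⟩ ih

/-- `T_x` as a unit. -/
def unitT (x : G) : Hˣ := (K.isUnit_T x).unit

@[simp] theorem coe_unitT (x : G) : (K.unitT x : H) = K.T x := rfl

/-- The image `(T_{x⁻¹})⁻¹` of `T_x` under the bar involution. -/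
def barT (x : G) : H := ((K.unitT x⁻¹)⁻¹ : Hˣ)

theorem barT_mul {x y : G} (h : D.len (x * y) = D.len x + D.len y) :
    K.barT (x * y) = K.barT x * K.barT y := by
  have : K.unitT (x * y)⁻¹ = K.unitT y⁻¹ * K.unitT x⁻¹ := by
    refine Units.ext ?_
    rw [Units.val_mul, coe_unitT, coe_unitT, coe_unitT, mul_inv_rev]
    refine (K.T_mul _ _ ?_).symm
    rw [← mul_inv_rev, D.len_inv, D.len_inv, D.len_inv, h, add_comm]
  rw [barT, this, mul_inv_rev, Units.val_mul]
  rfl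

theorem T_inv_mul_barT (x : G) : K.T x⁻¹ * K.barT x = 1 := by
  rw [← coe_unitT]; exact Units.mul_inv _

theorem barT_mul_T_inv (x : G) : K.barT x * K.T x⁻¹ = 1 := by
  rw [← coe_unitT]; exact Units.inv_mul _

theorem eq_barT {x : G} {h : H} (hh : h * K.T x⁻¹ = 1) : h = K.barT x := by
  calc h = h * (K.T x⁻¹ * K.barT x) := by rw [K.T_inv_mul_barT, mul_one]
    _ = _ := by rw [← mul_assoc, hh, one_mul]

theorem barT_r {a : R} (ha : a ∈ D.simple) :
    K.barT (D.r a) = v (-2) • K.T (D.r a) + (v (-2) - 1) • 1 :=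
  (K.eq_barT (by rw [D.r_inv]; exact K.inverse_mul_r ha)).symm

theorem barT_of_len_eq_zero {x : G} (hx : D.len x = 0) : K.barT x = K.T x :=
  (K.eq_barT (by rw [K.T_mul _ _ (by simp [hx, D.len_inv]), mul_inv_cancel, K.T_one])).symm

theorem barT_r_mul {a : R} (ha : a ∈ D.simple) {x : G} (h : D.pos (x⁻¹ • a)) :
    K.barT (D.r a * x) = K.barT (D.r a) * K.barT x :=
  K.barT_mul (by rw [len_r_mul ha h, len_r ha, add_comm])

/-- The quadratic relation with `v` replaced by `v⁻¹`; this is what makes the semilinear extension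
`barHom` multiplicative at a descent. -/
theorem barT_r_sq {a : R} (ha : a ∈ D.simple) :
    K.barT (D.r a) * K.barT (D.r a) = v (-2) • 1 + (v (-2) - 1) • K.barT (D.r a) := by
  have h1 := K.r_mul_inverse ha
  rw [← K.barT_r ha] at h1
  conv_lhs =>
    arg 1
    rw [K.barT_r ha]
  rw [add_mul, smul_mul_assoc, h1, smul_mul_assoc, one_mul]

/-- The bar involution as an additive map. -/
def barHom : H →+ H :=
  (Finsupp.liftAddHom fun x : G => ((smulAddHom A H).flip (K.barT x)).comp
    (LaurentPolynomial.invert : A ≃ₐ[ℤ] A).toRingHom.toAddMonoidHom).comp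
      K.T.repr.toLinearMap.toAddMonoidHom

theorem barHom_apply (h : H) :
    K.barHom h = (K.T.repr h).sum fun x t => LaurentPolynomial.invert t • K.barT x := rfl

theorem barHom_T (x : G) : K.barHom (K.T x) = K.barT x := by
  rw [barHom_apply, Module.Basis.repr_self, Finsupp.sum_single_index] <;> simp

theorem barHom_smul (t : A) (h : H) :
    K.barHom (t • h) = LaurentPolynomial.invert t • K.barHom h := by
  rw [barHom_apply, barHom_apply, map_smul, Finsupp.sum_smul_index (by simp), Finsupp.smul_sum]
  simp only [map_mul, mul_smul]

theorem barHom_one : K.barHom 1 = 1 := by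
  rw [← K.T_one, barHom_T, K.barT_of_len_eq_zero len_one]

theorem barHom_r_mul {a : R} (ha : a ∈ D.simple) (h : H) :
    K.barHom (K.T (D.r a) * h) = K.barT (D.r a) * K.barHom h := by
  induction h using K.induct with
  | ha g h hg hh => rw [mul_add, map_add, hg, hh, map_add, mul_add]
  | hs t h hh => rw [mul_smul_comm, barHom_smul, hh, barHom_smul, mul_smul_comm]
  | hT x =>
    rw [barHom_T]
    by_cases hx : D.pos (x⁻¹ • a)
    · rw [r_mul_T ha hx, barHom_T, K.barT_r_mul ha hx]
    · have h1 := K.barT_r_mul (x := D.r a * x) ha (by rwa [D.smul_inv_r_mul, D.pos_neg])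
      rw [r_mul_r_mul] at h1
      rw [r_mul_T_of_not ha hx, map_add, barHom_smul, barHom_smul, barHom_T, barHom_T, h1,
        ← mul_assoc, K.barT_r_sq ha, add_mul, smul_mul_assoc, smul_mul_assoc, one_mul]
      simp

theorem barHom_T_mul (x : G) (h : H) : K.barHom (K.T x * h) = K.barT x * K.barHom h := by
  induction x using D.induction_left generalizing h with
  | h0 x hx =>
    induction h using K.induct with
    | ha g h hg hh => rw [mul_add, map_add, hg, hh, map_add, mul_add]
    | hs t h hh => rw [mul_smul_comm, barHom_smul, hh, barHom_smul, mul_smul_comm]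
    | hT y =>
      have : D.len (x * y) = D.len x + D.len y := by rw [len_mul_of_len_eq_zero hx, hx, zero_add]
      rw [K.T_mul _ _ this, barHom_T, barHom_T, K.barT_mul this]
  | h1 a ha x hx ih =>
    rw [← r_mul_T ha hx, mul_assoc, K.barHom_r_mul ha, ih, K.barT_r_mul ha hx, mul_assoc]

theorem barHom_mul (g h : H) : K.barHom (g * h) = K.barHom g * K.barHom h := by
  induction g using K.induct with
  | ha g g' hg hh => rw [add_mul, map_add, hg, hh, map_add, add_mul]
  | hs t g hg => rw [smul_mul_assoc, barHom_smul, hg, barHom_smul, smul_mul_assoc]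
  | hT x => rw [K.barHom_T_mul, K.barHom_T]

/-- Duality applied to `T_{x⁻¹} * barT x = 1` shows that the second dual of `T_x` is inverse to
`barT x⁻¹`, and so is `T_x`. -/
theorem barHom_barHom (h : H) : K.barHom (K.barHom h) = h := by
  induction h using K.induct with
  | ha g h hg hh => rw [map_add, map_add, hg, hh]
  | hs t h hh => rw [barHom_smul, barHom_smul, hh, LaurentPolynomial.involutive_invert]
  | hT x =>
    rw [barHom_T]
    have h1 := congrArg K.barHom (K.T_inv_mul_barT x)
    rw [barHom_mul, barHom_one, barHom_T] at h1
    have h2 := K.T_inv_mul_barT x⁻¹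
    rw [inv_inv] at h2
    calc _ = (K.T x * K.barT x⁻¹) * K.barHom (K.barT x) := by rw [h2, one_mul]
      _ = _ := by rw [mul_assoc, h1, mul_one]

/-- The defining property of the bar involution. -/
structure IsBar (f : H ≃+* H) : Prop where
  map_scalar (t : A) : f (algebraMap A H t) = algebraMap A H (LaurentPolynomial.invert t)
  map_mul_eq_one (x : G) : f (K.T x) * K.T x⁻¹ = 1

theorem IsBar.map_T {K : HeckeBasis D H} {f : H ≃+* H} (hf : K.IsBar f) (x : G) :
    f (K.T x) = K.barT x := K.eq_barT (hf.map_mul_eq_one x)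

theorem IsBar.map_smul {K : HeckeBasis D H} {f : H ≃+* H} (hf : K.IsBar f) (t : A) (h : H) :
    f (t • h) = LaurentPolynomial.invert t • f h := by
  rw [Algebra.smul_def, map_mul, hf.map_scalar, Algebra.smul_def]

theorem IsBar.ext {K : HeckeBasis D H} {f g : H ≃+* H} (hf : K.IsBar f) (hg : K.IsBar g) :
    f = g := by
  ext h
  induction h using K.induct with
  | ha g h hg hh => rw [map_add, map_add, hg, hh]
  | hs t h hh => rw [hf.map_smul, hg.map_smul, hh]
  | hT x => rw [hf.map_T, hg.map_T]

theorem exists_isBar : ∃ f : H ≃+* H, K.IsBar f := by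
  refine ⟨{ K.barHom with
    invFun := K.barHom
    left_inv := K.barHom_barHom
    right_inv := K.barHom_barHom
    map_mul' := K.barHom_mul }, fun t => ?_, fun x => ?_⟩
  · change K.barHom _ = _
    rw [Algebra.algebraMap_eq_smul_one, barHom_smul, barHom_one, Algebra.algebraMap_eq_smul_one]
  · change K.barHom _ * _ = _
    rw [barHom_T, barT_mul_T_inv]

end HeckeBasis

end

section

open AffHecke

/-! ### Kazhdan-Lusztig elements -/

/-- A self-dual combination of independent elements, on which the duality is unitriangular up to
normalization, vanishes if all its normalized coefficients only involve negative powers of `v`. -/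
theorem eq_zero_of_selfDual {N M : Type*} [AddCommGroup M] [Module A M] {e : N → M}
    (he : LinearIndependent A e) (l : N → ℕ) (f : M →+ M)
    (hfs : ∀ (t : A) h, f (t • h) = LaurentPolynomial.invert t • f h)
    (hfe : ∀ n, f (e n) - (v (-2 * (l n : ℤ)) : A) • e n ∈
      Submodule.span A (e '' {n' | l n' < l n}))
    (q : N →₀ A) (hq : ∀ n, ∃ lo, Between lo (-1) (v (l n : ℤ) * q n))
    (hd : f (Finsupp.linearCombination A e q) = Finsupp.linearCombination A e q) : q = 0 := by
  classical
  by_contra hq0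
  obtain ⟨m, hm, hmax⟩ := q.support.exists_max_image l (Finsupp.support_nonempty_iff.2 hq0)
  -- The failure of each coefficient to satisfy the self-duality it would have if duality were
  -- diagonal on the `e n`.
  let p : N →₀ A := Finsupp.onFinset q.support
    (fun n => q n - LaurentPolynomial.invert (q n) * v (-2 * (l n : ℤ)))
    (fun n hn => by
      rw [Finsupp.mem_support_iff]
      intro h
      rw [h, map_zero, zero_mul, sub_zero] at hn
      exact hn rfl)
  -- Comparing the element with its dual expresses `∑ p n • e n` through the error terms of duality,
  -- which lie strictly below the maximal level `l m`.
  have hp : Finsupp.linearCombination A e p ∈ Submodule.span A (e '' {n' | l n' < l m}) := by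
    have : Finsupp.linearCombination A e p = ∑ n ∈ q.support,
        LaurentPolynomial.invert (q n) • (f (e n) - (v (-2 * (l n : ℤ)) : A) • e n) := by
      have h1 : Finsupp.linearCombination A e p = ∑ n ∈ q.support, p n • e n :=
        Finsupp.sum_of_support_subset p Finsupp.support_onFinset_subset _ (by simp)
      have h2 : Finsupp.linearCombination A e q = ∑ n ∈ q.support, q n • e n := rfl
      have h3 : ∑ n ∈ q.support, (q n • e n - LaurentPolynomial.invert (q n) • f (e n)) = 0 := by
        rw [h2, map_sum, eq_comm, ← sub_eq_zero, ← Finset.sum_sub_distrib] at hd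
        simpa only [hfs] using hd
      rw [h1, ← sub_eq_zero, ← Finset.sum_sub_distrib, ← h3]
      refine Finset.sum_congr rfl fun n _ => ?_
      simp only [p, Finsupp.onFinset_apply, sub_smul, smul_sub, mul_smul]
      abel
    rw [this]
    refine Submodule.sum_mem _ fun n hn => Submodule.smul_mem _ _ ?_
    refine Submodule.span_mono (Set.image_mono fun n' hn' => ?_) (hfe n)
    exact lt_of_lt_of_le hn' (hmax n hn)
  obtain ⟨p', hp', h⟩ := (Finsupp.mem_span_image_iff_linearCombination A).1 hp
  have hpp : p' = p := he h
  have hpm : p m = 0 := by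
    rw [← hpp]
    by_contra h0
    exact lt_irrefl (l m) ((Finsupp.mem_supported A p').1 hp' (Finsupp.mem_support_iff.2 h0))
  -- Equivalently, `v^(l m) * q m` is fixed by `v ↦ v⁻¹`; having only negative exponents, it
  -- vanishes.
  have h1 : q m = LaurentPolynomial.invert (q m) * v (-2 * (l m : ℤ)) := by
    rw [← sub_eq_zero]; exact hpm
  obtain ⟨lo, hlo⟩ := hq m
  have h2 := eq_zero_of_invert_eq hlo (by
    conv_rhs => rw [h1]
    rw [map_mul, LaurentPolynomial.invert_T, mul_comm (LaurentPolynomial.invert (q m)),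
      v_mul_v_mul]
    congr 2
    ring)
  exact (Finsupp.mem_support_iff.1 hm) ((mul_eq_zero.1 h2).resolve_left (v_ne_zero _))

namespace HeckeBasis

variable {G R : Type*} [Group G] [MulAction G R] {D : RefSys G R} {H : Type*} [Ring H]
  [Algebra A H] (K : HeckeBasis D H)

open RefSys

open Classical in
-- Unitriangularity of duality up to the factor `v^(-2 ℓ(x))`: each simple factor contributes
-- `v^(-2) T_s` to the leading term, and the rest of its dual does not increase length.
theorem repr_barT (x y : G) (h : D.len x ≤ D.len y) :
    K.T.repr (K.barT x) y = if x = y then v (-2 * (D.len x : ℤ)) else 0 := by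
  induction x using D.induction_left generalizing y with
  | h0 x hx =>
    rw [K.barT_of_len_eq_zero hx, Module.Basis.repr_self, Finsupp.single_apply, hx]
    simp
  | h1 a ha x hx ih =>
    have hl := len_r_mul ha hx
    have h2 : K.T.repr (K.barT x) y = 0 := by
      rw [ih y (by omega), if_neg]; rintro rfl; omega
    rw [K.barT_r_mul ha hx, K.barT_r ha, add_mul, smul_mul_assoc, smul_mul_assoc, one_mul, map_add,
      map_smul, map_smul, Finsupp.add_apply, Finsupp.smul_apply, Finsupp.smul_apply, h2, smul_zero,
      add_zero, repr_r_mul ha, h2, mul_zero, add_zero]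
    have e : x = D.r a * y ↔ D.r a * x = y :=
      ⟨fun h => by rw [h, r_mul_r_mul], fun h => by rw [← h, r_mul_r_mul]⟩
    by_cases hp : D.pos (y⁻¹ • a)
    · have := len_r_mul ha hp
      rw [if_pos hp, ih _ (by omega), if_neg, if_neg, mul_zero, smul_zero]
      · rintro rfl
        rw [D.smul_inv_r_mul, D.pos_neg] at hp; exact hp hx
      · rintro rfl; omega
    · have := len_r_mul_of_not ha hp
      rw [if_neg hp, ih _ (by omega), e]
      split_ifs
      · rw [smul_eq_mul, v_mul_v, hl]; congr 1; push_cast; ring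
      · rw [smul_zero]

theorem barT_sub_mem (x : G) : K.barT x - (v (-2 * (D.len x : ℤ)) : A) • K.T x ∈
    Submodule.span A (K.T '' {y | D.len y < D.len x}) := by
  classical
  rw [K.T.mem_span_image]
  intro y hy
  simp only [Finset.mem_coe, Finsupp.mem_support_iff] at hy
  by_contra h
  refine hy ?_
  rw [map_sub, map_smul, Finsupp.sub_apply, Finsupp.smul_apply, Module.Basis.repr_self,
    K.repr_barT x y (not_lt.1 h), Finsupp.single_apply]
  split_ifs <;> simp

theorem IsBar.map_T_sub_mem {K : HeckeBasis D H} {f : H ≃+* H} (hf : K.IsBar f) (x : G) :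
    f (K.T x) - (v (-2 * (D.len x : ℤ)) : A) • K.T x ∈
      Submodule.span A (K.T '' {y | D.len y < D.len x}) := by
  rw [hf.map_T]; exact K.barT_sub_mem x

/-- The defining property of the Kazhdan-Lusztig element `C'_x`. -/
def IsKL (f : H ≃+* H) (x : G) (c : H) : Prop :=
  f c = c ∧ ∃ p : G →₀ ℤ[X],
    (∀ y ∈ p.support, D.Lt y x ∧ (p y).natDegree + D.len y + 1 ≤ D.len x) ∧
    c = v (-(D.len x : ℤ)) • K.T x +
      p.sum fun y q => (v (-(D.len x : ℤ)) * Polynomial.toLaurent q) • K.T y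

/-- The defining property of `C'_x`, in terms of coordinates. -/
def IsKLRepr (f : H ≃+* H) (x : G) (c : H) : Prop :=
  f c = c ∧ K.T.repr c x = v (-(D.len x : ℤ)) ∧ ∀ y, y ≠ x → K.T.repr c y ≠ 0 →
    D.Lt y x ∧ Between (-(D.len x : ℤ)) (-(D.len y : ℤ) - 1) (K.T.repr c y)

theorem repr_sum (t : A) (p : G →₀ ℤ[X]) (z : G) :
    K.T.repr (p.sum fun y q => (t * Polynomial.toLaurent q) • K.T y) z =
      t * Polynomial.toLaurent (p z) := by
  classical
  rw [Finsupp.sum, map_sum, Finsupp.finsetSum_apply]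
  simp only [map_smul, Finsupp.smul_apply, Module.Basis.repr_self, Finsupp.single_apply,
    smul_eq_mul, mul_ite, mul_one, mul_zero]
  rw [Finset.sum_ite_eq']
  split_ifs with h
  · rfl
  · rw [Finsupp.notMem_support_iff.1 h, map_zero, mul_zero]

variable {K}

theorem IsKL.isKLRepr {f : H ≃+* H} {x : G} {c : H} (h : K.IsKL f x c) : K.IsKLRepr f x c := by
  classical
  obtain ⟨h1, p, h2, h3⟩ := h
  have hr : ∀ y, K.T.repr c y = (if x = y then v (-(D.len x : ℤ)) else 0) +
      v (-(D.len x : ℤ)) * Polynomial.toLaurent (p y) := by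
    intro y
    rw [h3, map_add, map_smul, Finsupp.add_apply, K.repr_sum, Finsupp.smul_apply,
      Module.Basis.repr_self, Finsupp.single_apply]
    simp
  have hx : p x = 0 := by
    by_contra h
    exact (h2 x (Finsupp.mem_support_iff.2 h)).1.2 rfl
  refine ⟨h1, by rw [hr, if_pos rfl, hx, map_zero, mul_zero, add_zero], fun y hy hy' => ?_⟩
  rw [hr, if_neg hy.symm, zero_add] at hy' ⊢
  obtain ⟨h4, h5⟩ := h2 y (by
    rw [Finsupp.mem_support_iff]
    intro h
    rw [h, map_zero, mul_zero] at hy'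
    exact hy' rfl)
  refine ⟨h4, ((between_toLaurent le_rfl).v_mul _).mono ?_ ?_⟩ <;> omega

theorem IsKLRepr.isKL {f : H ≃+* H} {x : G} {c : H} (h : K.IsKLRepr f x c) : K.IsKL f x c := by
  classical
  obtain ⟨h1, h2, h3⟩ := h
  have key : ∀ y, ∃ p : ℤ[X], (y = x → p = 0) ∧ (K.T.repr c y = 0 → p = 0) ∧
      (p ≠ 0 → D.Lt y x ∧ p.natDegree + D.len y + 1 ≤ D.len x) ∧
      (y ≠ x → K.T.repr c y = v (-(D.len x : ℤ)) * Polynomial.toLaurent p) := by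
    intro y
    by_cases hy : y = x
    · exact ⟨0, by simp [hy]⟩
    by_cases hy' : K.T.repr c y = 0
    · exact ⟨0, by simp [hy']⟩
    obtain ⟨h4, h5⟩ := h3 y hy hy'
    -- This makes the natural subtraction `len x - len y - 1` below an honest one.
    have hl := h4.len_lt
    obtain ⟨p, hp, hp'⟩ := ((h5.v_mul (D.len x)).mono (lo' := 0)
      (hi' := ((D.len x - D.len y - 1 : ℕ) : ℤ)) (by omega) (by omega)).exists_toLaurent
    refine ⟨p, fun h => absurd h hy, fun h => absurd h hy', fun _ => ⟨h4, by omega⟩, fun _ => ?_⟩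
    rw [hp', v_mul_v_mul, neg_add_cancel, v_zero, one_mul]
  choose p hp1 hp2 hp3 hp4 using key
  refine ⟨h1, Finsupp.onFinset (K.T.repr c).support p fun y hy =>
    Finsupp.mem_support_iff.2 fun h => hy (hp2 y h), fun y hy => ?_, ?_⟩
  · exact hp3 y (Finsupp.mem_support_iff.1 hy)
  · refine K.T.repr.injective (Finsupp.ext fun y => ?_)
    rw [map_add, map_smul, Finsupp.add_apply, K.repr_sum, Finsupp.smul_apply,
      Module.Basis.repr_self, Finsupp.single_apply, Finsupp.onFinset_apply]
    by_cases hy : x = y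
    · subst hy
      rw [if_pos rfl, h2, hp1 x rfl]
      simp
    · rw [if_neg hy, smul_zero, zero_add, hp4 y (Ne.symm hy)]

/-- If `c = C'_x` and `s x > x`, then `C'_s C'_x = v⁻¹ (T_s + 1) c` is, up to integral multiples of
shorter Kazhdan-Lusztig elements, the element `C'_{s x}`. -/
theorem IsKLRepr.r_mul {f : H ≃+* H} (hf : K.IsBar f) {a : R} (ha : a ∈ D.simple) {x : G}
    (hx : D.pos (x⁻¹ • a)) {c : H} (hc : K.IsKLRepr f x c) :
    ∃ d : H, f d = d ∧ K.T.repr d (D.r a * x) = v (-(D.len (D.r a * x) : ℤ)) ∧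
      ∀ y, y ≠ D.r a * x → K.T.repr d y ≠ 0 → D.Lt y (D.r a * x) ∧
        Between (-(D.len (D.r a * x) : ℤ)) (-(D.len y : ℤ)) (K.T.repr d y) := by
  classical
  obtain ⟨h1, h2, h3⟩ := hc
  have hl := len_r_mul ha hx
  have hle : ∀ y, K.T.repr c y ≠ 0 → D.Le y x := fun y hy => by
    by_cases h : y = x
    · rw [h]; exact .refl _
    · exact (h3 y h hy).1.1
  have hb : ∀ y, Between (-(D.len x : ℤ)) (-(D.len y : ℤ)) (K.T.repr c y) := fun y => by
    by_cases h : y = x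
    · rw [h, h2]; exact between_v _
    by_cases h' : K.T.repr c y = 0
    · rw [h']; exact .zero _ _
    · exact (h3 y h h').2.mono le_rfl (by omega)
  have hb' : ∀ y, y ≠ x → Between (-(D.len x : ℤ)) (-(D.len y : ℤ) - 1) (K.T.repr c y) :=
    fun y h => by
    by_cases h' : K.T.repr c y = 0
    · rw [h']; exact .zero _ _
    · exact (h3 y h h').2
  have hr : ∀ y, K.T.repr ((v (-1) : A) • (K.T (D.r a) * c + c)) y = if D.pos (y⁻¹ • a) then
      v 1 * K.T.repr c (D.r a * y) + v (-1) * K.T.repr c y else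
      v (-1) * K.T.repr c (D.r a * y) + v 1 * K.T.repr c y := by
    intro y
    rw [map_smul, Finsupp.smul_apply, map_add, Finsupp.add_apply, repr_r_mul ha, smul_eq_mul]
    have e : (v 1 : A) = v (-1) * v 2 := by rw [v_mul_v]; rfl
    rw [e]
    split_ifs <;> ring
  refine ⟨(v (-1) : A) • (K.T (D.r a) * c + c), ?_, ?_, fun y hy hy' => ?_⟩
  · rw [hf.map_smul, map_add, map_mul, h1, hf.map_T, K.barT_r ha, LaurentPolynomial.invert_T,
      add_mul, smul_mul_assoc, smul_mul_assoc, one_mul, add_assoc, sub_smul, one_smul,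
      sub_add_cancel, ← smul_add, smul_smul, v_mul_v]
    norm_num
  · rw [hr, if_neg (by rwa [D.smul_inv_r_mul, D.pos_neg, not_not]), r_mul_r_mul, h2, v_mul_v, hl]
    have : K.T.repr c (D.r a * x) = 0 := by
      by_contra h
      have := (hle _ h).len_le
      omega
    rw [this, mul_zero, add_zero]
    congr 1; push_cast; ring
  · have hlt : D.Le y (D.r a * x) := by
      by_cases h : K.T.repr c y = 0
      · by_cases h' : K.T.repr c (D.r a * y) = 0
        · rw [hr, h, h'] at hy'; simp at hy'
        · have := (hle _ h').r_mul_r_mul ha hx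
          rwa [r_mul_r_mul] at this
      · exact (hle y h).trans (Le.r_mul ha hx)
    refine ⟨⟨hlt, hy⟩, ?_⟩
    rw [hr]
    split_ifs with hp
    · have h5 := len_r_mul ha hp
      refine (((hb _).v_mul 1).mono ?_ ?_).add (((hb y).v_mul (-1)).mono ?_ ?_) <;> omega
    · have h5 := len_r_mul_of_not ha hp
      -- At a descent `y` the coefficient of `c` is multiplied by `v`. The bound survives because
      -- this coefficient has exponents at most `-len y - 1`; the exception `y = x` is excluded, as
      -- `a` is an ascent of `x`.
      have hyx : y ≠ x := by rintro rfl; exact hp hx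
      refine (((hb _).v_mul (-1)).mono ?_ ?_).add (((hb' y hyx).v_mul 1).mono ?_ ?_) <;> omega

/-- The product `C'_s C'_{s x}` misses the degree bound at `y` by at most one exponent, `-len y`.
Subtracting integral multiples of shorter Kazhdan-Lusztig elements removes it. -/
theorem exists_isKLRepr {f : H ≃+* H} (hf : K.IsBar f) (x : G) : ∃ c, K.IsKLRepr f x c := by
  classical
  induction hn : D.len x using Nat.strong_induction_on generalizing x with
  | _ n ih =>
  subst hn
  by_cases h0 : D.len x = 0
  · refine ⟨K.T x, by rw [hf.map_T, K.barT_of_len_eq_zero h0], by simp [h0], fun y hy h => ?_⟩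
    simp [hy.symm] at h
  obtain ⟨a, ha, hx⟩ := exists_descent h0
  have hl := len_r_mul_of_not ha hx
  obtain ⟨c, hc⟩ := ih _ (by omega) (D.r a * x) rfl
  obtain ⟨d, h1, h2, h3⟩ := hc.r_mul hf ha (by rwa [D.smul_inv_r_mul, D.pos_neg])
  rw [r_mul_r_mul] at h2 h3
  have : ∀ y, ∃ c, D.len y < D.len x → K.IsKLRepr f y c := fun y => by
    by_cases hy : D.len y < D.len x
    · obtain ⟨c, hc⟩ := ih _ hy y rfl
      exact ⟨c, fun _ => hc⟩
    · exact ⟨0, fun h => absurd h hy⟩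
  choose C hC using this
  let s := (K.T.repr d).support.erase x
  -- The coefficient at the forbidden exponent. It is an integer, so `m y • C y` is again self-dual.
  let m : G → ℤ := fun y => (K.T.repr d y).coeff (-(D.len y : ℤ))
  have hs : ∀ y ∈ s, D.Lt y x := fun y hy =>
    (h3 y (Finset.ne_of_mem_erase hy) (Finsupp.mem_support_iff.1 (Finset.mem_of_mem_erase hy))).1
  have hCs : ∀ y ∈ s, K.IsKLRepr f y (C y) := fun y hy => hC y (hs y hy).len_lt
  have hr : ∀ z, K.T.repr (d - ∑ y ∈ s, m y • C y) z =
      K.T.repr d z - ∑ y ∈ s, m y • K.T.repr (C y) z := by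
    intro z
    rw [map_sub, Finsupp.sub_apply, map_sum, Finsupp.finsetSum_apply]
    simp only [map_zsmul, Finsupp.smul_apply]
  refine ⟨d - ∑ y ∈ s, m y • C y, ?_, ?_, fun z hz hz' => ?_⟩
  · rw [map_sub, h1, map_sum]
    congr 1
    refine Finset.sum_congr rfl fun y hy => ?_
    rw [map_zsmul, (hCs y hy).1]
  · rw [hr, h2, Finset.sum_eq_zero, sub_zero]
    intro y hy
    by_cases h : K.T.repr (C y) x = 0
    · rw [h, smul_zero]
    · have h4 := ((hCs y hy).2.2 x (hs y hy).2.symm h).1.len_lt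
      have h5 := (hs y hy).len_lt
      omega
  · rw [hr] at hz' ⊢
    constructor
    · by_cases h : K.T.repr d z = 0
      · rw [h, zero_sub, neg_ne_zero] at hz'
        obtain ⟨y, hy, h4⟩ := Finset.exists_ne_zero_of_sum_ne_zero hz'
        have h5 : K.T.repr (C y) z ≠ 0 := fun h => h4 (by rw [h, smul_zero])
        by_cases hzy : z = y
        · rw [hzy]; exact hs y hy
        · exact ((hCs y hy).2.2 z hzy h5).1.trans_le (hs y hy).1
      · exact (h3 z hz h).1
    · have hb : Between (-(D.len x : ℤ)) (-(D.len z : ℤ))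
          (K.T.repr d z - ∑ y ∈ s, m y • K.T.repr (C y) z) := by
        have h4 : Between (-(D.len x : ℤ)) (-(D.len z : ℤ)) (K.T.repr d z) := by
          by_cases h : K.T.repr d z = 0
          · rw [h]; exact .zero _ _
          · exact (h3 z hz h).2
        have h5 : ∀ y ∈ s, Between (-(D.len x : ℤ)) (-(D.len z : ℤ))
            (-(m y • K.T.repr (C y) z)) := by
          intro y hy
          rw [← neg_smul]
          refine Between.zsmul ?_ _
          have := (hs y hy).len_lt
          by_cases hzy : z = y
          · rw [hzy, (hCs y hy).2.1]
            exact (between_v _).mono (by omega) le_rfl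
          by_cases h : K.T.repr (C y) z = 0
          · rw [h]; exact .zero _ _
          · exact ((hCs y hy).2.2 z hzy h).2.mono (by omega) (by omega)
        rw [sub_eq_add_neg, ← Finset.sum_neg_distrib]
        refine h4.add ?_
        exact Finset.sum_induction _ _ (fun _ _ => Between.add) (.zero _ _) h5
      -- At `z` only the summand of `C z` has a term of exponent `-len z`; all others stay below.
      -- Therefore the corrections do not interfere and can be made all at once.
      have hcoeff : (K.T.repr d z - ∑ y ∈ s, m y • K.T.repr (C y) z).coeff
          (-(D.len z : ℤ)) = 0 := by
        rw [AddMonoidAlgebra.coeff_sub, Finsupp.sub_apply, AddMonoidAlgebra.coeff_sum,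
          Finsupp.finsetSum_apply]
        simp only [AddMonoidAlgebra.coeff_smul, Finsupp.smul_apply]
        have h6 : ∀ y ∈ s, y ≠ z → m y • (K.T.repr (C y) z).coeff (-(D.len z : ℤ)) = 0 := by
          intro y hy hyz
          by_cases h : K.T.repr (C y) z = 0
          · simp [h]
          · by_contra h'
            have := ((hCs y hy).2.2 z hyz.symm h).2 _ (fun h'' => h' (by rw [h'', smul_zero]))
            omega
        by_cases hzs : z ∈ s
        · rw [Finset.sum_eq_single_of_mem z hzs h6, (hCs z hzs).2.1]
          simp [m]
        · rw [Finset.sum_eq_zero fun y hy => h6 y hy (fun h => hzs (h ▸ hy)), sub_zero]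
          have : K.T.repr d z = 0 := by
            by_contra h
            exact hzs (Finset.mem_erase.2 ⟨hz, Finsupp.mem_support_iff.2 h⟩)
          simp [this]
      intro n hn
      have := hb n hn
      have h7 : n ≠ -(D.len z : ℤ) := fun h => hn (h ▸ hcoeff)
      omega

theorem IsKLRepr.ext {f : H ≃+* H} (hf : K.IsBar f) {x : G} {c d : H} (hc : K.IsKLRepr f x c)
    (hd : K.IsKLRepr f x d) : c = d := by
  have h := eq_zero_of_selfDual K.T.linearIndependent D.len (f : H →+ H) hf.map_smul
    hf.map_T_sub_mem (K.T.repr (c - d)) (fun y => ?_) ?_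
  · rwa [map_eq_zero_iff _ K.T.repr.injective, sub_eq_zero] at h
  -- Only the upper bound `-1` matters; the lower one is whatever the coefficients provide.
  · refine ⟨D.len y - D.len x, ?_⟩
    have hb : ∀ {e}, K.IsKLRepr f x e → y ≠ x →
        Between (-(D.len x : ℤ)) (-(D.len y : ℤ) - 1) (K.T.repr e y) := fun {e} he hy => by
      by_cases h : K.T.repr e y = 0
      · rw [h]; exact .zero _ _
      · exact (he.2.2 y hy h).2
    rw [map_sub, Finsupp.sub_apply]
    by_cases hy : y = x
    · have : K.T.repr c y - K.T.repr d y = 0 := by rw [hy, hc.2.1, hd.2.1, sub_self]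
      rw [this, mul_zero]; exact .zero _ _
    · exact (((hb hc hy).sub (hb hd hy)).v_mul (D.len y)).mono (by omega) (by omega)
  · rw [Module.Basis.linearCombination_repr]
    change f (c - d) = _
    rw [map_sub, hc.1, hd.1]

theorem existsUnique_isKL {f : H ≃+* H} (hf : K.IsBar f) (x : G) : ∃! c, K.IsKL f x c := by
  obtain ⟨c, hc⟩ := exists_isKLRepr hf x
  exact ⟨c, hc.isKL, fun d hd => hd.isKLRepr.ext hf hc⟩

end HeckeBasis

end

section

open AffHecke

namespace RefSys

variable {G R : Type*} [Group G] [MulAction G R] {D : RefSys G R}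

/-! ### Length-increasing induction in parabolic subgroups -/

theorem par_induction_reduced {I : Set R} (hI : I ⊆ D.simple) {p : G → Prop} (h1 : p 1)
    (h : ∀ a ∈ I, ∀ x ∈ D.par I, D.pos (x⁻¹ • a) → p x → p (D.r a * x)) {x : G}
    (hx : x ∈ D.par I) : p x := by
  induction hn : D.len x using Nat.strong_induction_on generalizing x with
  | _ n ih =>
  by_cases hx1 : x = 1
  · rwa [hx1]
  obtain ⟨a, ha, hpos⟩ := exists_descent_par hI hx hx1
  have hl := len_r_mul_of_not (hI ha) hpos
  have hmem := mul_mem (D.r_mem_par ha) hx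
  have := h a ha _ hmem (by rwa [D.smul_inv_r_mul, D.pos_neg]) (ih _ (by omega) hmem rfl)
  rwa [r_mul_r_mul] at this

theorem par_induction_reduced_right {I : Set R} (hI : I ⊆ D.simple) {p : G → Prop} (h1 : p 1)
    (h : ∀ a ∈ I, ∀ x ∈ D.par I, D.pos (x • a) → p x → p (x * D.r a)) {x : G}
    (hx : x ∈ D.par I) : p x := by
  have := par_induction_reduced hI (p := fun x => p x⁻¹) (by rwa [inv_one])
    (fun a ha x hx hp ih => by
      rw [mul_inv_rev, D.r_inv]; exact h a ha _ (inv_mem hx) hp ih) (inv_mem hx)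
  rwa [inv_inv] at this

end RefSys

namespace HeckeBasis

variable {G R : Type*} [Group G] [MulAction G R] {D : RefSys G R} {H : Type*} [Ring H]
  [Algebra A H] (K : HeckeBasis D H)

open RefSys

/-! #### Alternating sums of standard basis elements -/

variable (D) in
/-- The coefficient `(-1) ^ ℓ(x) v ^ (-2 ℓ(x))`. -/
def altCoeff (x : G) : A := (-1) ^ D.len x * v (-2 * (D.len x : ℤ))

theorem altCoeff_ne_zero (x : G) : altCoeff D x ≠ 0 :=
  mul_ne_zero (pow_ne_zero _ (by simp)) (v_ne_zero _)

theorem v_mul_altCoeff {x y : G} (h : D.len y = D.len x + 1) :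
    v 2 * altCoeff D y = -altCoeff D x := by
  rw [altCoeff, altCoeff, h, pow_succ]
  have : (v (-2 * (D.len x : ℤ)) : A) = v 2 * v (-2 * ((D.len x + 1 : ℕ) : ℤ)) := by
    rw [v_mul_v]; congr 1; push_cast; ring
  rw [this]
  ring

/-- The alternating sum `∑ (-1) ^ ℓ(x) v ^ (-2 ℓ(x)) T_x`. -/
def altSum (s : Finset G) : H := ∑ x ∈ s, altCoeff D x • K.T x

open Classical in
theorem repr_altSum (s : Finset G) (y : G) :
    K.T.repr (K.altSum s) y = if y ∈ s then altCoeff D y else 0 := by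
  rw [altSum, map_sum, Finsupp.finsetSum_apply]
  simp only [map_smul, Finsupp.smul_apply, Module.Basis.repr_self, Finsupp.single_apply,
    smul_eq_mul, mul_ite, mul_one, mul_zero]
  rw [Finset.sum_ite_eq']

variable {K}

/-- On a pair `y < s y` the coefficients have ratio `-v²`, which makes an eigenvector of `T_s` for
`-1`. Any finite `s`-stable set will do, so this applies to parabolic subgroups and to double
cosets. -/
theorem r_mul_altSum {a : R} (ha : a ∈ D.simple) {s : Finset G} (hs : ∀ x ∈ s, D.r a * x ∈ s) :
    K.T (D.r a) * K.altSum s = -K.altSum s := by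
  classical
  refine K.T.repr.injective (Finsupp.ext fun y => ?_)
  have e : D.r a * y ∈ s ↔ y ∈ s := ⟨fun h => by
    have := hs _ h; rwa [r_mul_r_mul] at this, hs y⟩
  rw [repr_r_mul ha, map_neg, Finsupp.neg_apply]
  simp only [repr_altSum, e]
  by_cases hy : y ∈ s
  · simp only [hy, if_true]
    split_ifs with hp
    · exact v_mul_altCoeff (len_r_mul ha hp)
    · have h2 := v_mul_altCoeff (D := D) (len_r_mul_of_not ha hp).symm
      linear_combination h2
  · simp [hy]

theorem altSum_mul_r {a : R} (ha : a ∈ D.simple) {s : Finset G} (hs : ∀ x ∈ s, x * D.r a ∈ s) :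
    K.altSum s * K.T (D.r a) = -K.altSum s := by
  classical
  refine K.T.repr.injective (Finsupp.ext fun y => ?_)
  have e : y * D.r a ∈ s ↔ y ∈ s := ⟨fun h => by
    have := hs _ h; rwa [mul_r_mul_r] at this, hs y⟩
  rw [repr_mul_r ha, map_neg, Finsupp.neg_apply]
  simp only [repr_altSum, e]
  by_cases hy : y ∈ s
  · simp only [hy, if_true]
    split_ifs with hp
    · exact v_mul_altCoeff (len_mul_r ha hp)
    · have h2 := v_mul_altCoeff (D := D) (len_mul_r_of_not ha hp).symm
      linear_combination h2
  · simp [hy]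

theorem par_mul_of_sign {I : Set R} (hI : I ⊆ D.simple) {h : H}
    (hh : ∀ a ∈ I, K.T (D.r a) * h = -h) {u : G} (hu : u ∈ D.par I) :
    K.T u * h = (-1 : A) ^ D.len u • h := by
  refine par_induction_reduced hI (p := fun u => K.T u * h = (-1 : A) ^ D.len u • h)
    (by simp [K.T_one]) (fun a ha x _ hp ih => ?_) hu
  rw [← r_mul_T (hI ha) hp, mul_assoc, ih, mul_smul_comm, hh a ha, len_r_mul (hI ha) hp, pow_succ,
    mul_neg_one, neg_smul, smul_neg]

theorem mul_par_of_sign {I : Set R} (hI : I ⊆ D.simple) {h : H}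
    (hh : ∀ a ∈ I, h * K.T (D.r a) = -h) {u : G} (hu : u ∈ D.par I) :
    h * K.T u = (-1 : A) ^ D.len u • h := by
  refine par_induction_reduced_right hI (p := fun u => h * K.T u = (-1 : A) ^ D.len u • h)
    (by simp [K.T_one]) (fun a ha x _ hp ih => ?_) hu
  rw [← T_mul_r (hI ha) hp, ← mul_assoc, ih, smul_mul_assoc, hh a ha, len_mul_r (hI ha) hp,
    pow_succ, mul_neg_one, neg_smul, smul_neg]

/-- A sign vector has its coordinates on `W_I` fixed by the one at `1`. With a support condition,
this determines `C_{w_I}` up to a scalar. -/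
theorem repr_of_sign {I : Set R} (hI : I ⊆ D.simple) {h : H}
    (hh : ∀ a ∈ I, K.T (D.r a) * h = -h) {u : G} (hu : u ∈ D.par I) :
    K.T.repr h u = altCoeff D u * K.T.repr h 1 := by
  classical
  refine par_induction_reduced hI (p := fun u => K.T.repr h u = altCoeff D u * K.T.repr h 1)
    (by simp [altCoeff]) (fun a ha x _ hp ih => ?_) hu
  have h1 := repr_r_mul (K := K) (hI ha) h x
  rw [hh a ha, if_pos hp, map_neg, Finsupp.neg_apply, ih] at h1
  refine mul_left_cancel₀ (v_ne_zero 2) ?_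
  rw [← h1, ← mul_assoc, v_mul_altCoeff (len_r_mul (hI ha) hp), neg_mul]

variable (K) in
/-- `h` is a combination of the `T_x` with `x ∈ S`. -/
def SuppIn (S : Set G) (h : H) : Prop := ∀ x, K.T.repr h x ≠ 0 → x ∈ S

theorem SuppIn.add {S : Set G} {g h : H} (hg : K.SuppIn S g) (hh : K.SuppIn S h) :
    K.SuppIn S (g + h) := fun x hx => by
  by_cases h0 : K.T.repr g x = 0
  · exact hh x fun h1 => hx (by rw [map_add, Finsupp.add_apply, h0, h1, add_zero])
  · exact hg x h0

theorem SuppIn.smul {S : Set G} {h : H} (hh : K.SuppIn S h) (t : A) : K.SuppIn S (t • h) :=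
  fun x hx => hh x fun h1 => hx (by rw [map_smul, Finsupp.smul_apply, h1, smul_zero])

theorem SuppIn.zero (S : Set G) : K.SuppIn S 0 := fun x hx => absurd (by simp) hx

theorem SuppIn.sum {α : Type*} {S : Set G} {s : Finset α} {g : α → H}
    (hg : ∀ i ∈ s, K.SuppIn S (g i)) : K.SuppIn S (∑ i ∈ s, g i) :=
  Finset.sum_induction _ _ (fun _ _ => SuppIn.add) (.zero S) hg

theorem suppIn_T {S : Set G} {x : G} (hx : x ∈ S) : K.SuppIn S (K.T x) := fun y hy => by
  classical
  rw [Module.Basis.repr_self, Finsupp.single_apply] at hy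
  split_ifs at hy with h
  · rwa [← h]
  · exact absurd rfl hy

theorem SuppIn.r_mul {a : R} (ha : a ∈ D.simple) {S : Set G} (hS : ∀ x ∈ S, D.r a * x ∈ S) {h : H}
    (hh : K.SuppIn S h) : K.SuppIn S (K.T (D.r a) * h) := fun x hx => by
  classical
  by_contra hxS
  have h1 : K.T.repr h x = 0 := by by_contra h'; exact hxS (hh x h')
  have h2 : K.T.repr h (D.r a * x) = 0 := by
    by_contra h'
    have := hS _ (hh _ h')
    rw [r_mul_r_mul] at this
    exact hxS this
  rw [repr_r_mul ha, h1, h2] at hx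
  simp at hx

theorem SuppIn.mul_r {a : R} (ha : a ∈ D.simple) {S : Set G} (hS : ∀ x ∈ S, x * D.r a ∈ S) {h : H}
    (hh : K.SuppIn S h) : K.SuppIn S (h * K.T (D.r a)) := fun x hx => by
  classical
  by_contra hxS
  have h1 : K.T.repr h x = 0 := by by_contra h'; exact hxS (hh x h')
  have h2 : K.T.repr h (x * D.r a) = 0 := by
    by_contra h'
    have := hS _ (hh _ h')
    rw [mul_r_mul_r] at this
    exact hxS this
  rw [repr_mul_r ha, h1, h2] at hx
  simp at hx

theorem SuppIn.par_mul {I : Set R} (hI : I ⊆ D.simple) {S : Set G}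
    (hS : ∀ a ∈ I, ∀ x ∈ S, D.r a * x ∈ S) {h : H} (hh : K.SuppIn S h) {u : G}
    (hu : u ∈ D.par I) : K.SuppIn S (K.T u * h) := by
  refine par_induction_reduced hI (p := fun u => K.SuppIn S (K.T u * h))
    (by rwa [K.T_one, one_mul]) (fun a ha x _ hp ih => ?_) hu
  rw [← r_mul_T (hI ha) hp, mul_assoc]
  exact ih.r_mul (hI ha) (hS a ha)

theorem SuppIn.mul_par {I : Set R} (hI : I ⊆ D.simple) {S : Set G}
    (hS : ∀ a ∈ I, ∀ x ∈ S, x * D.r a ∈ S) {h : H} (hh : K.SuppIn S h) {u : G}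
    (hu : u ∈ D.par I) : K.SuppIn S (h * K.T u) := by
  refine par_induction_reduced_right hI (p := fun u => K.SuppIn S (h * K.T u))
    (by rwa [K.T_one, mul_one]) (fun a ha x _ hp ih => ?_) hu
  rw [← T_mul_r (hI ha) hp, ← mul_assoc]
  exact ih.mul_r (hI ha) (hS a ha)

/-! #### The elements `C_{w_I}` -/

variable (K) in
/-- The element `c = C_{w_I}`, where `s` is the set of elements of the parabolic subgroup `W_I`. -/
structure IsParC (I : Set R) (s : Finset G) (N : ℕ) (c : H) : Prop where
  subset : I ⊆ D.simple
  mem_iff : ∀ x, x ∈ s ↔ x ∈ D.par I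
  len_le : ∀ x ∈ s, D.len x ≤ N
  exists_len : ∃ x ∈ s, D.len x = N
  eq : c = (-v 1) ^ N • K.altSum s

section

variable {I : Set R} {s : Finset G} {N : ℕ} {c : H} (hc : K.IsParC I s N c)
include hc

theorem IsParC.r_mul {a : R} (ha : a ∈ I) : K.T (D.r a) * c = -c := by
  rw [hc.eq, mul_smul_comm, r_mul_altSum (hc.subset ha), smul_neg]
  intro x hx
  rw [hc.mem_iff] at hx ⊢
  exact mul_mem (D.r_mem_par ha) hx

theorem IsParC.mul_r {a : R} (ha : a ∈ I) : c * K.T (D.r a) = -c := by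
  rw [hc.eq, smul_mul_assoc, altSum_mul_r (hc.subset ha), smul_neg]
  intro x hx
  rw [hc.mem_iff] at hx ⊢
  exact mul_mem hx (D.r_mem_par ha)

theorem IsParC.suppIn_barT {u : G} (hu : u ∈ D.par I) :
    K.SuppIn (D.par I : Set G) (K.barT u) := by
  refine par_induction_reduced hc.subset (p := fun u => K.SuppIn (D.par I : Set G) (K.barT u))
    (by rw [K.barT_of_len_eq_zero len_one]; exact suppIn_T (one_mem _))
    (fun a ha x _ hp ih => ?_) hu
  rw [K.barT_r_mul (hc.subset ha) hp, K.barT_r (hc.subset ha), add_mul, smul_mul_assoc,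
    smul_mul_assoc, one_mul]
  exact ((ih.r_mul (hc.subset ha) fun x hx => mul_mem (D.r_mem_par ha) hx).smul _).add (ih.smul _)

/-- The dual of `T_s` is its inverse, so `f c` is again a sign vector supported on `W_I`. It is thus
a multiple of `c`, and the multiple is read off at the longest element. -/
theorem IsParC.map_eq {f : H ≃+* H} (hf : K.IsBar f) : f c = c := by
  classical
  have h1 : ∀ a ∈ I, K.T (D.r a) * f c = -f c := by
    intro a ha
    have h2 := congrArg f (hc.r_mul ha)
    rw [map_mul, map_neg, hf.map_T] at h2
    have h3 := K.T_inv_mul_barT (D.r a)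
    rw [D.r_inv] at h3
    have h4 : f c = -(K.T (D.r a) * f c) := by
      rw [← mul_neg, ← h2, ← mul_assoc, h3, one_mul]
    rw [eq_neg_iff_add_eq_zero]
    exact add_eq_zero_iff_eq_neg'.2 h4
  have h0 : f c = ∑ x ∈ s, LaurentPolynomial.invert ((-v 1) ^ N * altCoeff D x) • K.barT x := by
    rw [hc.eq, altSum, Finset.smul_sum, map_sum]
    simp only [smul_smul, hf.map_smul, hf.map_T]
  have hsupp : K.SuppIn (D.par I : Set G) (f c) := by
    rw [h0]
    exact SuppIn.sum fun x hx => (hc.suppIn_barT ((hc.mem_iff x).1 hx)).smul _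
  obtain ⟨w, hw, hwN⟩ := hc.exists_len
  -- By triangularity only the term of `w` itself reaches `w`. Its coefficient is `v^(-N)` on both
  -- sides, which is the purpose of the factor `(-v)^N`.
  have htop : K.T.repr (f c) w = K.T.repr c w := by
    rw [h0, map_sum, Finsupp.finsetSum_apply, Finset.sum_eq_single_of_mem w hw]
    · rw [map_smul, Finsupp.smul_apply, K.repr_barT w w le_rfl, if_pos rfl, hc.eq, map_smul,
        Finsupp.smul_apply, repr_altSum, if_pos hw, altCoeff, hwN]
      have e1 : ((-v 1 : A) ^ N) = (-1) ^ N * v N := by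
        rw [neg_pow, LaurentPolynomial.T_pow, mul_one]
      have e2 : ((-1 : A) ^ N) * (-1) ^ N = 1 := by rw [← mul_pow]; simp
      rw [e1, map_mul, map_mul, map_mul, map_pow, map_neg, map_one, LaurentPolynomial.invert_T,
        LaurentPolynomial.invert_T, smul_eq_mul, smul_eq_mul]
      have e3 : ∀ m n : ℤ, ((-1 : A) ^ N) * v m * ((-1) ^ N * v n) = v (m + n) := fun m n => by
        rw [← v_mul_v]; linear_combination (v m * v n : A) * e2
      rw [e3, e3, v_mul_v]
      congr 1
      ring
    · intro x hx hxw
      rw [map_smul, Finsupp.smul_apply, K.repr_barT x w (by rw [hwN]; exact hc.len_le x hx),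
        if_neg hxw, smul_zero]
  have hα : K.T.repr (f c) 1 = (-v 1) ^ N := by
    have h2 := repr_of_sign (K := K) hc.subset h1 ((hc.mem_iff w).1 hw)
    have h3 : K.T.repr c w = altCoeff D w * (-v 1) ^ N := by
      rw [hc.eq, map_smul, Finsupp.smul_apply, repr_altSum, if_pos hw, smul_eq_mul, mul_comm]
    rw [htop, h3] at h2
    exact (mul_left_cancel₀ (altCoeff_ne_zero w) h2).symm
  refine K.T.repr.injective (Finsupp.ext fun y => ?_)
  by_cases hy : y ∈ D.par I
  · rw [repr_of_sign (K := K) hc.subset h1 hy, hα, hc.eq, map_smul, Finsupp.smul_apply,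
      repr_altSum, if_pos ((hc.mem_iff y).2 hy), smul_eq_mul, mul_comm]
  · have h2 : K.T.repr (f c) y = 0 := by
      by_contra h
      exact hy (hsupp y h)
    rw [h2, hc.eq, map_smul, Finsupp.smul_apply, repr_altSum, if_neg (mt (hc.mem_iff y).1 hy),
      smul_zero]

/-- Each `T_x` acts on `h` by `(-1)^ℓ(x)`, cancelling the alternating sign. What remains is a unit
times a sum of powers of `v`. -/
theorem IsParC.exists_mul_of_sign {h : H} (hh : ∀ a ∈ I, K.T (D.r a) * h = -h) :
    ∃ t : A, t ≠ 0 ∧ c * h = t • h := by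
  refine ⟨(-v 1) ^ N * ∑ x ∈ s, v (-2 * (D.len x : ℤ)), mul_ne_zero (pow_ne_zero _ ?_)
    (sum_v_ne_zero ((hc.mem_iff 1).2 (one_mem _))), ?_⟩
  · exact neg_ne_zero.2 (v_ne_zero _)
  · rw [hc.eq, smul_mul_assoc, altSum, Finset.sum_mul, mul_smul, Finset.sum_smul]
    congr 1
    refine Finset.sum_congr rfl fun x hx => ?_
    rw [smul_mul_assoc, par_mul_of_sign hc.subset hh ((hc.mem_iff x).1 hx), smul_smul, altCoeff,
      mul_right_comm, ← mul_pow]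
    simp

theorem IsParC.exists_mul_of_sign_right {h : H} (hh : ∀ a ∈ I, h * K.T (D.r a) = -h) :
    ∃ t : A, t ≠ 0 ∧ h * c = t • h := by
  refine ⟨(-v 1) ^ N * ∑ x ∈ s, v (-2 * (D.len x : ℤ)), mul_ne_zero (pow_ne_zero _ ?_)
    (sum_v_ne_zero ((hc.mem_iff 1).2 (one_mem _))), ?_⟩
  · exact neg_ne_zero.2 (v_ne_zero _)
  · rw [hc.eq, mul_smul_comm, altSum, Finset.mul_sum, mul_smul, Finset.sum_smul]
    congr 1
    refine Finset.sum_congr rfl fun x hx => ?_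
    rw [mul_smul_comm, mul_par_of_sign hc.subset hh ((hc.mem_iff x).1 hx), smul_smul, altCoeff,
      mul_right_comm, ← mul_pow]
    simp

end

/-! #### The module `C_{w_I} H C_{w_J}` -/

variable (D) in
/-- The double coset `W_I x W_J`. -/
def dblCoset (I J : Set R) (x : G) : Set G :=
  {y | ∃ u ∈ D.par I, ∃ u' ∈ D.par J, y = u * x * u'}

variable (D) in
/-- `x` has no left descents in `I` and no right descents in `J`. -/
def IsMin (I J : Set R) (x : G) : Prop :=
  (∀ a ∈ I, D.pos (x⁻¹ • a)) ∧ ∀ a ∈ J, D.pos (x • a)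

section

variable {I J : Set R} {s s' : Finset G} {N N' : ℕ} {c c' : H} (hc : K.IsParC I s N c)
  (hc' : K.IsParC J s' N' c')
include hc hc'

/-- If `s y > y` then `c T_{s y} = c T_s T_y = -c T_y`, and the length changes by one; if `s y < y`,
exchange the two. The right-hand side is symmetric. -/
theorem IsParC.mul_T_mul_const {x y : G} (hy : y ∈ dblCoset D I J x) :
    (-1 : A) ^ D.len y • (c * K.T y * c') = (-1 : A) ^ D.len x • (c * K.T x * c') := by
  have key1 : ∀ a ∈ I, ∀ y, (-1 : A) ^ D.len (D.r a * y) • (c * K.T (D.r a * y) * c') =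
      (-1 : A) ^ D.len y • (c * K.T y * c') := by
    have : ∀ a ∈ I, ∀ y, D.pos (y⁻¹ • a) →
        (-1 : A) ^ D.len (D.r a * y) • (c * K.T (D.r a * y) * c') =
          (-1 : A) ^ D.len y • (c * K.T y * c') := fun a ha y hp => by
      rw [← r_mul_T (hc.subset ha) hp, ← mul_assoc, hc.mul_r ha, len_r_mul (hc.subset ha) hp,
        pow_succ, mul_neg_one, neg_mul, neg_mul, neg_smul, smul_neg, neg_neg]
    intro a ha y
    by_cases hp : D.pos (y⁻¹ • a)
    · exact this a ha y hp
    · have h := this a ha (D.r a * y) (by rwa [D.smul_inv_r_mul, D.pos_neg])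
      rw [r_mul_r_mul] at h
      exact h.symm
  have key2 : ∀ a ∈ J, ∀ y, (-1 : A) ^ D.len (y * D.r a) • (c * K.T (y * D.r a) * c') =
      (-1 : A) ^ D.len y • (c * K.T y * c') := by
    have : ∀ a ∈ J, ∀ y, D.pos (y • a) →
        (-1 : A) ^ D.len (y * D.r a) • (c * K.T (y * D.r a) * c') =
          (-1 : A) ^ D.len y • (c * K.T y * c') := fun a ha y hp => by
      rw [← T_mul_r (hc'.subset ha) hp, mul_assoc, mul_assoc, hc'.r_mul ha,
        len_mul_r (hc'.subset ha) hp, pow_succ, mul_neg_one, mul_neg, mul_neg, neg_smul, smul_neg,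
        neg_neg, mul_assoc]
    intro a ha y
    by_cases hp : D.pos (y • a)
    · exact this a ha y hp
    · have h := this a ha (y * D.r a) (by rwa [D.smul_mul_r, D.pos_neg])
      rw [mul_r_mul_r] at h
      exact h.symm
  obtain ⟨u, hu, u', hu', rfl⟩ := hy
  rw [mul_assoc]
  trans (-1 : A) ^ D.len (x * u') • (c * K.T (x * u') * c')
  · refine par_induction (D := D) (p := fun u => (-1 : A) ^ D.len (u * (x * u')) •
      (c * K.T (u * (x * u')) * c') = (-1 : A) ^ D.len (x * u') • (c * K.T (x * u') * c'))
      (by rw [one_mul]) (fun a ha u _ ih => ?_) hu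
    rw [mul_assoc, key1 a ha, ih]
  · have := par_induction (D := D) (p := fun u => (-1 : A) ^ D.len (x * u⁻¹) •
      (c * K.T (x * u⁻¹) * c') = (-1 : A) ^ D.len x • (c * K.T x * c'))
      (by rw [inv_one, mul_one]) (fun a ha u _ ih => ?_) (inv_mem hu')
    · rwa [inv_inv] at this
    · rw [mul_inv_rev, D.r_inv, ← mul_assoc, key2 a ha, ih]

theorem IsParC.mul_T_mul {x y : G} (hy : y ∈ dblCoset D I J x) :
    c * K.T y * c' = (-1 : A) ^ (D.len y + D.len x) • (c * K.T x * c') := by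
  rw [pow_add, mul_smul, ← hc.mul_T_mul_const hc' hy, smul_smul, ← mul_pow]
  simp

theorem IsParC.mul_T_mul_suppIn (x : G) : K.SuppIn (dblCoset D I J x) (c * K.T x * c') := by
  have h1 : K.SuppIn (dblCoset D I J x) (c * K.T x) := by
    rw [hc.eq, altSum, smul_mul_assoc, Finset.sum_mul]
    refine (SuppIn.sum fun u hu => ?_).smul _
    rw [smul_mul_assoc]
    refine SuppIn.smul (SuppIn.par_mul hc.subset ?_ (suppIn_T ?_) ((hc.mem_iff u).1 hu)) _
    · rintro a ha _ ⟨w, hw, w', hw', rfl⟩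
      exact ⟨_, mul_mem (D.r_mem_par ha) hw, w', hw', by simp only [mul_assoc]⟩
    · exact ⟨1, one_mem _, 1, one_mem _, by simp⟩
  rw [hc'.eq, altSum, mul_smul_comm, Finset.mul_sum]
  refine (SuppIn.sum fun u hu => ?_).smul _
  rw [mul_smul_comm]
  refine SuppIn.smul (SuppIn.mul_par hc'.subset ?_ h1 ((hc'.mem_iff u).1 hu)) _
  rintro a ha _ ⟨w, hw, w', hw', rfl⟩
  exact ⟨w, hw, _, mul_mem hw' (D.r_mem_par ha), by simp only [mul_assoc]⟩

/-- The alternating sum over the double coset is a sign vector on both sides, so `c` and `c'`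
multiply it by non-zero scalars. The same product is a combination of elements `c T_y c'`, each of
them `c T_x c'` up to sign. -/
theorem IsParC.mul_T_mul_ne_zero (x : G) : c * K.T x * c' ≠ 0 := by
  classical
  intro h0
  let S : Finset G := (s ×ˢ s').image fun p => p.1 * x * p.2
  have hS : ∀ y, y ∈ S ↔ y ∈ dblCoset D I J x := by
    intro y
    simp only [S, Finset.mem_image, Finset.mem_product, Prod.exists, hc.mem_iff, hc'.mem_iff]
    constructor
    · rintro ⟨u, u', ⟨hu, hu'⟩, rfl⟩; exact ⟨u, hu, u', hu', rfl⟩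
    · rintro ⟨u, hu, u', hu', rfl⟩; exact ⟨u, u', ⟨hu, hu'⟩, rfl⟩
  obtain ⟨t, ht, h1⟩ := hc.exists_mul_of_sign (h := K.altSum S) fun a ha =>
    r_mul_altSum (hc.subset ha) fun y hy => by
      rw [hS] at hy ⊢
      obtain ⟨w, hw, w', hw', rfl⟩ := hy
      exact ⟨_, mul_mem (D.r_mem_par ha) hw, w', hw', by simp only [mul_assoc]⟩
  obtain ⟨t', ht', h2⟩ := hc'.exists_mul_of_sign_right (h := K.altSum S) fun a ha =>
    altSum_mul_r (hc'.subset ha) fun y hy => by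
      rw [hS] at hy ⊢
      obtain ⟨w, hw, w', hw', rfl⟩ := hy
      exact ⟨w, hw, _, mul_mem hw' (D.r_mem_par ha), by simp only [mul_assoc]⟩
  have h3 : c * K.altSum S * c' = 0 := by
    rw [altSum, Finset.mul_sum, Finset.sum_mul]
    refine Finset.sum_eq_zero fun y hy => ?_
    rw [mul_smul_comm, smul_mul_assoc, hc.mul_T_mul hc' ((hS y).1 hy), h0, smul_zero, smul_zero]
  rw [h1, smul_mul_assoc, h2, smul_smul] at h3
  have h4 := congrArg (fun h => K.T.repr h x) h3
  simp only [map_smul, Finsupp.smul_apply, repr_altSum, smul_eq_mul] at h4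
  rw [if_pos ((hS x).2 ⟨1, one_mem _, 1, one_mem _, by simp⟩)] at h4
  exact mul_ne_zero (mul_ne_zero ht ht') (altCoeff_ne_zero x) (by simpa using h4)

theorem IsParC.le_of_isMin {x y : G} (hx : IsMin D I J x) (hy : y ∈ dblCoset D I J x) :
    D.Le x y := by
  obtain ⟨u, hu, u', hu', rfl⟩ := hy
  exact le_of_mem_doubleCoset hc.subset hc'.subset hx.1 hx.2 hu hu'

/-- The supports lie in double cosets. Two minimal elements in one coset are below each other, hence
equal, so different ones have disjoint supports. -/
theorem IsParC.linearIndependent :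
    LinearIndependent A fun x : {x // IsMin D I J x} => c * K.T x * c' := by
  rw [linearIndependent_iff']
  intro t g hg x hx
  obtain ⟨y, hy⟩ := Finsupp.ne_iff.1
    ((map_ne_zero_iff _ K.T.repr.injective).2 (hc.mul_T_mul_ne_zero hc' x))
  have h1 := congrArg (fun h => K.T.repr h y) hg
  simp only [map_sum, Finsupp.finsetSum_apply, map_smul, Finsupp.smul_apply, map_zero,
    Finsupp.zero_apply] at h1 hy
  rw [Finset.sum_eq_single_of_mem x hx] at h1
  · exact (mul_eq_zero.1 h1).resolve_right hy
  · intro x' _ hne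
    by_contra h
    have h2 := hc.mul_T_mul_suppIn hc' x' y (fun h' => h (by rw [h', smul_zero]))
    have h3 := hc.mul_T_mul_suppIn hc' x y hy
    obtain ⟨u, hu, u', hu', rfl⟩ := h2
    obtain ⟨w, hw, w', hw', h4⟩ := h3
    have h5 : (x : G) ∈ dblCoset D I J x' := ⟨w⁻¹ * u, mul_mem (inv_mem hw) hu, u' * w'⁻¹,
      mul_mem hu' (inv_mem hw'), by
        calc (x : G) = w⁻¹ * (w * x * w') * w'⁻¹ := by group
          _ = _ := by rw [← h4]; group⟩
    have h6 : (x' : G) ∈ dblCoset D I J x := ⟨u⁻¹ * w, mul_mem (inv_mem hu) hw, w' * u'⁻¹,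
      mul_mem hw' (inv_mem hu'), by
        calc (x' : G) = u⁻¹ * (u * x' * u') * u'⁻¹ := by group
          _ = _ := by rw [h4]; group⟩
    have h7 := (hc.le_of_isMin hc' x'.2 h5).eq_or_len_lt
    have h8 := (hc.le_of_isMin hc' x.2 h6).len_le
    refine hne (Subtype.ext (h7.resolve_right ?_))
    omega

variable (K c c') in
omit hc hc' in
/-- The defining property of `C'_{λ,z}`, where the family `m` consists of the elements of minimal
length of the double cosets. -/
def IsKLIJ {α : Type*} (m : α → G) (f : H ≃+* H) (a : α) (h : H) : Prop :=
  f h = h ∧ ∃ p : α →₀ ℤ[X],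
    (∀ a' ∈ p.support, D.Lt (m a') (m a) ∧
      (p a').natDegree + D.len (m a') + 1 ≤ D.len (m a)) ∧
    h = v (-(D.len (m a) : ℤ)) • (c * K.T (m a) * c') +
      p.sum fun a' q => (v (-(D.len (m a) : ℤ)) * Polynomial.toLaurent q) •
        (c * K.T (m a') * c')

variable {α : Type*} {m : α → G} {f : H ≃+* H}

theorem IsParC.isKLIJ (hf : K.IsBar f) (hm : ∀ a, IsMin D I J (m a))
    (hm' : ∀ y, ∃ a, y ∈ dblCoset D I J (m a)) (a : α) {d : H} (hd : K.IsKL f (m a) d) :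
    K.IsKLIJ c c' m f a (c * d * c') := by
  classical
  choose i hi using hm'
  obtain ⟨h1, p, h2, h3⟩ := hd
  refine ⟨by rw [map_mul, map_mul, h1, hc.map_eq hf, hc'.map_eq hf], ?_⟩
  -- The sign comes from replacing `y` by the representative of its double coset. Polynomials of all
  -- `y` with the same chosen index are then added up.
  let g : G → ℤ[X] := fun y => (-1) ^ (D.len y + D.len (m (i y))) * p y
  have hle : ∀ y, D.Le (m (i y)) y := fun y => hc.le_of_isMin hc' (hm _) (hi y)
  refine ⟨∑ y ∈ p.support, Finsupp.single (i y) (g y), fun a' ha' => ?_, ?_⟩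
  · have hsum : (∑ y ∈ p.support, Finsupp.single (i y) (g y)) a' =
        ∑ y ∈ p.support with i y = a', g y := by
      rw [Finsupp.finsetSum_apply, Finset.sum_filter]
      simp only [Finsupp.single_apply]
    rw [Finsupp.mem_support_iff, hsum] at ha'
    rw [hsum]
    obtain ⟨y, hy, _⟩ := Finset.exists_ne_zero_of_sum_ne_zero ha'
    rw [Finset.mem_filter] at hy
    have hlt : D.Lt (m a') (m a) := by
      rw [← hy.2]
      exact (hle y).trans_lt (h2 y hy.1).1
    refine ⟨hlt, ?_⟩
    have hlen := hlt.len_lt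
    have : (∑ y ∈ p.support with i y = a', g y).natDegree ≤
        D.len (m a) - D.len (m a') - 1 := by
      refine Polynomial.natDegree_sum_le_of_forall_le _ _ fun z hz => ?_
      rw [Finset.mem_filter] at hz
      have h4 := (h2 z hz.1).2
      have h5 := (hle z).len_le
      rw [hz.2] at h5
      have h6 : (g z).natDegree = (p z).natDegree := by
        rcases neg_one_pow_eq_or ℤ[X] (D.len z + D.len (m (i z))) with h | h
        · simp only [g, h, one_mul]
        · simp only [g, h, neg_one_mul, Polynomial.natDegree_neg]
      omega
    omega
  · rw [h3, mul_add, add_mul, mul_smul_comm, smul_mul_assoc]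
    congr 1
    rw [← Finsupp.sum_finsetSum_index (by simp) (by
      intro a' q q'; rw [map_add, mul_add, add_smul])]
    rw [Finsupp.sum, Finset.mul_sum, Finset.sum_mul]
    refine Finset.sum_congr rfl fun y _ => ?_
    rw [Finsupp.sum_single_index (by simp), mul_smul_comm, smul_mul_assoc,
      hc.mul_T_mul hc' (hi y), smul_smul]
    congr 1
    simp only [g, map_mul, map_pow, map_neg, map_one]
    ring

/-- Duality commutes with `h ↦ c h c'`, so this is the image of the triangularity of the `T_x`.
Passing to minimal representatives only shortens the error terms. -/
theorem IsParC.map_mul_T_mul_sub_mem (hf : K.IsBar f) (hm : ∀ a, IsMin D I J (m a))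
    (hm' : ∀ y, ∃ a, y ∈ dblCoset D I J (m a)) (x : G) :
    f (c * K.T x * c') - (v (-2 * (D.len x : ℤ)) : A) • (c * K.T x * c') ∈
      Submodule.span A ((fun y : {y // IsMin D I J y} => c * K.T y * c') ''
        {y | D.len (y : G) < D.len x}) := by
  have h1 := hf.map_T_sub_mem x
  have h2 : f (c * K.T x * c') - (v (-2 * (D.len x : ℤ)) : A) • (c * K.T x * c') =
      LinearMap.mulLeftRight A (c, c') (f (K.T x) - (v (-2 * (D.len x : ℤ)) : A) • K.T x) := by
    simp only [LinearMap.mulLeftRight_apply, map_mul, hc.map_eq hf, hc'.map_eq hf, mul_sub, sub_mul,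
      mul_smul_comm, smul_mul_assoc]
  rw [h2]
  refine Submodule.span_induction (p := fun h _ => LinearMap.mulLeftRight A (c, c') h ∈ _)
    ?_ ?_ ?_ ?_ h1
  · rintro _ ⟨y, hy, rfl⟩
    obtain ⟨a, ha⟩ := hm' y
    rw [LinearMap.mulLeftRight_apply, hc.mul_T_mul hc' ha]
    refine Submodule.smul_mem _ _ (Submodule.subset_span ⟨⟨m a, hm a⟩, ?_, rfl⟩)
    exact (hc.le_of_isMin hc' (hm a) ha).len_le.trans_lt hy
  · rw [map_zero]; exact Submodule.zero_mem _
  · intro g h _ _ hg hh; rw [map_add]; exact Submodule.add_mem _ hg hh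
  · intro t h _ hh; rw [map_smul]; exact Submodule.smul_mem _ _ hh

theorem IsParC.isKLIJ_ext (hf : K.IsBar f) (hm : ∀ a, IsMin D I J (m a))
    (hm' : ∀ y, ∃ a, y ∈ dblCoset D I J (m a)) (a : α) {g h : H}
    (hg : K.IsKLIJ c c' m f a g) (hh : K.IsKLIJ c c' m f a h) : g = h := by
  classical
  let e : {x // IsMin D I J x} → H := fun x => c * K.T x * c'
  let N := {x // IsMin D I J x}
  -- The expansion is regrouped by minimal elements instead of indices, as `m` is not assumed
  -- injective.
  have key : ∀ {h}, K.IsKLIJ c c' m f a h → ∃ q : N →₀ A,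
      (∀ y : N, Between (-(D.len (m a) : ℤ)) (-(D.len (y : G) : ℤ) - 1) (q y)) ∧
      h = v (-(D.len (m a) : ℤ)) • (c * K.T (m a) * c') + Finsupp.linearCombination A e q := by
    rintro h ⟨_, p, h2, h3⟩
    refine ⟨∑ a' ∈ p.support, Finsupp.single ⟨m a', hm a'⟩
      (v (-(D.len (m a) : ℤ)) * Polynomial.toLaurent (p a')), fun y => ?_, ?_⟩
    · rw [Finsupp.finsetSum_apply]
      refine Finset.sum_induction _ _ (fun _ _ => Between.add) (.zero _ _) fun a' ha' => ?_
      rw [Finsupp.single_apply]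
      split_ifs with h
      · have h4 := (h2 a' ha').2
        rw [← h]
        refine ((between_toLaurent le_rfl).v_mul _).mono ?_ ?_
        · omega
        · dsimp only; omega
      · exact .zero _ _
    · rw [h3, map_sum]
      congr 1
      refine Finset.sum_congr rfl fun a' _ => ?_
      rw [Finsupp.linearCombination_single]
  obtain ⟨q, hq, hq'⟩ := key hg
  obtain ⟨q', hp, hp'⟩ := key hh
  have hsub : g - h = Finsupp.linearCombination A e (q - q') := by
    rw [hq', hp', map_sub]; abel
  have h0 := eq_zero_of_selfDual (hc.linearIndependent hc') (fun y : N => D.len (y : G))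
    (f : H →+ H) hf.map_smul (fun y => hc.map_mul_T_mul_sub_mem hc' hf hm hm' y)
    (q - q') (fun y => ?_) ?_
  · rw [← sub_eq_zero, hsub, h0, map_zero]
  · refine ⟨D.len (y : G) - D.len (m a), ?_⟩
    rw [Finsupp.sub_apply]
    exact (((hq y).sub (hp y)).v_mul _).mono (by omega) (by omega)
  · change f (Finsupp.linearCombination A e (q - q')) = Finsupp.linearCombination A e (q - q')
    rw [← hsub, map_sub, hg.1, hh.1]

end

end HeckeBasis

end

/-! ### Highest roots -/

namespace RootPairing

variable {ι M N : Type*} [AddCommGroup M] [AddCommGroup N]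

instance (Q : RootPairing ι ℤ M N) : Q.IsCrystallographic := ⟨fun i j => ⟨Q.pairing i j, by simp⟩⟩

theorem pairingIn_int_eq (Q : RootPairing ι ℤ M N) (i j : ι) :
    Q.pairingIn ℤ i j = Q.pairing i j := by
  have := Q.algebraMap_pairingIn ℤ i j
  simpa using this

namespace Base

variable {Q : RootPairing ι ℤ M N} (b : Q.Base)

/-- A positive root to which no simple root can be added. -/
def IsHighest (i : ι) : Prop :=
  b.IsPos i ∧ ∀ j ∈ b.support, Q.root i + Q.root j ∉ Set.range Q.root

variable {b}

theorem IsPos.root_ne_neg {i j : ι} (hi : b.IsPos i) (hj : b.IsPos j) : Q.root i ≠ -Q.root j := by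
  intro h
  let := Q.indexNeg
  have h1 : i = -j := Q.root.injective (by rw [h]; simp)
  rw [h1, IsPos.neg_iff_not] at hi
  exact hi hj

variable [Finite ι]

theorem pairing_pos_comm (i j : ι) : 0 < Q.pairing i j ↔ 0 < Q.pairing j i := by
  simpa only [pairingIn_int_eq] using Q.zero_lt_pairingIn_iff' (S := ℤ) (i := i) (j := j)

theorem pairing_neg_comm (i j : ι) : Q.pairing i j < 0 ↔ Q.pairing j i < 0 := by
  simpa only [pairingIn_int_eq] using Q.pairingIn_lt_zero_iff (S := ℤ) (i := i) (j := j)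

theorem pairing_nonneg_comm (i j : ι) : 0 ≤ Q.pairing i j ↔ 0 ≤ Q.pairing j i := by
  rw [← not_lt, ← not_lt, pairing_neg_comm]

theorem exists_root_sub {i j : ι} (h : 0 < Q.pairing i j) (h' : i ≠ j) :
    ∃ k, Q.root k = Q.root i - Q.root j :=
  Q.root_sub_root_mem_of_pairingIn_pos (by rwa [pairingIn_int_eq]) h'

theorem exists_root_add {i j : ι} (h : Q.pairing i j < 0) (h' : Q.root i ≠ -Q.root j) :
    ∃ k, Q.root k = Q.root i + Q.root j :=
  Q.root_add_root_mem_of_pairingIn_neg (by rwa [pairingIn_int_eq]) h'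

theorem IsHighest.pairing_simple_nonneg {i j : ι} (hi : b.IsHighest i) (hj : j ∈ b.support) :
    0 ≤ Q.pairing j i := by
  by_contra! h
  rw [pairing_neg_comm] at h
  exact hi.2 j hj (exists_root_add h (hi.1.root_ne_neg (b.isPos_of_mem_support hj)))

theorem IsHighest.pairing_nonneg {i j : ι} (hi : b.IsHighest i) (hj : b.IsPos j) :
    0 ≤ Q.pairing j i := by
  refine hj.induction_on_add (p := fun j => 0 ≤ Q.pairing j i)
    (fun j hj => hi.pairing_simple_nonneg hj) fun j k l hl h hk => ?_
  rw [Q.pairing_eq_add_of_root_eq_add hl]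
  exact add_nonneg h (hi.pairing_simple_nonneg hk)

/-- Suppose `k = i + l` is a root, with `l = j + s` and `s` simple. A positive pairing of `j` with
`k` would make `i + s` a root, one of `s` with `k` would make `i + j` a root. So `l` pairs
non-positively with `k`, although `⟨k, l⟩ = ⟨i, l⟩ + 2 > 0`. -/
theorem IsHighest.root_add_notMem {i j : ι} (hi : b.IsHighest i) (hj : b.IsPos j) :
    Q.root i + Q.root j ∉ Set.range Q.root := by
  suffices b.IsPos j ∧ Q.root i + Q.root j ∉ Set.range Q.root from this.2
  refine hj.induction_on_add (p := fun j => b.IsPos j ∧ Q.root i + Q.root j ∉ Set.range Q.root)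
    (fun j hj => ⟨b.isPos_of_mem_support hj, hi.2 j hj⟩) ?_
  rintro j s l hl ⟨hj, ih⟩ hs
  have hs' := b.isPos_of_mem_support hs
  have hlpos : b.IsPos l := hj.add hs' hl
  refine ⟨hlpos, ?_⟩
  rintro ⟨k, hk⟩
  have hk2 : Q.pairing k k = Q.pairing i k + Q.pairing l k := Q.pairing_eq_add_of_root_eq_add hk
  have hl2 : Q.pairing l k = Q.pairing j k + Q.pairing s k := Q.pairing_eq_add_of_root_eq_add hl
  have hjk : Q.pairing j k ≤ 0 := by
    by_contra! h
    rw [pairing_pos_comm] at h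
    have hne : k ≠ j := by
      rintro rfl
      refine hi.1.root_ne_neg hs' ?_
      rw [hl, add_left_comm] at hk
      rw [eq_neg_iff_add_eq_zero]
      exact left_eq_add.1 hk
    obtain ⟨m, hm⟩ := exists_root_sub h hne
    refine hi.2 s hs ⟨m, ?_⟩
    rw [hm, hk, hl]; abel
  have hsk : Q.pairing s k ≤ 0 := by
    by_contra! h
    rw [pairing_pos_comm] at h
    have hne : k ≠ s := by
      rintro rfl
      refine hi.1.root_ne_neg hj ?_
      rw [hl] at hk
      rw [eq_neg_iff_add_eq_zero]
      have := hk
      rw [← add_assoc, right_eq_add] at this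
      exact this
    obtain ⟨m, hm⟩ := exists_root_sub h hne
    refine ih ⟨m, ?_⟩
    rw [hm, hk, hl]; abel
  have hlk : ¬ 0 < Q.pairing k l := by rw [← pairing_pos_comm]; omega
  have h1 : Q.pairing k l = Q.pairing i l + Q.pairing l l := Q.pairing_eq_add_of_root_eq_add hk
  rw [Q.pairing_same] at h1
  have h2 := (pairing_nonneg_comm l i).1 (hi.pairing_nonneg hlpos)
  omega

/-- A counterexample `m` of maximal height is itself highest. As `m - i` is a root, either it or its
negative is positive, and adding it to one of the two highest roots `i`, `m` gives the other. -/
theorem IsHighest.pairing_le_one {i j : ι} (hi : b.IsHighest i) (hj : b.IsPos j) (hij : j ≠ i) :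
    Q.pairing j i ≤ 1 := by
  by_contra! h0
  let S : Set ι := {j | b.IsPos j ∧ j ≠ i ∧ 2 ≤ Q.pairing j i}
  obtain ⟨m, ⟨hm1, hm2, hm3⟩, hmax⟩ :=
    S.exists_max_image b.height (Set.toFinite _) ⟨j, hj, hij, h0⟩
  have hmh : b.IsHighest m := by
    refine ⟨hm1, fun s hs ⟨k, hk⟩ => ?_⟩
    have hkpos : b.IsPos k := hm1.add (b.isPos_of_mem_support hs) hk
    have hki : Q.pairing k i = Q.pairing m i + Q.pairing s i :=
      Q.pairing_eq_add_of_root_eq_add hk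
    have hsi := hi.pairing_simple_nonneg hs
    -- If `m + s = i`, the pairings force `⟨m, s⟩ = -2`; then the reflection of `m` in `s` is `m +
    -- 2s = i + s`, a root above `i`.
    have hne : k ≠ i := by
      rintro rfl
      rw [Q.pairing_same] at hki
      have h1 : Q.pairing s k = 0 := by omega
      have h2 : Q.pairing k s = 0 := by
        have h3 := pairing_pos_comm (Q := Q) k s
        have h4 := pairing_neg_comm (Q := Q) k s
        omega
      have h5 : Q.pairing k s = Q.pairing m s + Q.pairing s s :=
        Q.pairing_eq_add_of_root_eq_add hk
      rw [h2, Q.pairing_same] at h5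
      refine hi.2 s hs ⟨Q.reflectionPerm s m, ?_⟩
      rw [Q.root_reflectionPerm, Q.reflection_apply_root, hk]
      have : Q.pairing m s = -2 := by omega
      rw [this]
      module
    have := hmax k ⟨hkpos, hne, by omega⟩
    have h6 := b.height_add hk
    have h7 := b.height_one_of_mem_support hs
    omega
  obtain ⟨k, hk⟩ := exists_root_sub (Q := Q) (i := m) (j := i) (by omega) hm2
  let := Q.indexNeg
  rcases IsPos.or_neg b k with hp | hp
  · exact hi.root_add_notMem hp ⟨m, by rw [hk]; abel⟩
  · refine hmh.root_add_notMem hp ⟨i, ?_⟩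
    have : Q.root (-k) = -Q.root k := by simp
    rw [this, hk]; abel

variable (b)

/-- A function on the positive roots that is additive and positive on the simple roots, and less
than `M` on the highest roots, only has values between `0` and `M`. -/
theorem additive_bounds {φ : ι → ℤ} {B : ℤ}
    (hadd : ∀ i j k, Q.root k = Q.root i + Q.root j → φ k = φ i + φ j)
    (hs : ∀ i ∈ b.support, 0 < φ i) (hh : ∀ i, b.IsHighest i → φ i < B) {i : ι}
    (hi : b.IsPos i) : 0 < φ i ∧ φ i < B := by
  have hpos : ∀ i, b.IsPos i → 0 < φ i := fun i hi =>
    hi.induction_on_add (p := fun j => 0 < φ j) hs fun i j k hk h hj => by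
      rw [hadd i j k hk]; exact add_pos h (hs j hj)
  refine ⟨hpos i hi, ?_⟩
  obtain ⟨B', hB'⟩ := (Set.finite_range b.height).bddAbove
  have hB : ∀ i, b.height i ≤ B' := fun i => hB' ⟨i, rfl⟩
  induction hn : (B' - b.height i).toNat using Nat.strong_induction_on generalizing i with
  | _ n ih =>
  by_cases h : b.IsHighest i
  · exact hh i h
  · simp only [IsHighest, hi, true_and, not_forall, not_not] at h
    obtain ⟨j, hj, k, hk⟩ := h
    have h1 := b.height_add hk
    have h2 := b.height_one_of_mem_support hj
    have h3 := hB k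
    have := ih _ (by omega) (hi.add (b.isPos_of_mem_support hj) hk) rfl
    rw [hadd i j k hk] at this
    have := hs j hj
    omega

/-! ### Positivity of roots and coroots -/

theorem IsPos.flip [Q.IsReduced] [Q.flip.IsReduced] {i : ι} (hi : b.IsPos i) :
    b.flip.IsPos i := by
  -- Roots and coroots share the reflection permutations, and in both systems a simple reflection
  -- preserves positivity away from its own root. Positivity becomes a premise so that the induction
  -- can use it at the intermediate root.
  suffices b.IsPos i → b.flip.IsPos i from this hi
  refine hi.induction_on_reflect (p := fun i => b.IsPos i → b.flip.IsPos i)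
    (fun i hi _ => b.flip.isPos_of_mem_support hi) fun i j ih hj h => ?_
  by_cases hij : i = j
  · subst hij
    let := Q.indexNeg
    have : b.IsPos (-i) := h
    rw [IsPos.neg_iff_not] at this
    exact absurd (b.isPos_of_mem_support hj) this
  by_cases hij' : Q.reflectionPerm j i = j
  · rw [hij']; exact b.flip.isPos_of_mem_support hj
  · have h1 : b.IsPos i := by
      have := h.reflectionPerm hj hij'
      rwa [Q.reflectionPerm_self] at this
    exact (ih h1).reflectionPerm (b := b.flip) hj hij

theorem flip_isReduced [Q.IsReduced] : Q.flip.IsReduced := by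
  have h1 : Module.IsReflexive ℤ M := .of_isPerfPair Q.toLinearMap
  have h2 : Module.IsReflexive ℤ N := .of_isPerfPair Q.flip.toLinearMap
  infer_instance

theorem flip_isPos_iff [Q.IsReduced] (i : ι) : b.flip.IsPos i ↔ b.IsPos i := by
  have := flip_isReduced (Q := Q)
  refine ⟨fun h => ?_, IsPos.flip b⟩
  by_contra h'
  let := Q.indexNeg
  rw [← IsPos.neg_iff_not] at h'
  have h2 := IsPos.flip b h'
  have h3 := IsPos.neg_iff_not b.flip i
  exact h3.1 h2 h

end Base

end RootPairing

/-! ### The reflection system of the extended affine Weyl group -/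

namespace AffHecke

variable {ι X Y : Type*} [AddCommGroup X] [AddCommGroup Y]

section

variable (P : RootDatum ι X Y)

/-- The pairing of an element of `X` with a coroot. -/
def corootEval (x : X) (i : ι) : ℤ := P.toLinearMap x (P.coroot i)

@[simp] theorem corootEval_add (x y : X) (i : ι) :
    corootEval P (x + y) i = corootEval P x i + corootEval P y i := by
  simp [corootEval]

@[simp] theorem corootEval_zero (i : ι) : corootEval P 0 i = 0 := by simp [corootEval]

@[simp] theorem corootEval_zsmul (n : ℤ) (x : X) (i : ι) :
    corootEval P (n • x) i = n * corootEval P x i := by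
  simp [corootEval]

@[simp] theorem corootEval_root (i j : ι) : corootEval P (P.root i) j = P.pairing i j := rfl

theorem corootEval_eq_add {i j k : ι} (h : P.coroot k = P.coroot i + P.coroot j) (x : X) :
    corootEval P x k = corootEval P x i + corootEval P x j := by
  simp [corootEval, h]

theorem weylGroupToPerm_refl (i : ι) : P.weylGroupToPerm (refl P i) = P.reflectionPerm i := rfl

theorem coweightMap_coroot (w : P.weylGroup) (i : ι) :
    w.1.coweightMap (P.coroot i) = P.coroot ((P.weylGroupToPerm w).symm i) :=
  RootPairing.Hom.coroot_coweightMap_apply P P i w.1.toHom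

theorem corootEval_smul (w : P.weylGroup) (x : X) (i : ι) :
    corootEval P (w • x) i = corootEval P x ((P.weylGroupToPerm w).symm i) := by
  have h := RootPairing.Hom.weight_coweight_transpose_apply P P (P.coroot i) w.1.toHom
  have h' := LinearMap.congr_fun h x
  rw [corootEval, corootEval, ← coweightMap_coroot]
  exact h'

theorem coroot_perm_add (w : P.weylGroup) {i j k : ι} (h : P.coroot k = P.coroot i + P.coroot j) :
    P.coroot (P.weylGroupToPerm w k) =
      P.coroot (P.weylGroupToPerm w i) + P.coroot (P.weylGroupToPerm w j) := by
  have key : ∀ i, P.coroot (P.weylGroupToPerm w i) = w⁻¹.1.coweightMap (P.coroot i) := by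
    intro i
    rw [coweightMap_coroot, map_inv]
    rfl
  rw [key, key, key, h, map_add]

theorem refl_smul (i : ι) (x : X) : refl P i • x = x - corootEval P x i • P.root i :=
  P.reflection_apply i x

theorem refl_mul_self (i : ι) : refl P i * refl P i = 1 := by
  apply Subtype.ext
  apply RootPairing.Equiv.weightHom_injective P
  ext x
  exact P.reflection_same i x

theorem weylGroup_eq_iff (w w' : P.weylGroup) : w = w' ↔ ∀ x : X, w • x = w' • x := by
  refine ⟨fun h x => by rw [h], fun h => ?_⟩
  apply Subtype.ext
  apply RootPairing.Equiv.weightHom_injective P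
  ext x
  exact h x

theorem refl_perm (w : P.weylGroup) (i : ι) :
    refl P (P.weylGroupToPerm w i) = w * refl P i * w⁻¹ := by
  rw [weylGroup_eq_iff]
  intro x
  rw [mul_smul, mul_smul, refl_smul, refl_smul, smul_sub, smul_inv_smul, corootEval_smul, map_inv,
    smul_comm, RootPairing.weylGroup_apply_root]
  rfl

/-- The affine roots: the pair `(i, k)` stands for the affine function `x ↦ ⟨x, α_i^∨⟩ + k`. -/
def AffRoot (_ : RootDatum ι X Y) : Type _ := ι × ℤ

variable {P}

theorem extWeyl_left_mul (x y : ExtWeyl P) :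
    (x * y).left.toAdd = x.left.toAdd + x.right • y.left.toAdd := rfl

instance : MulAction (ExtWeyl P) (AffRoot P) where
  smul x a := (P.weylGroupToPerm x.right a.1,
    a.2 - corootEval P x.left.toAdd (P.weylGroupToPerm x.right a.1))
  one_smul a := by
    refine Prod.ext rfl ?_
    change a.2 - corootEval P 0 _ = a.2
    simp
  mul_smul x y a := by
    have h : P.weylGroupToPerm (x.right * y.right) a.1 =
        P.weylGroupToPerm x.right (P.weylGroupToPerm y.right a.1) := by
      rw [map_mul]; rfl
    refine Prod.ext h ?_
    change a.2 - corootEval P (x * y).left.toAdd (P.weylGroupToPerm (x.right * y.right) a.1) =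
      a.2 - corootEval P y.left.toAdd (P.weylGroupToPerm y.right a.1) - corootEval P x.left.toAdd
        (P.weylGroupToPerm x.right (P.weylGroupToPerm y.right a.1))
    rw [h, extWeyl_left_mul, corootEval_add, corootEval_smul, Equiv.symm_apply_apply]
    ring

theorem smul_affRoot (x : ExtWeyl P) (i : ι) (k : ℤ) :
    x • (show AffRoot P from (i, k)) = (P.weylGroupToPerm x.right i,
      k - corootEval P x.left.toAdd (P.weylGroupToPerm x.right i)) := rfl

theorem transl_mul_ofW_left (x : X) (w : P.weylGroup) :
    (transl P x * ofW P w).left.toAdd = x := by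
  rw [extWeyl_left_mul]
  change x + _ • 0 = x
  simp

theorem transl_mul_ofW_right (x : X) (w : P.weylGroup) : (transl P x * ofW P w).right = w := by
  change 1 * w = w
  simp

theorem transl_mul_ofW (x : ExtWeyl P) : transl P x.left.toAdd * ofW P x.right = x :=
  SemidirectProduct.inl_left_mul_inr_right x

theorem ofW_mul_transl (w : P.weylGroup) (x : X) :
    ofW P w * transl P x = transl P (w • x) * ofW P w := by
  refine SemidirectProduct.ext ?_ ?_
  · change (1 : Multiplicative X) * Multiplicative.ofAdd (w • x) =
      Multiplicative.ofAdd (w • x) * Multiplicative.ofAdd ((1 : P.weylGroup) • 0)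
    simp
  · change w * 1 = 1 * w
    simp

variable (P) in
/-- The reflection in an affine root. -/
def affRefl (a : AffRoot P) : ExtWeyl P := transl P (-a.2 • P.root a.1) * ofW P (refl P a.1)

theorem affRefl_left (a : AffRoot P) : (affRefl P a).left.toAdd = -a.2 • P.root a.1 :=
  transl_mul_ofW_left _ _

theorem affRefl_right (a : AffRoot P) : (affRefl P a).right = refl P a.1 :=
  transl_mul_ofW_right _ _

theorem corootEval_reflectionPerm (x : X) (i j : ι) :
    corootEval P x (P.reflectionPerm i j) = corootEval P x j - P.pairing i j * corootEval P x i := by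
  rw [corootEval, P.coroot_reflectionPerm, P.coreflection_apply_coroot]
  simp [corootEval]

theorem affRefl_smul (a : AffRoot P) (i : ι) (k : ℤ) :
    affRefl P a • (show AffRoot P from (i, k)) =
      (P.reflectionPerm a.1 i, k - a.2 * P.pairing a.1 i) := by
  rw [smul_affRoot, affRefl_left, affRefl_right, weylGroupToPerm_refl]
  refine Prod.ext rfl ?_
  simp only [corootEval_reflectionPerm, corootEval_zsmul, corootEval_root, P.pairing_same]
  ring

theorem affRefl_smul_root (x : ExtWeyl P) (a : AffRoot P) :
    affRefl P (x • a) = x * affRefl P a * x⁻¹ := by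
  rw [eq_mul_inv_iff_mul_eq]
  have h1 : (affRefl P (x • a)).right = x.right * refl P a.1 * x.right⁻¹ := by
    rw [affRefl_right, ← refl_perm]; rfl
  refine SemidirectProduct.ext (Multiplicative.toAdd.injective ?_) ?_
  · rw [extWeyl_left_mul, extWeyl_left_mul, affRefl_left, affRefl_right, affRefl_left]
    change -(a.2 - corootEval P x.left.toAdd (P.weylGroupToPerm x.right a.1)) •
      P.root (P.weylGroupToPerm x.right a.1) + refl P (P.weylGroupToPerm x.right a.1) • _ = _
    rw [refl_smul, smul_comm, RootPairing.weylGroup_apply_root]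
    module
  · rw [SemidirectProduct.mul_right, SemidirectProduct.mul_right, h1, affRefl_right]
    group

theorem affRefl_mul_self (a : AffRoot P) : affRefl P a * affRefl P a = 1 := by
  refine SemidirectProduct.ext (Multiplicative.toAdd.injective ?_) ?_
  · rw [extWeyl_left_mul, affRefl_left, affRefl_right, refl_smul, corootEval_zsmul,
      corootEval_root, P.pairing_same]
    change _ = (0 : X)
    module
  · rw [SemidirectProduct.mul_right, affRefl_right, refl_mul_self]
    rfl

/-- The negative of an affine root. -/
def affNeg (a : AffRoot P) : AffRoot P := (P.reflectionPerm a.1 a.1, -a.2)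

theorem affRefl_smul_self (a : AffRoot P) : affRefl P a • a = affNeg a := by
  refine (affRefl_smul a a.1 a.2).trans (Prod.ext rfl ?_)
  rw [P.pairing_same]
  change a.2 - a.2 * 2 = -a.2
  ring

theorem reflectionPerm_perm (w : P.weylGroup) (i : ι) :
    P.weylGroupToPerm w (P.reflectionPerm i i) =
      P.reflectionPerm (P.weylGroupToPerm w i) (P.weylGroupToPerm w i) := by
  rw [← weylGroupToPerm_refl, ← weylGroupToPerm_refl, refl_perm, map_mul, map_mul, map_inv]
  simp

theorem smul_affNeg (x : ExtWeyl P) (a : AffRoot P) : x • affNeg a = affNeg (x • a) := by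
  refine Prod.ext (reflectionPerm_perm _ _) ?_
  change -a.2 - corootEval P _ (P.weylGroupToPerm x.right (P.reflectionPerm a.1 a.1)) =
    -(a.2 - corootEval P _ (P.weylGroupToPerm x.right a.1))
  rw [reflectionPerm_perm, corootEval_reflectionPerm, P.pairing_same]
  ring

end

/-! ### Positive and simple affine roots -/

section Based

variable {P : RootDatum ι X Y} (b : P.Base)

/-- The simple affine roots. -/
def affSimpleRoots : Set (AffRoot P) :=
  {a | a.1 ∈ b.support ∧ a.2 = 0} ∪
    {a | ∃ i, IsHighestCoroot b i ∧ a = ((P.reflectionPerm i i, 1) : ι × ℤ)}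

theorem isPos_reflectionPerm_self (i : ι) : b.IsPos (P.reflectionPerm i i) ↔ ¬ b.IsPos i := by
  let := P.indexNeg
  exact RootPairing.Base.IsPos.neg_iff_not b i

theorem affPos_neg_iff (i : ι) (k : ℤ) :
    AffPos b (P.reflectionPerm i i) (-k) ↔ ¬ AffPos b i k := by
  simp only [AffPos, isPos_reflectionPerm_self]
  by_cases h : b.IsPos i
  · simp only [h, and_true, not_true, and_false, or_false]; omega
  · simp only [h, and_true, not_false_eq_true, and_false, or_false]; omega

/-- The height of a coroot. -/
def coheight (i : ι) : ℤ := b.flip.height i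

theorem coheight_reflectionPerm_self (i : ι) :
    coheight b (P.reflectionPerm i i) = -coheight b i :=
  b.flip.height_reflectionPerm_self i

theorem exists_coheight_lt [Finite ι] : ∃ M : ℤ, ∀ i, |coheight b i| < M := by
  obtain ⟨B, hB⟩ := (Set.finite_range fun i => |coheight b i|).bddAbove
  exact ⟨B + 1, fun i => Int.lt_add_one_of_le (hB ⟨i, rfl⟩)⟩

variable [Finite ι] [P.IsReduced]

theorem isHighestCoroot_iff (i : ι) : IsHighestCoroot b i ↔ b.flip.IsHighest i := by
  rw [IsHighestCoroot, RootPairing.Base.IsHighest, RootPairing.Base.flip_isPos_iff]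
  rfl

theorem coheight_pos_iff (i : ι) : 0 < coheight b i ↔ b.IsPos i :=
  RootPairing.Base.flip_isPos_iff b i

/-- The point where every coroot takes the value coheight divided by `M` lies inside the alcove.
Positivity is tested at this point, scaled by `M` to stay in the integers. -/
theorem affPos_iff {M : ℤ} (hM : ∀ i, |coheight b i| < M) (i : ι) (k : ℤ) :
    AffPos b i k ↔ 0 < coheight b i + M * k := by
  have h := abs_lt.1 (hM i)
  rw [AffPos, ← coheight_pos_iff]
  rcases lt_trichotomy k 0 with hk | rfl | hk
  · constructor
    · rintro (h | h) <;> omega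
    · intro; nlinarith
  · simp
  · simp only [hk, true_or, true_iff]; nlinarith

theorem coheight_lt_of_smul_pos {M : ℤ} (hM : ∀ i, |coheight b i| < M) (x : ExtWeyl P)
    (hx : ∀ a ∈ affSimpleRoots b, AffPos b (x • a).1 (x • a).2) (a : AffRoot P)
    (ha : AffPos b a.1 a.2) : AffPos b (x • a).1 (x • a).2 := by
  -- Up to the scale `M`, the values of the coroots at the test point moved by `x⁻¹`. The simple
  -- affine roots give positivity on simple coroots and the bound `M` on highest ones; additivity
  -- extends both to all positive coroots.
  set φ : ι → ℤ := fun i => coheight b (P.weylGroupToPerm x.right i) -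
    M * corootEval P x.left.toAdd (P.weylGroupToPerm x.right i) with hφ
  have key : ∀ a : AffRoot P, AffPos b (x • a).1 (x • a).2 ↔ 0 < φ a.1 + M * a.2 := by
    intro a
    rw [affPos_iff b hM]
    change 0 < coheight b (P.weylGroupToPerm x.right a.1) +
      M * (a.2 - corootEval P _ (P.weylGroupToPerm x.right a.1)) ↔ _
    rw [hφ]
    ring_nf
  have hneg : ∀ i, φ (P.reflectionPerm i i) = -φ i := by
    intro i
    simp only [hφ, reflectionPerm_perm, coheight_reflectionPerm_self, corootEval_reflectionPerm,
      P.pairing_same]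
    ring
  have hb : ∀ i, b.IsPos i → 0 < φ i ∧ φ i < M := by
    intro i hi
    rw [← RootPairing.Base.flip_isPos_iff] at hi
    refine b.flip.additive_bounds (φ := φ) ?_ ?_ ?_ hi
    · intro i j k hk
      have h1 := coroot_perm_add P x.right hk
      have h2 : coheight b (P.weylGroupToPerm x.right k) =
          coheight b (P.weylGroupToPerm x.right i) + coheight b (P.weylGroupToPerm x.right j) :=
        b.flip.height_add h1
      simp only [hφ, h2, corootEval_eq_add P h1]
      ring
    · intro i hi
      simpa using (key (i, 0)).1 (hx (i, 0) (Or.inl ⟨hi, rfl⟩))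
    · intro i hi
      rw [← isHighestCoroot_iff] at hi
      have := (key (P.reflectionPerm i i, 1)).1 (hx _ (Or.inr ⟨i, hi, rfl⟩))
      simp only [hneg] at this
      omega
  rw [key]
  rcases ha with h | ⟨h, h'⟩
  · by_cases hp : b.IsPos a.1
    · have := hb _ hp; nlinarith
    · have := hb _ ((isPos_reflectionPerm_self b a.1).2 hp)
      rw [hneg] at this
      nlinarith
  · have := (hb _ h').1
    rw [h]; simpa using this

theorem affPos_affRefl_simple {j : ι} (hj : j ∈ b.support) {i : ι} {k : ℤ} (hi : AffPos b i k)
    (h : ((i, k) : ι × ℤ) ≠ (j, 0)) : AffPos b (P.reflectionPerm j i) k := by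
  rcases hi with hi | ⟨rfl, hi⟩
  · exact Or.inl hi
  · exact Or.inr ⟨rfl, hi.reflectionPerm hj fun h' => h (by rw [h'])⟩

/-- The critical cases are those where the new constant term is zero. For positive `i` this fixes
the affine root. For `i = -l` with `l ≠ j` the new coroot is `θ - l`; were it negative, adding the
positive `l - θ` to the highest `θ` would give a coroot. -/
theorem affPos_affRefl_highest {j : ι} (hj : IsHighestCoroot b j) {i : ι} {k : ℤ}
    (hi : AffPos b i k) (h : ((i, k) : ι × ℤ) ≠ (P.reflectionPerm j j, 1)) :
    AffPos b (P.reflectionPerm j i) (k + P.pairing j i) := by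
  have hj' := (isHighestCoroot_iff b j).1 hj
  have hroot : P.coroot (P.reflectionPerm j i) = P.coroot i - P.pairing j i • P.coroot j := by
    rw [P.coroot_reflectionPerm, P.coreflection_apply_coroot]
  have hneg : ∀ i j, P.pairing j (P.reflectionPerm i i) = - P.pairing j i := by simp
  have hself : P.reflectionPerm j (P.reflectionPerm j j) = j := P.reflectionPerm_self j j
  by_cases hp : b.IsPos i
  · have hp' := (RootPairing.Base.flip_isPos_iff b i).2 hp
    have h0 : 0 ≤ P.pairing j i := hj'.pairing_nonneg hp'
    have hk : 0 ≤ k := by rcases hi with hi | hi <;> omega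
    by_cases hk' : 0 < k + P.pairing j i
    · exact Or.inl hk'
    have h1 : P.pairing j i = 0 := by omega
    have h2 : P.reflectionPerm j i = i := P.coroot.injective (by rw [hroot, h1]; simp)
    rw [h2, h1, add_zero]
    exact hi
  · obtain ⟨l, rfl⟩ : ∃ l, P.reflectionPerm l l = i :=
      ⟨P.reflectionPerm i i, by let := P.indexNeg; exact neg_neg i⟩
    have hl : b.IsPos l := by by_contra hl; exact hp ((isPos_reflectionPerm_self b l).2 hl)
    have hl' := (RootPairing.Base.flip_isPos_iff b l).2 hl
    have hk : 0 < k := hi.resolve_right fun h => hp h.2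
    rw [hneg] at hroot ⊢
    by_cases hlj : l = j
    · subst hlj
      rw [P.pairing_same, hself]
      have : k ≠ 1 := by rintro rfl; exact h rfl
      by_cases hk2 : k = 2
      · exact Or.inr ⟨by omega, hl⟩
      · exact Or.inl (by omega)
    · have h1 : P.pairing j l ≤ 1 := hj'.pairing_le_one hl' hlj
      by_cases hk' : 0 < k + -P.pairing j l
      · exact Or.inl hk'
      have h2 : P.pairing j l = 1 := by omega
      refine Or.inr ⟨by omega, ?_⟩
      by_contra hm
      rw [← isPos_reflectionPerm_self, ← RootPairing.Base.flip_isPos_iff] at hm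
      refine hj'.root_add_notMem hm ⟨l, ?_⟩
      change P.coroot l = P.coroot j + P.coroot _
      rw [P.coroot_reflectionPerm, P.coreflection_apply_self, hroot, h2, P.coroot_reflectionPerm,
        P.coreflection_apply_self]
      module

/-- The reflection system of the extended affine Weyl group. -/
def refSys : RefSys (ExtWeyl P) (AffRoot P) where
  neg := affNeg
  pos a := AffPos b a.1 a.2
  simple := affSimpleRoots b
  r := affRefl P
  smul_negRoot := smul_affNeg
  pos_neg := by
    rintro ⟨i, k⟩
    exact affPos_neg_iff b i k
  r_smul := affRefl_smul_root
  r_self := affRefl_smul_self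
  r_mul_self := affRefl_mul_self
  simple_pos := by
    rintro a (⟨h1, h2⟩ | ⟨i, hi, rfl⟩)
    · exact Or.inr ⟨h2, b.isPos_of_mem_support h1⟩
    · exact Or.inl one_pos
  simple_perm := by
    rintro a ha ⟨i, k⟩ hc hne
    have h := affRefl_smul a i k
    change AffPos b (affRefl P a • (show AffRoot P from (i, k))).1
      (affRefl P a • (show AffRoot P from (i, k))).2
    rw [h]
    rcases ha with ⟨h1, h2⟩ | ⟨j, hj, rfl⟩
    · change AffPos b (P.reflectionPerm a.1 i) (k - a.2 * P.pairing a.1 i)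
      rw [h2, zero_mul, sub_zero]
      exact affPos_affRefl_simple b h1 hc fun h => hne (h.trans (Prod.ext rfl h2.symm))
    · have h1 := affPos_affRefl_highest b hj hc hne
      change AffPos b (P.reflectionPerm (P.reflectionPerm j j) i)
        (k - 1 * P.pairing (P.reflectionPerm j j) i)
      have h2 : P.reflectionPerm (P.reflectionPerm j j) i = P.reflectionPerm j i := by
        apply P.root.injective
        simp only [P.root_reflectionPerm, P.reflection_apply_root, P.pairing_reflectionPerm_self_right,
          P.pairing_same]
        module
      rw [h2]
      simpa using h1
  pos_of_simple x hx a ha := by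
    obtain ⟨M, hM⟩ := exists_coheight_lt b
    exact coheight_lt_of_smul_pos b hM x hx a ha
  finite_inv x := by
    -- The shift of the constant term under `x`; an inversion `(i, k)` has `0 ≤ k ≤ c i`.
    let c : ι → ℤ := fun i => corootEval P x.left.toAdd (P.weylGroupToPerm x.right i)
    obtain ⟨B, hB⟩ := (Set.finite_range c).bddAbove
    refine (Set.finite_univ.prod (Set.finite_Icc (0 : ℤ) B)).subset ?_
    rintro ⟨i, k⟩ ⟨h1, h2⟩
    refine ⟨trivial, ?_⟩
    change ¬ (0 < k - c i ∨ _) at h2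
    change 0 < k ∨ _ at h1
    have := hB ⟨i, rfl⟩
    refine ⟨?_, ?_⟩ <;> dsimp only <;> omega

end Based

end AffHecke

namespace RefSys

/-! ### Words in simple reflections and conjugates of simple reflections -/

variable {G R : Type*} [Group G] [MulAction G R] {D : RefSys G R}

theorem exists_wprod_mul (x : G) : ∃ l : List R, (∀ a ∈ l, a ∈ D.simple) ∧ l.length = D.len x ∧
    ∃ γ, D.len γ = 0 ∧ x = D.wprod l * γ := by
  induction x using D.induction_left with
  | h0 x hx => exact ⟨[], by simp, by simp [hx], x, hx, by simp⟩
  | h1 a ha x hx ih =>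
    obtain ⟨l, h1, h2, γ, h3, h4⟩ := ih
    refine ⟨a :: l, ?_, ?_, γ, h3, ?_⟩
    · simpa [ha] using h1
    · rw [len_r_mul ha hx, List.length_cons, h2]
    · rw [wprod_cons, mul_assoc, ← h4]

theorem len_prod_le {l : List G} (hl : ∀ s ∈ l, s ∈ D.r '' D.simple) :
    D.len l.prod ≤ l.length := by
  induction l with
  | nil => simp
  | cons s l ih =>
    obtain ⟨a, ha, rfl⟩ := hl s (by simp)
    rw [List.prod_cons, List.length_cons]
    exact (len_r_mul_le ha _).trans (Nat.succ_le_succ (ih fun s hs => hl s (by simp [hs])))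

/-- While the simple factors of `x` are applied one by one, the root must equal a simple root just
before it turns negative. -/
theorem exists_smul_simple {x : G} {a : R} (ha : D.pos a) (h : ¬ D.pos (x⁻¹ • a)) :
    ∃ y ∈ D.par D.simple, ∃ c ∈ D.simple, a = y • c := by
  induction x using D.induction_left generalizing a with
  | h0 x hx => exact absurd (len_eq_zero_iff.1 (by rwa [D.len_inv]) a ha) h
  | h1 s hs x _ ih =>
    by_cases has : a = s
    · exact ⟨1, one_mem _, s, hs, by simp [has]⟩
    · rw [mul_inv_rev, D.r_inv, mul_smul] at h
      obtain ⟨y, hy, c, hc, hac⟩ := ih (D.simple_perm s hs a ha has) h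
      refine ⟨D.r s * y, mul_mem (r_mem_par hs) hy, c, hc, ?_⟩
      rw [mul_smul, ← hac, ← mul_smul, D.r_mul_self, one_smul]

theorem exists_r_eq_conj (a : R) :
    ∃ y ∈ D.par D.simple, ∃ c ∈ D.simple, D.r a = y * D.r c * y⁻¹ := by
  obtain ⟨d, hd, hda⟩ := D.exists_pos a
  obtain ⟨y, hy, c, hc, h⟩ := exists_smul_simple (x := D.r d) hd (by
    rw [D.r_inv, D.r_self, D.pos_neg, not_not]; exact hd)
  exact ⟨y, hy, c, hc, by rw [← hda, h, D.r_smul]⟩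

end RefSys

namespace AffHecke

variable {ι X Y : Type*} [AddCommGroup X] [AddCommGroup Y] {P : RootDatum ι X Y} (b : P.Base)
  [Finite ι] [P.IsReduced]

/-! ### Length and Bruhat order -/

omit [Finite ι] [P.IsReduced] in
theorem affRefl_zero (i : ι) : affRefl P ((i, 0) : ι × ℤ) = ofW P (refl P i) := by
  change transl P (-0 • P.root i) * _ = _
  rw [neg_zero, zero_smul]
  exact one_mul _

theorem affRefl_highest (b : P.Base) (i : ι) :
    affRefl P ((P.reflectionPerm i i, 1) : ι × ℤ) = transl P (P.root i) * ofW P (refl P i) := by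
  have h := (refSys b).r_neg ((i, -1) : ι × ℤ)
  have h2 : (refSys b).neg ((i, -1) : ι × ℤ) = ((P.reflectionPerm i i, 1) : ι × ℤ) :=
    Prod.ext rfl (neg_neg (1 : ℤ))
  rw [h2] at h
  refine h.trans ?_
  change transl P (-(-1) • P.root i) * _ = _
  rw [neg_neg, one_smul]

theorem affSimple_eq : affSimple b = (refSys b).r '' (refSys b).simple := by
  ext s
  constructor
  · rintro (⟨i, hi, rfl⟩ | ⟨i, hi, rfl⟩)
    · exact ⟨((i, 0) : ι × ℤ), Or.inl ⟨hi, rfl⟩, affRefl_zero i⟩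
    · exact ⟨_, Or.inr ⟨i, hi, rfl⟩, affRefl_highest b i⟩
  · rintro ⟨⟨i, k⟩, ⟨h1, h2⟩ | ⟨j, hj, h⟩, rfl⟩
    · change k = 0 at h2
      subst h2
      exact Or.inl ⟨i, h1, affRefl_zero i⟩
    · rw [h]
      exact Or.inr ⟨j, hj, affRefl_highest b j⟩

theorem mem_alcoveStab_iff (x : ExtWeyl P) : x ∈ alcoveStab b ↔ (refSys b).len x = 0 := by
  rw [RefSys.len_eq_zero_iff]
  exact ⟨fun h c hc => h c.1 c.2 hc, fun h i k hik => h (i, k) hik⟩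

/-- A simple reflection changes the number of inversions by one and the stabilizer does not change
it, so words are at least that long; removing descents yields a word of exactly that length. -/
theorem length_eq_len : length b = (refSys b).len := by
  funext x
  have hx : (refSys b).len x ∈ {n | ∃ l : List (ExtWeyl P), (∀ s ∈ l, s ∈ affSimple b) ∧
      l.length = n ∧ ∃ γ ∈ alcoveStab b, x = l.prod * γ} := by
    obtain ⟨l, h1, h2, γ, h3, h4⟩ := (refSys b).exists_wprod_mul x
    refine ⟨l.map (refSys b).r, ?_, by simpa using h2, γ, (mem_alcoveStab_iff b γ).2 h3, h4⟩
    intro s hs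
    rw [affSimple_eq]
    obtain ⟨a, ha, rfl⟩ := List.mem_map.1 hs
    exact ⟨a, h1 a ha, rfl⟩
  refine le_antisymm (Nat.sInf_le hx) (le_csInf ⟨_, hx⟩ ?_)
  rintro n ⟨l, h1, rfl, γ, h2, rfl⟩
  rw [RefSys.len_mul_of_len_eq_zero' ((mem_alcoveStab_iff b γ).1 h2)]
  exact RefSys.len_prod_le fun s hs => by rw [← affSimple_eq]; exact h1 s hs

theorem par_simple_le : (refSys b).par (refSys b).simple ≤ affWeyl P := by
  rw [RefSys.par, ← affSimple_eq, Subgroup.closure_le]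
  have h1 : ∀ w, ofW P w ∈ affWeyl P := fun w => Subgroup.subset_closure (Or.inl ⟨w, rfl⟩)
  rintro s (⟨i, -, rfl⟩ | ⟨i, -, rfl⟩)
  · exact h1 _
  · exact mul_mem (Subgroup.subset_closure (Or.inr ⟨i, rfl⟩)) (h1 _)

theorem isAffReflection_iff (t : ExtWeyl P) :
    IsAffReflection b t ↔ ∃ a, t = (refSys b).r a := by
  rw [IsAffReflection, affSimple_eq]
  constructor
  · rintro ⟨y, -, _, ⟨c, -, rfl⟩, rfl⟩
    exact ⟨y • c, ((refSys b).r_smul y c).symm⟩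
  · rintro ⟨a, rfl⟩
    obtain ⟨y, hy, c, hc, h⟩ := (refSys b).exists_r_eq_conj a
    exact ⟨y, par_simple_le b hy, _, ⟨c, hc, rfl⟩, h⟩

theorem bruhatLE_eq_le : BruhatLE b = (refSys b).Le := by
  unfold BruhatLE RefSys.Le
  congr 1
  funext x x'
  rw [length_eq_len]
  apply propext
  simp only [isAffReflection_iff]
  constructor
  · rintro ⟨_, ⟨a, rfl⟩, h⟩; exact ⟨a, h⟩
  · rintro ⟨a, h⟩; exact ⟨_, ⟨a, rfl⟩, h⟩

theorem bruhatLT_eq_lt : BruhatLT b = (refSys b).Lt := by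
  funext x x'
  rw [BruhatLT, bruhatLE_eq_le]
  rfl

/-! ### The standard basis -/

omit [Finite ι] [P.IsReduced] in
theorem stdT_one : stdT b 1 = 1 := by
  rw [stdT, RingQuot.mkAlgHom_rel A (HeckeRel.one (b := b)), map_one]

theorem stdT_mul {x y : ExtWeyl P}
    (h : (refSys b).len (x * y) = (refSys b).len x + (refSys b).len y) :
    stdT b x * stdT b y = stdT b (x * y) := by
  rw [stdT, stdT, stdT, ← map_mul]
  exact RingQuot.mkAlgHom_rel A (HeckeRel.mul x y (by rwa [length_eq_len]))

theorem stdT_sq {a : AffRoot P} (ha : a ∈ (refSys b).simple) :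
    stdT b ((refSys b).r a) * stdT b ((refSys b).r a) =
      v 2 • stdT b 1 + (v 2 - 1) • stdT b ((refSys b).r a) := by
  have h := RingQuot.mkAlgHom_rel A (HeckeRel.sq (b := b) ((refSys b).r a) (by
    rw [affSimple_eq]; exact ⟨a, ha, rfl⟩))
  rw [map_mul, map_add, map_smul, map_smul] at h
  exact h

/-- The relations hold in the regular representation, where `T_x` sends the basis vector at `1` to
the one at `x`. -/
theorem linearIndependent_stdT : LinearIndependent A (stdT b) := by
  obtain ⟨L, h1, h2, h3, h4⟩ := (refSys b).exists_regular_rep (v 2 : A)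
  have hL : ∀ ⦃x y⦄, HeckeRel b x y → FreeAlgebra.lift A L x = FreeAlgebra.lift A L y := by
    rintro _ _ (_ | ⟨x, y, h⟩ | ⟨s, h⟩)
    · simp [h1]
    · rw [length_eq_len] at h
      simp [h2 _ _ h]
    · rw [affSimple_eq] at h
      obtain ⟨a, ha, rfl⟩ := h
      simp only [map_mul, map_add, map_smul, FreeAlgebra.lift_ι_apply]
      exact h3 a ha
  let φ : Hecke b →ₐ[A] Module.End A (ExtWeyl P →₀ A) :=
    RingQuot.liftAlgHom A ⟨FreeAlgebra.lift A L, hL⟩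
  have hφ : ∀ x, φ (stdT b x) = L x := by
    intro x
    simp only [φ, stdT, RingQuot.liftAlgHom_mkAlgHom_apply, FreeAlgebra.lift_ι_apply]
  refine LinearIndependent.of_comp ((LinearMap.applyₗ (Finsupp.single 1 1)).comp φ.toLinearMap) ?_
  have : ((LinearMap.applyₗ (Finsupp.single 1 1)).comp φ.toLinearMap) ∘ stdT b =
      (Finsupp.basisSingleOne : Module.Basis (ExtWeyl P) A _) := by
    funext x
    simp [hφ, h4]
  rw [this]
  exact Module.Basis.linearIndependent _

theorem stdT_mul_mem_span (x : ExtWeyl P) {h : Hecke b}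
    (hh : h ∈ Submodule.span A (Set.range (stdT b))) :
    stdT b x * h ∈ Submodule.span A (Set.range (stdT b)) := by
  set S := Submodule.span A (Set.range (stdT b)) with hS
  have hmem : ∀ y, stdT b y ∈ S := fun y => Submodule.subset_span ⟨y, rfl⟩
  have red : ∀ x, (∀ y, stdT b x * stdT b y ∈ S) → ∀ h ∈ S, stdT b x * h ∈ S := by
    intro x hx h hh
    have : S ≤ S.comap (LinearMap.mulLeft A (stdT b x)) := by
      rw [hS, Submodule.span_le]
      rintro _ ⟨y, rfl⟩
      exact hx y
    exact this hh
  induction x using (refSys b).induction_left generalizing h with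
  | h0 x hx =>
    refine red x (fun y => ?_) h hh
    rw [stdT_mul b (by rw [RefSys.len_mul_of_len_eq_zero hx, hx, zero_add])]
    exact hmem _
  | h1 a ha x hx ih =>
    rw [← stdT_mul b (by rw [RefSys.len_r_mul ha hx, RefSys.len_r ha, add_comm]), mul_assoc]
    refine red _ (fun y => ?_) _ (ih hh)
    by_cases hy : (refSys b).pos (y⁻¹ • a)
    · rw [stdT_mul b (by rw [RefSys.len_r_mul ha hy, RefSys.len_r ha, add_comm])]
      exact hmem _
    · have h1 := RefSys.len_r_mul_of_not ha hy
      have h2 : stdT b y = stdT b ((refSys b).r a) * stdT b ((refSys b).r a * y) := by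
        rw [stdT_mul b (by rw [RefSys.r_mul_r_mul, RefSys.len_r ha]; omega), RefSys.r_mul_r_mul]
      have h3 := h2
      rw [h2, ← mul_assoc, stdT_sq b ha, stdT_one, add_mul, smul_mul_assoc, smul_mul_assoc,
        one_mul, ← h3]
      exact add_mem (S.smul_mem _ (hmem _)) (S.smul_mem _ (hmem _))

/-- The span is stable under left multiplication by all generators, hence under the whole algebra,
and it contains `1`. -/
theorem span_stdT : ⊤ ≤ Submodule.span A (Set.range (stdT b)) := by
  set S := Submodule.span A (Set.range (stdT b)) with hS
  rintro h -
  obtain ⟨f, rfl⟩ := RingQuot.mkAlgHom_surjective A (HeckeRel b) h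
  have key : ∀ h ∈ S, RingQuot.mkAlgHom A (HeckeRel b) f * h ∈ S := by
    induction f using FreeAlgebra.induction with
    | grade0 t =>
      intro h hh
      rw [AlgHom.commutes, ← Algebra.smul_def]
      exact S.smul_mem _ hh
    | grade1 x => exact fun h hh => stdT_mul_mem_span b x hh
    | mul f g hf hg =>
      intro h hh
      rw [map_mul, mul_assoc]
      exact hf _ (hg _ hh)
    | add f g hf hg =>
      intro h hh
      rw [map_add, add_mul]
      exact add_mem (hf _ hh) (hg _ hh)
  have := key 1 (by rw [← stdT_one]; exact Submodule.subset_span ⟨1, rfl⟩)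
  rwa [mul_one] at this

/-- The standard basis of the extended affine Hecke algebra. -/
def heckeBasis : HeckeBasis (refSys b) (Hecke b) where
  T := Module.Basis.mk (linearIndependent_stdT b) (span_stdT b)
  T_one := by rw [Module.Basis.mk_apply, stdT_one]
  T_mul x y h := by
    simp only [Module.Basis.mk_apply]
    exact stdT_mul b h
  T_sq a ha := by
    simp only [Module.Basis.mk_apply]
    exact stdT_sq b ha

theorem heckeBasis_T (x : ExtWeyl P) : (heckeBasis b).T x = stdT b x :=
  Module.Basis.mk_apply (linearIndependent_stdT b) (span_stdT b) x

/-! ### The bar involution and the Kazhdan-Lusztig basis -/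

theorem isBar_iff (f : Hecke b ≃+* Hecke b) : IsBar b f ↔ (heckeBasis b).IsBar f := by
  constructor
  · intro h
    exact ⟨h.map_scalar, fun x => by simpa only [heckeBasis_T] using h.map_mul_eq_one x⟩
  · intro h
    refine ⟨h.map_scalar, fun x => ?_, fun x => ?_⟩
    · simpa only [heckeBasis_T] using h.map_mul_eq_one x
    · rw [← heckeBasis_T, ← heckeBasis_T, h.map_T, HeckeBasis.T_inv_mul_barT]

theorem existsUnique_isBar : ∃! f : Hecke b ≃+* Hecke b, IsBar b f := by
  obtain ⟨f, hf⟩ := (heckeBasis b).exists_isBar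
  exact ⟨f, (isBar_iff b f).2 hf, fun g hg => ((isBar_iff b g).1 hg).ext hf⟩

theorem isBar_bar : (heckeBasis b).IsBar (bar b) :=
  (isBar_iff b _).1 (Classical.epsilon_spec (existsUnique_isBar b).exists)

theorem isKL_iff (x : ExtWeyl P) (c : Hecke b) :
    IsKL b x c ↔ (heckeBasis b).IsKL (bar b) x c := by
  simp only [IsKL, HeckeBasis.IsKL, heckeBasis_T, bruhatLT_eq_lt, length_eq_len]

theorem existsUnique_isKL (x : ExtWeyl P) : ∃! c : Hecke b, IsKL b x c := by
  simp only [isKL_iff]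
  exact (heckeBasis b).existsUnique_isKL (isBar_bar b) x

theorem isKL_klC' (x : ExtWeyl P) : (heckeBasis b).IsKL (bar b) x (klC' b x) :=
  (isKL_iff b x _).1 (Classical.epsilon_spec (existsUnique_isKL b x).exists)

end AffHecke

namespace AffHecke

variable {ι X Y : Type*} [AddCommGroup X] [AddCommGroup Y] {P : RootDatum ι X Y}

/-! ### Parabolic subgroups -/

variable (P) in
/-- The affine root with linear part `i` and constant term zero. -/
def linearRoot (i : ι) : AffRoot P := (i, 0)

variable (P) in
/-- The affine roots with linear part in `I` and constant term zero. -/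
def linearRoots (I : Set ι) : Set (AffRoot P) := linearRoot P '' I

theorem ofW_injective : Function.Injective (ofW P) := SemidirectProduct.inr_injective

theorem ofW_smul (w : P.weylGroup) (i : ι) (k : ℤ) :
    ofW P w • (show AffRoot P from (i, k)) = (P.weylGroupToPerm w i, k) := by
  refine Prod.ext rfl ?_
  change k - corootEval P 0 _ = k
  simp

variable (b : P.Base) [Finite ι] [P.IsReduced]

theorem linearRoots_subset {I : Set ι} (hI : I ⊆ b.support) :
    linearRoots P I ⊆ (refSys b).simple := by
  rintro _ ⟨i, hi, rfl⟩
  exact Or.inl ⟨hI hi, rfl⟩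

theorem par_linearRoots (I : Set ι) :
    (refSys b).par (linearRoots P I) = (parab P I).map (ofW P) := by
  rw [parab, MonoidHom.map_closure, RefSys.par, linearRoots, Set.image_image, Set.image_image]
  congr 1
  exact Set.image_congr fun i _ => affRefl_zero i

theorem mem_par_linearRoots {I : Set ι} {x : ExtWeyl P} :
    x ∈ (refSys b).par (linearRoots P I) ↔ ∃ w ∈ parab P I, ofW P w = x := by
  rw [par_linearRoots, Subgroup.mem_map]

/-- Elements of `W` preserve constant terms, so their inversions have constant term zero. The
uniform bound yields the finiteness of `W_I`. -/
theorem len_ofW_le (w : P.weylGroup) : (refSys b).len (ofW P w) ≤ Nat.card ι := by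
  have h : (refSys b).inversions (ofW P w) ⊆ Set.range (linearRoot P) := by
    rintro ⟨i, k⟩ ⟨h1, h2⟩
    rw [ofW_smul] at h2
    change AffPos b i k at h1
    change ¬ AffPos b (P.weylGroupToPerm w i) k at h2
    have hk : k = 0 := by
      rcases h1 with h1 | h1
      · exact absurd (Or.inl h1) h2
      · exact h1.1
    exact ⟨i, by rw [hk]; rfl⟩
  refine (Set.ncard_le_ncard h (Set.finite_range _)).trans ?_
  rw [← Set.image_univ, ← Set.ncard_univ]
  exact Set.ncard_image_le Set.finite_univ

theorem par_linearRoots_finite {I : Set ι} (hI : I ⊆ b.support) :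
    ((refSys b).par (linearRoots P I) : Set (ExtWeyl P)).Finite := by
  refine RefSys.par_finite (linearRoots_subset b hI) ((Set.toFinite I).image _)
    (n := Nat.card ι) fun x hx => ?_
  obtain ⟨w, -, rfl⟩ := (mem_par_linearRoots b).1 hx
  exact len_ofW_le b w

theorem isParC_parabC {I : Set ι} (hI : I ⊆ b.support) :
    (heckeBasis b).IsParC (linearRoots P I) (par_linearRoots_finite b hI).toFinset
      (longestLength b I) (parabC b I) := by
  have hbdd : BddAbove (Set.range fun y : parab P I => length b (ofW P y)) := by
    refine ⟨Nat.card ι, ?_⟩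
    rintro _ ⟨y, rfl⟩
    dsimp only
    rw [length_eq_len]
    exact len_ofW_le b y
  have hcoe : ((par_linearRoots_finite b hI).toFinset : Set (ExtWeyl P)) =
      ofW P '' (parab P I : Set P.weylGroup) := by
    rw [Set.Finite.coe_toFinset, par_linearRoots]; rfl
  refine ⟨linearRoots_subset b hI, fun x => by simp, fun x hx => ?_, ?_, ?_⟩
  · rw [Set.Finite.mem_toFinset, SetLike.mem_coe, mem_par_linearRoots] at hx
    obtain ⟨w, hw, rfl⟩ := hx
    rw [← length_eq_len]
    exact le_ciSup hbdd ⟨w, hw⟩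
  · obtain ⟨w, hw⟩ := Nat.sSup_mem (Set.range_nonempty _) hbdd
    refine ⟨ofW P w, ?_, ?_⟩
    · rw [Set.Finite.mem_toFinset, SetLike.mem_coe, mem_par_linearRoots]
      exact ⟨w, w.2, rfl⟩
    · rw [← length_eq_len]; exact hw
  · rw [parabC, HeckeBasis.altSum]
    congr 1
    have h1 : ∀ x, HeckeBasis.altCoeff (refSys b) x • (heckeBasis b).T x =
        ((-1) ^ length b x * v (-2 * (length b x : ℤ))) • stdT b x := by
      intro x
      rw [heckeBasis_T, length_eq_len]; rfl
    simp only [h1]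
    rw [← finsum_mem_coe_finset, hcoe, finsum_mem_image ofW_injective.injOn]
    exact finsum_set_coe_eq_finsum_mem (s := (parab P I : Set P.weylGroup))
      (f := fun y => ((-1) ^ length b (ofW P y) * v (-2 * (length b (ofW P y) : ℤ))) •
        stdT b (ofW P y))

/-! ### Double cosets -/

theorem mem_dblCoset_iff {I J : Set ι} {lam : X} {z : P.weylGroup} {x : ExtWeyl P} :
    x ∈ dblCoset P I J lam z ↔ x ∈ HeckeBasis.dblCoset (refSys b) (linearRoots P I)
      (linearRoots P J) (transl P lam * ofW P z) := by
  constructor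
  · rintro ⟨u, hu, u', hu', rfl⟩
    exact ⟨_, (mem_par_linearRoots b).2 ⟨u, hu, rfl⟩, _, (mem_par_linearRoots b).2 ⟨u', hu', rfl⟩,
      rfl⟩
  · rintro ⟨x, hx, x', hx', rfl⟩
    obtain ⟨u, hu, rfl⟩ := (mem_par_linearRoots b).1 hx
    obtain ⟨u', hu', rfl⟩ := (mem_par_linearRoots b).1 hx'
    exact ⟨u, hu, u', hu', rfl⟩

section

variable {b} {I J : Set ι}

omit [Finite ι] [P.IsReduced] in
theorem minElt_mem (a : Index b I J) : minElt a ∈ dblCoset P I J a.1.1 a.1.2 :=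
  Function.argminOn_mem _ _ _

omit [Finite ι] [P.IsReduced] in
theorem length_minElt_le (a : Index b I J) {x : ExtWeyl P} (hx : x ∈ dblCoset P I J a.1.1 a.1.2) :
    length b (minElt a) ≤ length b x :=
  Function.argminOn_le _ _ hx

theorem isMin_minElt (hI : I ⊆ b.support) (hJ : J ⊆ b.support) (a : Index b I J) :
    HeckeBasis.IsMin (refSys b) (linearRoots P I) (linearRoots P J) (minElt a) := by
  have hmem := minElt_mem a
  have hle := fun x hx => length_minElt_le (x := x) a hx
  rw [length_eq_len] at hle
  obtain ⟨u, hu, u', hu', h⟩ := hmem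
  constructor
  · rintro _ ⟨i, hi, rfl⟩
    by_contra hn
    have h1 := RefSys.len_r_mul_of_not (linearRoots_subset b hI ⟨i, hi, rfl⟩) hn
    have h2 := hle _ ⟨refl P i * u, mul_mem (Subgroup.subset_closure ⟨i, hi, rfl⟩) hu, u', hu',
      rfl⟩
    have h3 : (refSys b).r (linearRoot P i) = ofW P (refl P i) := affRefl_zero i
    rw [h3] at h1
    rw [map_mul, mul_assoc, mul_assoc, ← mul_assoc (ofW P u), ← h] at h2
    omega
  · rintro _ ⟨j, hj, rfl⟩
    by_contra hn
    have h1 := RefSys.len_mul_r_of_not (linearRoots_subset b hJ ⟨j, hj, rfl⟩) hn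
    have h2 := hle _ ⟨u, hu, u' * refl P j, mul_mem hu' (Subgroup.subset_closure ⟨j, hj, rfl⟩),
      rfl⟩
    have h3 : (refSys b).r (linearRoot P j) = ofW P (refl P j) := affRefl_zero j
    rw [h3] at h1
    rw [map_mul, ← mul_assoc, ← h] at h2
    omega

/-- Take `g` in `W_K` minimizing the number of positive coroots that are negative on `g • x`. -/
theorem exists_dominant {K : Set ι} (hK : K ⊆ b.support) (x : X) :
    ∃ g ∈ parab P K, ∀ k ∈ K, 0 ≤ corootEval P (g • x) k := by
  let N : P.weylGroup → Set ι := fun g => {i | b.IsPos i ∧ corootEval P (g • x) i < 0}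
  have hne : (parab P K : Set P.weylGroup).Nonempty := ⟨1, one_mem _⟩
  let g := Function.argminOn (fun g => (N g).ncard) (parab P K : Set P.weylGroup) hne
  have hg : g ∈ parab P K := Function.argminOn_mem _ _ hne
  refine ⟨g, hg, fun k hk => ?_⟩
  by_contra! hlt
  have hle : (N g).ncard ≤ (N (refl P k * g)).ncard :=
    Function.argminOn_le (fun g => (N g).ncard) _
      (mul_mem (Subgroup.subset_closure ⟨k, hk, rfl⟩) hg : refl P k * g ∈ parab P K)
  have hsymm : (P.weylGroupToPerm (refl P k)).symm = P.reflectionPerm k := by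
    rw [weylGroupToPerm_refl]; exact P.reflectionPerm_symm k
  have hev : ∀ i, corootEval P ((refl P k * g) • x) i =
      corootEval P (g • x) (P.reflectionPerm k i) := by
    intro i
    rw [mul_smul, corootEval_smul, hsymm]
  have hkk : corootEval P (g • x) (P.reflectionPerm k k) = -corootEval P (g • x) k := by
    rw [corootEval_reflectionPerm, P.pairing_same]; ring
  -- The simple reflection permutes the positive roots other than `k`, while `k` itself stops being
  -- counted: the number would drop.
  have hsub : P.reflectionPerm k '' N (refl P k * g) ⊆ N g \ {k} := by
    rintro _ ⟨i, ⟨hi, hi'⟩, rfl⟩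
    rw [hev] at hi'
    have hik : i ≠ k := by
      rintro rfl
      rw [hkk] at hi'
      omega
    refine ⟨⟨hi.reflectionPerm (hK hk) hik, hi'⟩, fun h => ?_⟩
    have h' : P.reflectionPerm k i = k := h
    have h2 := congrArg (P.reflectionPerm k) h'
    rw [P.reflectionPerm_self] at h2
    rw [h2] at hi
    exact (isPos_reflectionPerm_self b k).1 hi (b.isPos_of_mem_support (hK hk))
  have h1 := Set.ncard_le_ncard hsub (Set.toFinite _)
  rw [Set.ncard_image_of_injective _ (P.reflectionPerm k).injective] at h1
  have h2 : (N g \ {k}).ncard < (N g).ncard :=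
    Set.ncard_sdiff_singleton_lt_of_mem ⟨b.isPos_of_mem_support (hK hk), hlt⟩ (Set.toFinite _)
  omega

omit [Finite ι] [P.IsReduced] in
theorem exists_mem_minReps (I J : Set ι) (w : P.weylGroup) :
    ∃ z ∈ minReps b I J, ∃ u ∈ parab P I, ∃ u' ∈ parab P J, w = u * z * u' := by
  let S : Set P.weylGroup := {z | ∃ u ∈ parab P I, ∃ u' ∈ parab P J, z = u * w * u'}
  have hne : S.Nonempty := ⟨w, 1, one_mem _, 1, one_mem _, by simp⟩
  obtain ⟨z, ⟨u, hu, u', hu', h⟩, hle⟩ : ∃ z ∈ S, ∀ z' ∈ S,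
      length b (ofW P z) ≤ length b (ofW P z') :=
    ⟨_, Function.argminOn_mem (fun z => length b (ofW P z)) S hne, fun z hz =>
      Function.argminOn_le (fun z => length b (ofW P z)) S hz⟩
  refine ⟨z, fun y hy y' hy' => hle _ ?_, u⁻¹, inv_mem hu, u'⁻¹, inv_mem hu', by rw [h]; group⟩
  exact ⟨y * u, mul_mem hy hu, u' * y', mul_mem hu' hy', by rw [h]; group⟩

/-- Write the finite part as `u z u'`. The translation part can still be moved by `g` in the
subgroup generated by the `s_i`, `i ∈ I`, that lie in `z J z⁻¹`: `g` is absorbed on the left by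
`W_I` and, conjugated by `z`, on the right by `W_J`. This suffices for dominance. -/
theorem exists_index (hI : I ⊆ b.support) (x : ExtWeyl P) :
    ∃ a : Index b I J, x ∈ dblCoset P I J a.1.1 a.1.2 := by
  obtain ⟨z, hz, u, hu, u', hu', hw⟩ := exists_mem_minReps (b := b) I J x.right
  let K : Set ι := {i ∈ I | ∃ j ∈ J, refl P i = z * refl P j * z⁻¹}
  have hKI : K ⊆ I := fun i hi => hi.1
  obtain ⟨g, hg, hdom⟩ := exists_dominant (hKI.trans hI) (u⁻¹ • x.left.toAdd)
  have hgI : g ∈ parab P I := Subgroup.closure_mono (Set.image_mono hKI) hg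
  have hgJ : z⁻¹ * g * z ∈ parab P J := by
    have : parab P K ≤ (parab P J).map (MulAut.conj z).toMonoidHom := by
      rw [parab, Subgroup.closure_le]
      rintro _ ⟨i, ⟨-, j, hj, h⟩, rfl⟩
      exact ⟨refl P j, Subgroup.subset_closure ⟨j, hj, rfl⟩, h.symm⟩
    obtain ⟨y, hy, rfl⟩ := this hg
    have h : z⁻¹ * (z * y * z⁻¹) * z = y := by group
    change z⁻¹ * (z * y * z⁻¹) * z ∈ _
    rwa [h]
  refine ⟨⟨(g • u⁻¹ • x.left.toAdd, z), hz, fun i hi h => hdom i ⟨hi, h⟩⟩,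
    u * g⁻¹, mul_mem hu (inv_mem hgI), z⁻¹ * g * z * u', mul_mem hgJ hu', ?_⟩
  change x = ofW P (u * g⁻¹) * (transl P (g • u⁻¹ • x.left.toAdd) * ofW P z) *
    ofW P (z⁻¹ * g * z * u')
  rw [← mul_assoc (ofW P _), ofW_mul_transl, mul_assoc (transl P _), mul_assoc (transl P _),
    ← map_mul, ← map_mul, mul_smul u, inv_smul_smul, smul_inv_smul]
  have h : u * g⁻¹ * z * (z⁻¹ * g * z * u') = x.right := by rw [hw]; group
  rw [h, transl_mul_ofW]

theorem exists_mem_dblCoset_minElt (hI : I ⊆ b.support) (x : ExtWeyl P) :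
    ∃ a : Index b I J, x ∈ HeckeBasis.dblCoset (refSys b) (linearRoots P I)
      (linearRoots P J) (minElt a) := by
  obtain ⟨a, ha⟩ := exists_index (b := b) (J := J) hI x
  refine ⟨a, ?_⟩
  obtain ⟨u, hu, u', hu', h⟩ := (mem_dblCoset_iff b).1 ha
  obtain ⟨w, hw, w', hw', h'⟩ := (mem_dblCoset_iff b).1 (minElt_mem a)
  refine ⟨u * w⁻¹, mul_mem hu (inv_mem hw), w'⁻¹ * u', mul_mem (inv_mem hw') hu', ?_⟩
  rw [h, h']
  group

/-! ### The main theorem -/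

omit [Finite ι] [P.IsReduced] in
theorem chi_apply (h : Hecke b) : chi b I J h = parabC b I * h * parabC b J := rfl

theorem isKLIJ_iff (a : Index b I J) (h : Hecke b) :
    IsKLIJ a h ↔
      (heckeBasis b).IsKLIJ (parabC b I) (parabC b J) minElt (bar b) a h := by
  simp only [IsKLIJ, HeckeBasis.IsKLIJ, heckeBasis_T, bruhatLT_eq_lt, length_eq_len, stdTIJ,
    chi_apply]

theorem bar_mem_HIJ (hI : I ⊆ b.support) (hJ : J ⊆ b.support) {h : Hecke b} (hh : h ∈ HIJ b I J) :
    bar b h ∈ HIJ b I J := by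
  obtain ⟨g, rfl⟩ := hh
  refine ⟨bar b g, ?_⟩
  rw [chi_apply, chi_apply, map_mul, map_mul, (isParC_parabC b hI).map_eq (isBar_bar b),
    (isParC_parabC b hJ).map_eq (isBar_bar b)]

end

end AffHecke

end

theorem mainTheorem10 {ι X Y : Type*} [Finite ι] [AddCommGroup X] [AddCommGroup Y]
    [Module.Finite ℤ X] [Module.Finite ℤ Y] (P : RootDatum ι X Y) [P.IsReduced] (b : P.Base) :
    (∃! f : AffHecke.Hecke b ≃+* AffHecke.Hecke b, AffHecke.IsBar b f) ∧
    (∀ x : AffHecke.ExtWeyl P, ∃! c : AffHecke.Hecke b, AffHecke.IsKL b x c) ∧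
    ∀ I J : Set ι, I ⊆ b.support → J ⊆ b.support →
      (∀ h ∈ AffHecke.HIJ b I J, AffHecke.bar b h ∈ AffHecke.HIJ b I J) ∧
      ∀ a : AffHecke.Index b I J,
        AffHecke.klC'IJ a ∈ AffHecke.HIJ b I J ∧
        AffHecke.IsKLIJ a (AffHecke.klC'IJ a) ∧
        ∀ h ∈ AffHecke.HIJ b I J, AffHecke.IsKLIJ a h → h = AffHecke.klC'IJ a := by
  refine ⟨AffHecke.existsUnique_isBar b, AffHecke.existsUnique_isKL b, fun I J hI hJ => ?_⟩
  have hc := AffHecke.isParC_parabC b hI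
  have hc' := AffHecke.isParC_parabC b hJ
  have hf := AffHecke.isBar_bar b
  have hm : ∀ a : AffHecke.Index b I J, _ := AffHecke.isMin_minElt hI hJ
  have hm' := AffHecke.exists_mem_dblCoset_minElt (b := b) (J := J) hI
  have hkl : ∀ a : AffHecke.Index b I J, AffHecke.IsKLIJ a (AffHecke.klC'IJ a) := fun a =>
    (AffHecke.isKLIJ_iff a _).2 (hc.isKLIJ hc' hf hm hm' a (AffHecke.isKL_klC' b _))
  refine ⟨fun h hh => AffHecke.bar_mem_HIJ hI hJ hh, fun a => ⟨⟨_, rfl⟩, hkl a, fun h _ hh => ?_⟩⟩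
  exact hc.isKLIJ_ext hc' hf hm hm' a ((AffHecke.isKLIJ_iff a _).1 hh)
    ((AffHecke.isKLIJ_iff a _).1 (hkl a))
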